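/- Let $n\ge 3$ and $m=\lfloor n/2\rfloor$, let $\mathcal A$ be the $n\times n$ anti-diagonal matrix with anti-diagonal entries $1$, and let $R$ be $\mathbb R$ or $\mathbb Z_p$ ($p$ prime), with its usual absolute value $|\cdot|$ and its additive Haar measure (Lebesgue measure on $\mathbb R$; total mass $1$ on $\mathbb Z_p$). Let $G=\mathrm{SO}_{\mathcal A}$ if $n$ is odd and $G=\mathrm O_{\mathcal A}/\mu_2$ if $n$ is even, and let $\mathcal P\subset G$ be the lower-triangular subgroup. For $n$ even, $G(R)$ is the group of pairs $(g,c)\in \mathrm{GL}_n(R)\times R^\times$ with $g^t\mathcal A g=c\mathcal A$, modulo the pairs $(a\cdot\mathrm{id},a^2)$, $a\in R^\times$; for $n$ odd put $c=1$. Let $W_0(R)$ be the set of symmetric matrices $B=[b_{ij}]$ over $R$ with $b_{ij}=0$ for $i+j<n$. The group $\mathcal P(R)$ acts on $W_0(R)$ by $g\cdot B=c^{-1}gBg^t$. Let $dB$ be the product measure in the coordinates $b_{ij}$ ($i\le j$, $i+j\ge n$). Let $U(R)$ be the set of monic degree-$n$ polynomials over $R$ and $df$ the product measure in the coefficients. Put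 $\mathrm{inv}(B)=(-1)^{m}\det(x\mathcal A+B)\in U(R)$, and $$\lambda(B)=\prod_{i=1}^{m} b_{i(n-i)}^{2i-1}\ (n\text{ odd}),\qquad \lambda(B)=b_{\frac n2\frac n2}^{\frac{n-2}2}\prod_{i=1}^{\frac{n-2}2} b_{i(n-i)}^{2i-1}\ (n\text{ even}).$$ Every $h\in \mathcal P(R)$ is uniquely $h=su$, where $u$ is a lower-triangular unipotent element of $\mathrm O_{\mathcal A}(R)$ and $s$ is in the diagonal torus of $\mathcal P(R)$. The torus is $(R^\times)^m$ with coordinates $s_1,\dots,s_m$ given on $\mathrm{diag}(t_1,\dots,t_n)$, $t_it_{n+1-i}=c$, by $s_i=t_{i+1}/t_i$ for $i<m$, and $s_m=1/t_m$ for $n$ odd, $s_m=c/(t_{m-1}t_m)$ for $n$ even. Let $d^\times s=\prod_i ds_i/|s_i|$. Let $du$ be the Haar measure on the unipotent group $N(R)$ which in the coordinates $u_{ij}$ (the entries with $1\le j<i$, $i+j\le n$) is $\prod du_{ij}$ for $n$ even and $|2|^{-m}\prod du_{ij}$ for $n$ odd, so that $N(\mathbb Z)$ has covolume $1$ in $N(\mathbb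 R)$ and $N(\mathbb Z_p)$ has volume $1$. Let $$\delta(s)=\prod_{i=1}^{m}s_i^{i^2-2im}\ (n\text{ odd}),\qquad \delta(s)=(s_{m-1}s_m)^{-\frac{n^2-2n}{8}}\prod_{i=1}^{m-2}s_i^{i^2-i(n-1)}\ (n\text{ even}),$$ and let $dh=|\delta(s)|^{-1}\,du\,d^\times s$, a right Haar measure on $\mathcal P(R)$. For $J\in\mathbb Q^\times$ consider the change-of-variables formula over $R$ $$\int_{W_0(R)}\phi(B)\,|\lambda(B)|\,dB=|J|\int_{\substack{f\in U(R)\\ \mathrm{disc}(f)\ne0}}\Bigl(\sum_{B\in \mathcal P(R)\backslash(\mathrm{inv}^{-1}(f)\cap W_0(R))}\int_{\mathcal P(R)}\phi(h\cdot B)\,dh\Bigr)df,$$ required for all measurable $\phi:W_0(R)\to[0,\infty]$ and for all measurable $\phi:W_0(R)\to\mathbb R$ such that $\phi|\lambda|$ is integrable (in which case the outer integral on the right converges absolutely). Then there is $J\in\mathbb Q^\times$ for which the formula holds over $\mathbb R$ and over $\mathbb Z_p$ for every prime $p$ (with $|J|$ the absolute value of $R$). Every such $J$ has real absolute value $$|J|=1\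 \text{ if } n \text{ is odd},\qquad |J|=2^{-n/2}\ \text{ if } n\text{ is even}.$$ Moreover the formula over $\mathbb R$ alone forces this value of $|J|$, and the formula over $\mathbb Z_p$ alone forces $|J|_p=1$ for $n$ odd and $|J|_p=|2^{-n/2}|_p$ for $n$ even. -/

import Mathlib

open MeasureTheory Matrix Polynomial
open scoped ENNReal

noncomputable section

namespace OrbitJacobian

/-! ### The quadratic form, the space `W₀` and the invariant polynomial -/

section Space

variable (n : ℕ) (R : Type*) [CommRing R]

/-- The anti-diagonal `n × n` matrix with all anti-diagonal entries equal to `1`. -/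
def antidiag : Matrix (Fin n) (Fin n) R :=
  Matrix.of fun i j => if j = i.rev then 1 else 0

/-- `W₀(R)`: symmetric `n × n` matrices `[b_ij]` with `b_ij = 0` for `i + j < n`
(with indices starting at `1`; here they start at `0`). -/
def W0 : Type _ :=
  {B : Matrix (Fin n) (Fin n) R //
    B.IsSymm ∧ ∀ i j : Fin n, (i : ℕ) + (j : ℕ) + 2 < n → B i j = 0}

/-- The positions `(i, j)`, `i ≤ j`, `i + j ≥ n` (indices from `1`) of the coordinates of `W₀`. -/
abbrev W0Index : Type :=
  {q : Fin n × Fin n // q.1 ≤ q.2 ∧ n ≤ (q.1 : ℕ) + (q.2 : ℕ) + 2}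

variable {n R}

/-- The element of `W₀(R)` with given coordinates. -/
def W0.ofCoords (x : W0Index n → R) : W0 n R :=
  ⟨Matrix.of fun i j =>
      if h : n ≤ (i : ℕ) + (j : ℕ) + 2 then
        x ⟨(min i j, max i j), min_le_max, by
          rcases le_total i j with hij | hij
          · simpa [hij] using h
          · simpa [hij, add_comm (j : ℕ)] using h⟩
      else 0, by
    constructor
    · ext i j
      simp only [Matrix.transpose_apply, Matrix.of_apply, min_comm i j, max_comm i j,
        add_comm (i : ℕ) (j : ℕ)]
    · intro i j hij
      simp only [Matrix.of_apply]
      rw [dif_neg (by omega)]⟩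

/-- The invariant polynomial `inv(B) = (-1)^⌊n/2⌋ det (x A + B)`. -/
def W0.inv (B : W0 n R) : R[X] :=
  (-1) ^ (n / 2) * ((X : R[X]) • (antidiag n R).map C + B.1.map C).det

/-- The weight: for `n` odd, `λ(B) = ∏_{i=1}^{⌊n/2⌋} b_{i,n-i}^{2i-1}`; for `n` even,
`λ(B) = b_{n/2,n/2}^{(n-2)/2} ∏_{i=1}^{(n-2)/2} b_{i,n-i}^{2i-1}` (indices from `1`;
below `i = k + 1`, and `2 i = n` occurs only for `n` even). -/
def W0.lam (B : W0 n R) : R :=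
  ∏ k : Fin (n / 2),
    B.1 ⟨k, by omega⟩ ⟨n - 2 - k, by omega⟩ ^
      (if 2 * ((k : ℕ) + 1) = n then (n - 2) / 2 else 2 * (k : ℕ) + 1)

/-- The monic polynomial `x^n + ∑_{i<n} c_i x^i`; thus `Fin n → R` parametrizes `U(R)`. -/
def monicPoly (c : Fin n → R) : R[X] := X ^ n + ∑ i : Fin n, C (c i) * X ^ (i : ℕ)

end Space

/-! ### Groups -/

section Groups

variable (n : ℕ) (R : Type*) [CommRing R]

/-- Invertible lower-triangular matrices. -/
def lowerGL : Subgroup (GL (Fin n) R) where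
  carrier := {g | ∀ i j : Fin n, i < j → g.1 i j = 0}
  one_mem' := by
    intro i j hij
    simp [Matrix.one_apply_ne hij.ne]
  mul_mem' := by
    intro a b ha hb i j hij
    simp only [Units.val_mul, Matrix.mul_apply]
    refine Finset.sum_eq_zero fun k _ => ?_
    rcases lt_or_ge i k with h | h
    · rw [ha i k h, zero_mul]
    · rw [hb k j (lt_of_le_of_lt h hij), mul_zero]
  inv_mem' := by
    intro a ha
    have h1 : a.1.BlockTriangular OrderDual.toDual := fun i j hij => ha i j hij
    have h2 : (a.1⁻¹).BlockTriangular OrderDual.toDual := by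
      have : Invertible a.1 := a.invertible
      exact Matrix.blockTriangular_inv_of_blockTriangular h1
    intro i j hij
    rw [Matrix.coe_units_inv]
    exact h2 hij

/-- The orthogonal group `O_A(R) = {g ∈ GL_n(R) : gᵀ A g = A}`. -/
def orthGroup : Subgroup (GL (Fin n) R) where
  carrier := {g | g.1ᵀ * antidiag n R * g.1 = antidiag n R}
  one_mem' := by simp
  mul_mem' := by
    intro a b ha hb
    have e : (a * b).1ᵀ * antidiag n R * (a * b).1
        = b.1ᵀ * (a.1ᵀ * antidiag n R * a.1) * b.1 := by
      simp only [Units.val_mul, Matrix.transpose_mul, Matrix.mul_assoc]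
    show _ = _
    rw [e, ha, hb]
  inv_mem' := by
    intro a ha
    have h1 : a.1 * a⁻¹.1 = 1 := by rw [← Units.val_mul, mul_inv_cancel, Units.val_one]
    have h2 : a⁻¹.1ᵀ * a.1ᵀ = 1 := by rw [← Matrix.transpose_mul, h1, Matrix.transpose_one]
    show _ = _
    calc a⁻¹.1ᵀ * antidiag n R * a⁻¹.1
        = a⁻¹.1ᵀ * (a.1ᵀ * antidiag n R * a.1) * a⁻¹.1 := by rw [ha]
      _ = (a⁻¹.1ᵀ * a.1ᵀ) * antidiag n R * (a.1 * a⁻¹.1) := by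
          simp only [Matrix.mul_assoc]
      _ = antidiag n R := by rw [h1, h2]; simp

/-- The similitudes of `A`: pairs `(g, c)` with `gᵀ A g = c A` and `c` a unit
(`c` is determined by `g` as soon as `n ≥ 1`). -/
def simGroup : Subgroup (GL (Fin n) R × Rˣ) where
  carrier := {x | x.1.1ᵀ * antidiag n R * x.1.1 = x.2.1 • antidiag n R}
  one_mem' := by simp
  mul_mem' := by
    intro a b ha hb
    have e : (a * b).1.1ᵀ * antidiag n R * (a * b).1.1
        = b.1.1ᵀ * (a.1.1ᵀ * antidiag n R * a.1.1) * b.1.1 := by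
      simp only [Prod.fst_mul, Units.val_mul, Matrix.transpose_mul, Matrix.mul_assoc]
    show _ = _
    rw [e, ha, Matrix.mul_smul, Matrix.smul_mul, hb, smul_smul]
    rfl
  inv_mem' := by
    intro a ha
    have h1 : a.1.1 * a.1⁻¹.1 = 1 := by rw [← Units.val_mul, mul_inv_cancel, Units.val_one]
    have h2 : a.1⁻¹.1ᵀ * a.1.1ᵀ = 1 := by
      rw [← Matrix.transpose_mul, h1, Matrix.transpose_one]
    have h3 : antidiag n R = a.2.1 • (a.1⁻¹.1ᵀ * antidiag n R * a.1⁻¹.1) := by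
      calc antidiag n R
          = (a.1⁻¹.1ᵀ * a.1.1ᵀ) * antidiag n R * (a.1.1 * a.1⁻¹.1) := by rw [h1, h2]; simp
        _ = a.1⁻¹.1ᵀ * (a.1.1ᵀ * antidiag n R * a.1.1) * a.1⁻¹.1 := by
            simp only [Matrix.mul_assoc]
        _ = _ := by rw [ha, Matrix.mul_smul, Matrix.smul_mul]
    show a.1⁻¹.1ᵀ * antidiag n R * a.1⁻¹.1 = a.2⁻¹.1 • antidiag n R
    conv_rhs => rw [h3]
    rw [smul_smul, ← Units.val_mul, inv_mul_cancel, Units.val_one, one_smul]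

/-- `N(R)`: the lower-triangular unipotent elements of `O_A(R)`. -/
def unipGroup : Subgroup (GL (Fin n) R) where
  carrier := {g | g ∈ orthGroup n R ∧ g ∈ lowerGL n R ∧ ∀ i, g.1 i i = 1}
  one_mem' := ⟨one_mem _, one_mem _, by simp⟩
  mul_mem' := by
    rintro a b ⟨ha, ha', ha1⟩ ⟨hb, hb', hb1⟩
    refine ⟨mul_mem ha hb, mul_mem ha' hb', fun i => ?_⟩
    simp only [Units.val_mul, Matrix.mul_apply]
    rw [Finset.sum_eq_single i, ha1, hb1, mul_one]
    · intro k _ hk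
      rcases lt_or_gt_of_ne hk with h | h
      · rw [hb' k i h, mul_zero]
      · rw [ha' i k h, zero_mul]
    · simp
  inv_mem' := by
    rintro a ⟨ha, ha', ha1⟩
    have hi : a⁻¹ ∈ lowerGL n R := inv_mem ha'
    refine ⟨inv_mem ha, hi, fun i => ?_⟩
    have h1 : (a.1 * a⁻¹.1) i i = 1 := by
      rw [← Units.val_mul, mul_inv_cancel, Units.val_one, Matrix.one_apply_eq]
    rw [Matrix.mul_apply, Finset.sum_eq_single i, ha1, one_mul] at h1
    · exact h1
    · intro k _ hk
      rcases lt_or_gt_of_ne hk with h | h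
      · rw [hi k i h, mul_zero]
      · rw [ha' i k h, zero_mul]
    · simp

/-- For `n` odd: `P(R)`, the lower-triangular subgroup of
`G(R) = SO_A(R) = {g ∈ SL_n(R) : gᵀ A g = A}`. -/
def POdd : Subgroup (GL (Fin n) R) :=
  orthGroup n R ⊓ lowerGL n R ⊓ (Matrix.GeneralLinearGroup.det).ker

/-- The lower-triangular similitudes of `A`. -/
def lowerSim : Subgroup (GL (Fin n) R × Rˣ) :=
  simGroup n R ⊓ (lowerGL n R).prod ⊤

/-- The scalar matrices `a • 1` (of multiplier `a²`) inside the lower-triangular similitudes. -/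
def scalarHom : Rˣ →* lowerSim n R where
  toFun a := ⟨(Units.map (Matrix.scalar (Fin n)).toMonoidHom a, a ^ 2), by
    refine ⟨?_, ?_, trivial⟩
    · show (Matrix.scalar (Fin n) a.1)ᵀ * antidiag n R * Matrix.scalar (Fin n) a.1
        = (a ^ 2 : Rˣ).1 • antidiag n R
      ext i j
      simp [Matrix.scalar_apply, Matrix.diagonal_transpose, Matrix.mul_diagonal,
        Matrix.diagonal_mul]
      ring
    · intro i j hij
      show Matrix.scalar (Fin n) a.1 i j = 0
      simp [Matrix.scalar_apply, Matrix.diagonal_apply_ne _ hij.ne]⟩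
  map_one' := by
    apply Subtype.ext
    apply Prod.ext <;> simp
  map_mul' a b := by
    apply Subtype.ext
    apply Prod.ext
    · simp
    · simp [mul_pow]

instance scalarHom_range_normal : (scalarHom n R).range.Normal where
  conj_mem := by
    rintro _ ⟨a, rfl⟩ g
    refine ⟨a, ?_⟩
    have h : g * scalarHom n R a = scalarHom n R a * g := by
      apply Subtype.ext
      apply Prod.ext
      · apply Units.ext
        show g.1.1.1 * Matrix.scalar (Fin n) a.1 = Matrix.scalar (Fin n) a.1 * g.1.1.1
        exact ((Matrix.scalar_commute a.1 (fun r => Commute.all _ _) g.1.1.1).eq).symm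
      · exact mul_comm _ _
    rw [h, mul_inv_cancel_right]

/-- For `n` even: `P(R)`, the lower-triangular subgroup of `G(R) = (O_A / μ₂)(R)`.
The group scheme `O_A / μ₂` is the quotient of the group `GO_A` of similitudes by the
scalars `𝔾_m` (locally for the fppf topology, every similitude is a scalar times an element of
`O_A`), and its `R`-points, for `R` with trivial Picard group such as `ℝ` and `ℤ_p`, are the
similitudes over `R` modulo `Rˣ`. -/
abbrev PEven : Type _ := lowerSim n R ⧸ (scalarHom n R).range

end Groups

/-! ### The actions of `P(R)` on `W₀(R)` -/

section Actions

variable {n : ℕ} {R : Type*} [CommRing R]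

/-- `B ↦ c • g B gᵀ`, for `g` lower triangular. -/
def W0.congr (c : R) (g : GL (Fin n) R) (hg : g ∈ lowerGL n R) (B : W0 n R) : W0 n R :=
  ⟨c • (g.1 * B.1 * g.1ᵀ), by
    constructor
    · have h := B.2.1
      unfold Matrix.IsSymm at h ⊢
      simp only [Matrix.transpose_smul, Matrix.transpose_mul, Matrix.transpose_transpose, h,
        Matrix.mul_assoc]
    · intro i j hij
      rw [Matrix.smul_apply, Matrix.mul_apply, Finset.sum_eq_zero, smul_zero]
      intro l _
      rw [Matrix.mul_apply, Finset.sum_mul, Finset.sum_eq_zero]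
      intro k _
      rcases lt_or_ge i k with h | h
      · rw [hg i k h, zero_mul, zero_mul]
      · rcases lt_or_ge j l with h' | h'
        · rw [Matrix.transpose_apply, hg j l h', mul_zero]
        · have h1 : (k : ℕ) ≤ i := h
          have h2 : (l : ℕ) ≤ j := h'
          rw [B.2.2 k l (by omega), mul_zero, zero_mul]⟩

/-- For `n` odd, `g · B = g B gᵀ`. -/
instance instMulActionPOdd : MulAction (POdd n R) (W0 n R) where
  smul g B := W0.congr 1 g.1 g.2.1.2 B
  one_smul B := by
    apply Subtype.ext
    show (1 : R) • ((1 : Matrix (Fin n) (Fin n) R) * B.1 * (1 : Matrix (Fin n) (Fin n) R)ᵀ) = B.1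
    simp
  mul_smul g h B := by
    apply Subtype.ext
    show (1 : R) • ((g.1.1 * h.1.1) * B.1 * (g.1.1 * h.1.1)ᵀ)
      = (1 : R) • (g.1.1 * ((1 : R) • (h.1.1 * B.1 * h.1.1ᵀ)) * g.1.1ᵀ)
    simp only [one_smul, Matrix.transpose_mul, Matrix.mul_assoc]

/-- A similitude `g` of multiplier `c` acts by `g · B = c⁻¹ g B gᵀ`. -/
instance instMulActionLowerSim : MulAction (lowerSim n R) (W0 n R) where
  smul g B := W0.congr (g.1.2⁻¹).1 g.1.1 g.2.2.1 B
  one_smul B := by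
    apply Subtype.ext
    show ((1 : Rˣ)⁻¹).1 •
      ((1 : Matrix (Fin n) (Fin n) R) * B.1 * (1 : Matrix (Fin n) (Fin n) R)ᵀ) = B.1
    simp
  mul_smul g h B := by
    apply Subtype.ext
    show ((g.1.2 * h.1.2)⁻¹).1 • ((g.1.1.1 * h.1.1.1) * B.1 * (g.1.1.1 * h.1.1.1)ᵀ)
      = (g.1.2⁻¹).1 • (g.1.1.1 * ((h.1.2⁻¹).1 • (h.1.1.1 * B.1 * h.1.1.1ᵀ)) * g.1.1.1ᵀ)
    rw [Matrix.mul_smul, Matrix.smul_mul, smul_smul, mul_inv, Units.val_mul]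
    simp only [Matrix.transpose_mul, Matrix.mul_assoc]

/-- The scalars act trivially, so the action of the similitudes descends to `P(R)`, `n` even. -/
instance instMulActionPEven : MulAction (PEven n R) (W0 n R) :=
  MulAction.compHom (W0 n R)
    (QuotientGroup.lift (scalarHom n R).range (MulAction.toPermHom (lowerSim n R) (W0 n R)) (by
      rintro _ ⟨a, rfl⟩
      apply Equiv.ext
      intro B
      apply Subtype.ext
      show ((a ^ 2)⁻¹ : Rˣ).1 •
        (Matrix.scalar (Fin n) a.1 * B.1 * (Matrix.scalar (Fin n) a.1)ᵀ) = B.1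
      ext i j
      have h : ((a ^ 2)⁻¹ : Rˣ).1 * a.1 ^ 2 = 1 := by
        rw [← Units.val_pow_eq_pow_val, ← Units.val_mul, inv_mul_cancel, Units.val_one]
      simp only [Matrix.smul_apply, Matrix.scalar_apply, Matrix.diagonal_transpose,
        Matrix.mul_diagonal, Matrix.diagonal_mul, smul_eq_mul]
      calc _ = (((a ^ 2)⁻¹ : Rˣ).1 * a.1 ^ 2) * B.1 i j := by ring
        _ = B.1 i j := by rw [h, one_mul]))

end Actions

/-! ### The torus -/

section Torus

variable (n : ℕ) {R : Type*} [CommRing R]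

/-- The invertible diagonal matrix with given entries. -/
def diagGL (t : Fin n → Rˣ) : GL (Fin n) R where
  val := Matrix.diagonal fun i => (t i).1
  inv := Matrix.diagonal fun i => ((t i)⁻¹).1
  val_inv := by simp [Matrix.diagonal_mul_diagonal]
  inv_val := by simp [Matrix.diagonal_mul_diagonal]

theorem diagGL_mem_lowerGL (t : Fin n → Rˣ) : diagGL n t ∈ lowerGL n R := fun _ _ hij =>
  Matrix.diagonal_apply_ne _ hij.ne

theorem diagGL_sim (t : Fin n → Rˣ) (c : Rˣ) (h : ∀ i, t i * t i.rev = c) :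
    (diagGL n t).1ᵀ * antidiag n R * (diagGL n t).1 = c.1 • antidiag n R := by
  ext i j
  simp only [diagGL, Matrix.diagonal_transpose, Matrix.mul_diagonal, Matrix.diagonal_mul,
    antidiag, Matrix.of_apply, Matrix.smul_apply, smul_eq_mul]
  split_ifs with hij
  · subst hij
    rw [← h i, Units.val_mul]
    ring
  · simp

/-- For `n` odd and `m = ⌊n/2⌋`: `t_i = ∏_{k=i}^m s_k⁻¹` for `i ≤ m`, `t_{m+1} = 1`, and
`t_{n+1-i} = t_i⁻¹` (indices from `1`). -/
def torusOddEntry (s : Fin (n / 2) → Rˣ) (i : Fin n) : Rˣ :=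
  (∏ k : Fin (n / 2), if (i : ℕ) ≤ k then (s k)⁻¹ else 1) *
    ∏ k : Fin (n / 2), if (i.rev : ℕ) ≤ k then s k else 1

theorem torusOddEntry_mul_rev (s : Fin (n / 2) → Rˣ) (i : Fin n) :
    torusOddEntry n s i * torusOddEntry n s i.rev = 1 := by
  have h : ∀ a : ℕ, (∏ k : Fin (n / 2), if a ≤ (k : ℕ) then (s k)⁻¹ else 1)
      = (∏ k : Fin (n / 2), if a ≤ (k : ℕ) then s k else 1)⁻¹ := by
    intro a
    rw [← Finset.prod_inv_distrib]
    refine Finset.prod_congr rfl fun k _ => ?_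
    split_ifs <;> simp
  simp only [torusOddEntry, h, Fin.rev_rev]
  group

/-- The element `diag(t_1, …, t_n)` of `P(R)` with coordinates `s`, for `n` odd. -/
def torusOdd (s : Fin (n / 2) → Rˣ) : POdd n R :=
  ⟨diagGL n (torusOddEntry n s), ⟨⟨by
      have := diagGL_sim n (torusOddEntry n s) 1 (torusOddEntry_mul_rev n s)
      rw [Units.val_one, one_smul] at this
      exact this, diagGL_mem_lowerGL n _⟩, by
    apply Units.ext
    show (Matrix.diagonal fun i => (torusOddEntry n s i).1).det = 1
    rw [Matrix.det_diagonal, ← Units.coe_prod]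
    have e : ∏ i : Fin n, torusOddEntry n s i = 1 := by
      have h : ∏ i : Fin n, (∏ k : Fin (n / 2), if (i.rev : ℕ) ≤ k then s k else 1)
          = ∏ i : Fin n, (∏ k : Fin (n / 2), if (i : ℕ) ≤ k then s k else 1) :=
        Equiv.prod_comp Fin.revPerm
          (fun i : Fin n => ∏ k : Fin (n / 2), if (i : ℕ) ≤ k then s k else 1)
      simp only [torusOddEntry]
      rw [Finset.prod_mul_distrib, h, ← Finset.prod_mul_distrib]
      refine Finset.prod_eq_one fun i _ => ?_
      rw [← Finset.prod_mul_distrib]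
      refine Finset.prod_eq_one fun k _ => ?_
      split_ifs <;> simp
    rw [e, Units.val_one]⟩⟩

/-- For `n` even, the coordinates `s_1, …, s_{n/2}` on the torus of `O_A / μ₂` are
`s_i = t_{i+1} / t_i` for `i < n/2` and `s_{n/2} = 1 / (t_{n/2-1} t_{n/2})`, where
`diag(t_1, …, t_n)` has `t_i t_{n+1-i} = 1`; equivalently, with `𝔰 = (s_{n/2-1} s_{n/2})^{1/2}`,
`t_i = 𝔰⁻¹ ∏_{k=i}^{n/2-2} s_k⁻¹` for `i ≤ n/2 - 1` and `t_{n/2} = 𝔰⁻¹ s_{n/2-1}`.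
We take the representative `diag(t_i / t_1)` of this class modulo scalars. Its
multiplier is `t_1⁻² = s_{n/2-1} s_{n/2} ∏_{k=1}^{n/2-2} s_k²`. -/
def torusEvenMult (s : Fin (n / 2) → Rˣ) : Rˣ :=
  ∏ k : Fin (n / 2), s k ^ (if (k : ℕ) + 2 < n / 2 then 2 else 1)

/-- The entries `t_i / t_1`: equal to `∏_{k<i} s_k` for `i ≤ n/2` (indices from `1`), the others
being determined by the multiplier. -/
def torusEvenEntry (s : Fin (n / 2) → Rˣ) (i : Fin n) : Rˣ :=
  if (i : ℕ) < n / 2 then ∏ k : Fin (n / 2), if (k : ℕ) < i then s k else 1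
  else torusEvenMult n s * (∏ k : Fin (n / 2), if (k : ℕ) < i.rev then s k else 1)⁻¹

/-- The similitude `diag(t_i / t_1)`, for `n` even. -/
def torusEvenSim (hn : Even n) (s : Fin (n / 2) → Rˣ) : lowerSim n R :=
  ⟨(diagGL n (torusEvenEntry n s), torusEvenMult n s), by
    refine ⟨diagGL_sim n _ _ fun i => ?_, diagGL_mem_lowerGL n _, trivial⟩
    obtain ⟨m, rfl⟩ := hn
    have hr : (i.rev : ℕ) = m + m - (i + 1) := Fin.val_rev i
    have hi := i.isLt
    by_cases h : (i : ℕ) < (m + m) / 2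
    · have h' : ¬ (i.rev : ℕ) < (m + m) / 2 := by omega
      simp only [torusEvenEntry, if_pos h, if_neg h', Fin.rev_rev]
      rw [mul_comm, inv_mul_cancel_right]
    · have h' : (i.rev : ℕ) < (m + m) / 2 := by omega
      simp only [torusEvenEntry, if_neg h, if_pos h']
      rw [inv_mul_cancel_right]⟩

/-- The function `δ(s)`: for `n` odd, `∏_i s_i^{i² - 2 i ⌊n/2⌋}`; for `n` even,
`(s_{n/2-1} s_{n/2})^{-(n²-2n)/8} ∏_{i=1}^{n/2-2} s_i^{i² - i(n-1)}`
(indices from `1`; below `i = k + 1`). -/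
def delta (s : Fin (n / 2) → Rˣ) : Rˣ :=
  if Odd n then
    ∏ k : Fin (n / 2), s k ^ (((k : ℤ) + 1) ^ 2 - 2 * ((k : ℤ) + 1) * ((n / 2 : ℕ) : ℤ))
  else
    ∏ k : Fin (n / 2), s k ^
      (if (k : ℕ) + 2 < n / 2 then ((k : ℤ) + 1) ^ 2 - ((k : ℤ) + 1) * ((n : ℤ) - 1)
        else -(((n ^ 2 - 2 * n) / 8 : ℕ) : ℤ))

end Torus

/-! ### Measures

`R` is `ℝ` or `ℤ_p` and `μ` is its standard additive Haar measure. -/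

section Measures

variable (n : ℕ) {R : Type*} [NormedCommRing R] [MeasurableSpace R] (μ : Measure R)

/-- Entrywise measurable structure on matrices (the units then carry the induced one). -/
instance instMeasurableSpaceMatrix : MeasurableSpace (Matrix (Fin n) (Fin n) R) :=
  MeasurableSpace.pi (X := fun _ : Fin n => Fin n → R)

instance instMeasurableSpaceW0 : MeasurableSpace (W0 n R) :=
  inferInstanceAs (MeasurableSpace {B : Matrix (Fin n) (Fin n) R //
    B.IsSymm ∧ ∀ i j : Fin n, (i : ℕ) + (j : ℕ) + 2 < n → B i j = 0})

/-- The Euclidean measure `dB` on `W₀(R)`. -/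
def W0.measure : Measure (W0 n R) :=
  Measure.map W0.ofCoords (Measure.pi fun _ : W0Index n => μ)

/-- The positions of the free coordinates `u_ij` of `N`: `j ≤ min(i-1, n-i)`
(indices from `1`). -/
abbrev unipIndex : Type :=
  {q : Fin n × Fin n // q.2 < q.1 ∧ (q.1 : ℕ) + (q.2 : ℕ) + 2 ≤ n}

/-- The coordinates `(u_ij)` of an element of `N(R)`: its entries at the free positions. -/
def unipCoords (g : unipGroup n R) : unipIndex n → R := fun q => g.1.1 q.1.1 q.1.2

/-- The Haar measure `du` on `N(R)`, normalized so that `N(ℤ)` has covolume `1` in `N(ℝ)`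
and `N(ℤ_p)` has volume `1`. For `n` even this is `∏ du_ij`. For `n` odd, a point
of `N(ℝ)` is integral iff all `u_ij` are integers and the `⌊n/2⌋` coordinates `u_ij` with
`i = (n+1)/2` are even, so that `du = 2^{-⌊n/2⌋} ∏ du_ij`. -/
def unipMeasure : Measure (unipGroup n R) :=
  (if Odd n then (‖(2 : R)‖ₑ ^ (n / 2))⁻¹ else 1) •
    Measure.comap (unipCoords n) (Measure.pi fun _ : unipIndex n => μ)

/-- The multiplicative Haar measure `ds / |s|` on `Rˣ`. -/
def unitMeasure : Measure Rˣ :=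
  (Measure.comap Units.val μ).withDensity fun s => ‖s.1‖ₑ⁻¹

/-- The measure `δ(s)⁻¹ d^×s du` on the pairs `(s, u)`. -/
def coordMeasure : Measure ((Fin (n / 2) → Rˣ) × unipGroup n R) :=
  ((Measure.pi fun _ : Fin (n / 2) => unitMeasure μ).withDensity
    fun s => ‖(delta n s).1‖ₑ⁻¹).prod (unipMeasure n μ)

/-- For `n` odd, the point `h = s u` of `P(R)`. -/
def pointOdd (x : (Fin (n / 2) → Rˣ) × unipGroup n R) : POdd n R :=
  torusOdd n x.1 * ⟨x.2.1, ⟨⟨x.2.2.1, x.2.2.2.1⟩, by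
    apply Units.ext
    show x.2.1.1.det = 1
    have h : x.2.1.1.BlockTriangular OrderDual.toDual := fun i j hij => x.2.2.2.1 i j hij
    rw [Matrix.det_of_isLowerTriangular _ h]
    exact Finset.prod_eq_one fun i _ => x.2.2.2.2 i⟩⟩

/-- For `n` odd, the right Haar measure `dh = δ(s)⁻¹ du d^×s` on `P(R)`, where `h = s u`. -/
def haarOdd : Measure (POdd n R) :=
  Measure.map (pointOdd n) (coordMeasure n μ)

/-- For `n` even, the point `h = s u` of `P(R)`. -/
def pointEven (hn : Even n) (x : (Fin (n / 2) → Rˣ) × unipGroup n R) : PEven n R :=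
  QuotientGroup.mk (torusEvenSim n hn x.1 * ⟨(x.2.1, 1), by
    refine ⟨?_, x.2.2.2.1, trivial⟩
    show x.2.1.1ᵀ * antidiag n R * x.2.1.1 = (1 : R) • antidiag n R
    rw [one_smul]
    exact x.2.2.1⟩)

/-- For `n` even, the right Haar measure `dh = δ(s)⁻¹ du d^×s` on `P(R)`, where `h = s u`. -/
def haarEven (hn : Even n) : Measure (PEven n R) :=
  Measure.map (pointEven n hn) (coordMeasure n μ)

/-! ### The change-of-variables formula -/

/-- The `P`-orbits on `inv⁻¹(f) ∩ W₀(R)`. -/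
abbrev fiberOrbits (P : Type*) [Group P] [MulAction P (W0 n R)] (f : R[X]) : Type _ :=
  {ω : MulAction.orbitRel.Quotient P (W0 n R) // ∀ B ∈ ω.orbit, B.inv = f}

/-- The change-of-variables formula with constant `j ≥ 0`:
`∫_{W₀(R)} φ(B) |λ(B)| dB
  = j ∫_{f ∈ U(R), disc f ≠ 0} (∑_{B ∈ P(R) \ inv⁻¹(f)₀} ∫_{P(R)} φ(h · B) dh) df`
for all measurable `φ ≥ 0`, and for all measurable real-valued `φ` for which the left
hand side is absolutely convergent. -/
def ChangeOfVariables (P : Type*) [Group P] [MeasurableSpace P] [MulAction P (W0 n R)]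
    (dh : Measure P) (j : ℝ) : Prop :=
  (∀ φ : W0 n R → ℝ≥0∞, Measurable φ →
    ∫⁻ B, φ B * ‖B.lam‖ₑ ∂(W0.measure n μ) =
      ENNReal.ofReal j *
        ∫⁻ c in {c : Fin n → R | (monicPoly c).discr ≠ 0},
          (∑' ω : fiberOrbits n P (monicPoly c), ∫⁻ h, φ (h • Quotient.out ω.1) ∂dh)
          ∂(Measure.pi fun _ => μ)) ∧
  (∀ φ : W0 n R → ℝ, Measurable φ →
    Integrable (fun B => φ B * ‖B.lam‖) (W0.measure n μ) →
    IntegrableOn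
      (fun c : Fin n → R =>
        ∑' ω : fiberOrbits n P (monicPoly c), ∫ h, φ (h • Quotient.out ω.1) ∂dh)
      {c : Fin n → R | (monicPoly c).discr ≠ 0} (Measure.pi fun _ => μ) ∧
    ∫ B, φ B * ‖B.lam‖ ∂(W0.measure n μ) =
      j * ∫ c in {c : Fin n → R | (monicPoly c).discr ≠ 0},
          (∑' ω : fiberOrbits n P (monicPoly c), ∫ h, φ (h • Quotient.out ω.1) ∂dh)
          ∂(Measure.pi fun _ => μ))

/-- The change-of-variables formula for `n` of either parity. -/
def JacobianFormula (j : ℝ) : Prop :=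
  (Odd n → ChangeOfVariables n μ (POdd n R) (haarOdd n μ) j) ∧
  (∀ hn : Even n, ChangeOfVariables n μ (PEven n R) (haarEven n μ hn) j)

end Measures

/-! ### The base rings `ℝ` and `ℤ_p` -/

section Padic

variable (p : ℕ) [Fact p.Prime]

instance instMeasurableSpacePadicInt : MeasurableSpace ℤ_[p] := borel _

instance instBorelSpacePadicInt : BorelSpace ℤ_[p] := ⟨rfl⟩

/-- The Haar measure on `ℤ_p` of total mass `1`. -/
def padicMeasure : Measure ℤ_[p] := Measure.addHaarMeasure ⊤

end Padic

/-- `J` is a Jacobian constant in dimension `n`: it is a nonzero rational number, and the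
change-of-variables formula holds with constant `|J|` over `ℝ` and with constant `|J|_p` over
`ℤ_p` for every prime `p`. -/
def IsJacobianConstant (n : ℕ) (J : ℚ) : Prop :=
  J ≠ 0 ∧ JacobianFormula n (volume : Measure ℝ) |(J : ℝ)| ∧
    ∀ (p : ℕ) [Fact p.Prime], JacobianFormula n (padicMeasure p) ‖(J : ℚ_[p])‖

/-- The claimed value of `|J|`: `1` for `n` odd and `2^{-n/2}` for `n` even. -/
def jacobianValue (n : ℕ) : ℚ := if Odd n then 1 else (2 ^ (n / 2))⁻¹

end OrbitJacobian

end

/-!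
The formula is the composite of three changes of variables, each of which is triangular and hence
changes the measure by the product of its diagonal coefficients (`comap_triangular`). The base ring
enters only through its Haar measure, which multiplication by `a` scales by `|a|` (`IsModulus`), so
that `ℝ` and `ℤ_p` are treated alike, and so are the two parities of `n` (`IsParabolicChart`).

The matrix `M = B A` is lower Hessenberg and symmetric under reflection in the anti-diagonal, and
the invariant polynomial of `B` is `det (x + M)`. The coordinates of `W₀` fall into three blocks
(`blockEquiv`): the `m` entries `beta` next to the anti-diagonal, the entries `mid` at the middle of
each diagonal of `M`, and the others, `side`, which correspond to the coordinates of the unipotent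
group `N`.

* For fixed `beta` and `side`, the coefficients of the invariant polynomial are triangular in `mid`,
  by the recursion for Hessenberg determinants (`inv_coeff_sub`). The diagonal coefficients are
  products of entries `beta`, with a factor `2` for every other coefficient; their product is
  `2^m λ(B) D(B)` with a monomial `D` (`prod_invSlope`, where `D` is `W0.orbitScale`). Therefore the
  integral of `φ |λ|` over `W₀` is the integral of `φ |2^m D|⁻¹` over `beta`, `side` and the
  coefficients (`lintegral_mul_lam`).
* Along the orbit of `B` under `P`, the entries `beta` are multiplied by characters of the torus
  that form a system of coordinates on it (`entryRatio`), and for a fixed element of the torus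
  `side` is triangular in the coordinates of `N` (`IsUnip.conj_sub_conj`). The product of all the
  factors is `|D|` times `|δ|⁻¹`, which is how the orbit receives the Haar measure of `P`
  (`IsParabolicChart.lintegral_orbitMap`).

For nonzero discriminant no entry of `beta` vanishes (`discr_inv_eq_zero`). Then `beta`, `side` and
the invariant polynomial determine the matrix, so that `P` acts freely and the orbits in a fibre of
the invariant correspond to disjoint sets. Each has positive measure, because `N` is not negligible
in its space of coordinates, as the Cayley transform shows; so the orbits are countable in number
and the integral over a fibre is the sum of the integrals over the orbits
(`IsParabolicChart.lintegral_fiberDensity`). The polynomials of discriminant zero form a null set.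

The constant `|2|^(-m)` that results is cancelled for `n` odd by the normalization of `du`. It is
unique, because the left-hand side of the formula is finite and nonzero for a suitable `φ`
(`ChangeOfVariables.ofReal_eq`).
-/

set_option linter.unusedSectionVars false

namespace OrbitJacobian

/-! ### Triangular changes of variables -/

section Triangular

variable {R : Type*} [NormedCommRing R] [NormMulClass R] [IsDomain R] [ProperSpace R]
  [MeasurableSpace R] [BorelSpace R]

/-- `‖a‖` is the factor by which multiplication by `a` scales the measure `μ`. -/
def IsModulus (μ : Measure R) : Prop :=
  ∀ a : R, a ≠ 0 → ∀ s : Set R, MeasurableSet s → μ ((a * ·) '' s) = ‖a‖ₑ * μ s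

variable {μ : Measure R} [μ.IsAddHaarMeasure] (hμ : IsModulus μ)
  {ι : Type*} [Fintype ι] [DecidableEq ι]

include hμ in
theorem IsModulus.measure_image_affine {a : R} (ha : a ≠ 0) (g : R) {s : Set R}
    (hs : MeasurableSet s) : μ ((fun x => a * x + g) '' s) = ‖a‖ₑ * μ s := by
  have : (fun x => a * x + g) '' s = (· + g) '' ((a * ·) '' s) := by
    rw [← Set.image_comp]; rfl
  rw [this, Set.image_add_right, measure_preimage_add_right, hμ a ha s hs]

include hμ in
/-- Replacing the coordinate `q` by an expression that is affine in it, with slope `a`, scales the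
Haar measure of `R^ι` by `‖a‖`. -/
theorem comap_update (q : ι) {a : R} (ha : a ≠ 0) {F : (ι → R) → R} (hF : Measurable F)
    (h : ∀ y x x', F (Function.update y q x) - a * x = F (Function.update y q x') - a * x') :
    MeasurableEmbedding (fun y : ι → R => Function.update y q (F y)) ∧
      (Measure.pi fun _ : ι => μ).comap (fun y => Function.update y q (F y)) =
        ‖a‖ₑ • Measure.pi fun _ => μ := by
  set E : (ι → R) → ι → R := fun y => Function.update y q (F y) with hE
  have hEm : Measurable E := by
    refine measurable_pi_lambda _ fun i => ?_
    by_cases hi : i = q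
    · subst hi; simpa [hE] using hF
    · simpa [hE, hi] using measurable_pi_apply i
  have hEi : Function.Injective E := by
    intro y y' hyy
    have h1 : ∀ i, i ≠ q → y i = y' i := fun i hi => by
      simpa [hE, hi] using congrFun hyy i
    have h2 : F y = F y' := by simpa [hE] using congrFun hyy q
    have h3 : Function.update y q (y' q) = y' := by
      ext i
      by_cases hi : i = q
      · subst hi; simp
      · simp [hi, h1 i hi]
    have h4 := h y (y q) (y' q)
    rw [h3, Function.update_eq_self, h2, sub_right_inj] at h4
    have h5 := mul_left_cancel₀ ha h4
    rw [← h3, ← h5, Function.update_eq_self]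
  have hem := hEm.measurableEmbedding hEi
  refine ⟨hem, ?_⟩
  ext s hs
  rw [hem.comap_apply, Measure.smul_apply, smul_eq_mul,
    ← lintegral_indicator_one (hem.measurableSet_image.2 hs), ← lintegral_indicator_one hs,
    ← lintegral_const_mul _ (measurable_one.indicator hs)]
  refine lintegral_eq_of_lmarginal_eq {q} (measurable_one.indicator (hem.measurableSet_image.2 hs))
    ((measurable_one.indicator hs).const_mul _) ?_
  rw [lmarginal_singleton, lmarginal_singleton]
  funext y
  have hup : Measurable fun x : R => Function.update y q x := measurable_update y
  refine Eq.trans ?_ (lintegral_const_mul _ ((measurable_one.indicator hs).comp hup)).symm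
  have e1 : (fun x => (E '' s).indicator (1 : (ι → R) → ℝ≥0∞) (Function.update y q x)) =
      ((fun x => Function.update y q x) ⁻¹' (E '' s)).indicator 1 := rfl
  have e2 : (fun x => s.indicator (1 : (ι → R) → ℝ≥0∞) (Function.update y q x)) =
      ((fun x => Function.update y q x) ⁻¹' s).indicator 1 := rfl
  simp only [Function.comp_def]
  rw [e1, e2, lintegral_indicator_one (hup (hem.measurableSet_image.2 hs)),
    lintegral_indicator_one (hup hs), ← hμ.measure_image_affine ha (F y - a * y q) (hup hs)]
  congr 1
  have hFy : ∀ x, F (Function.update y q x) = a * x + (F y - a * y q) := fun x => by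
    have := h y x (y q)
    rw [Function.update_eq_self] at this
    rw [← this]; ring
  ext x
  simp only [Set.mem_preimage, Set.mem_image]
  constructor
  · rintro ⟨z, hz, hzx⟩
    have h1 : Function.update y q (z q) = z := by
      ext i
      by_cases hi : i = q
      · subst hi; simp
      · simpa [hE, hi] using (congrFun hzx i).symm
    refine ⟨z q, by rwa [h1], ?_⟩
    rw [← hFy, h1]
    simpa [hE] using congrFun hzx q
  · rintro ⟨x', hx', rfl⟩
    refine ⟨_, hx', ?_⟩
    simp [hE, hFy]

include hμ in
/-- A triangular self-map of `R^ι`, with diagonal coefficients `a`, scales the Haar measure by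
`∏ ‖a q‖`. -/
theorem comap_triangular (r : ι → ℕ) (hr : Function.Injective r) {a : ι → R} (ha : ∀ q, a q ≠ 0)
    {F : (ι → R) → ι → R} (hF : Measurable F)
    (h : ∀ q y y', (∀ q', r q' < r q → y q' = y' q') →
      F y q - a q * y q = F y' q - a q * y' q) :
    MeasurableEmbedding F ∧
      (Measure.pi fun _ : ι => μ).comap F = (∏ q, ‖a q‖ₑ) • Measure.pi fun _ => μ := by
  -- `F` is the composite of the maps changing one coordinate at a time, the last one first
  set G : ℕ → (ι → R) → ι → R := fun k y q => if k ≤ r q then F y q else y q with hG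
  set K := ∑ q, r q + 1 with hK
  have hrK : ∀ q, r q < K := fun q =>
    Nat.lt_succ_of_le (Finset.single_le_sum (f := r) (fun _ _ => Nat.zero_le _) (Finset.mem_univ q))
  suffices H : ∀ j ≤ K, MeasurableEmbedding (G (K - j)) ∧
      (Measure.pi fun _ : ι => μ).comap (G (K - j)) =
        (∏ q, if K - j ≤ r q then ‖a q‖ₑ else 1) • Measure.pi fun _ => μ by
    have := H K le_rfl
    simpa [hG] using this
  intro j
  induction j with
  | zero =>
    intro _
    have h1 : G (K - 0) = fun y => y := by
      funext y q
      simp [hG, hrK q]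
    rw [h1, Finset.prod_eq_one, one_smul]
    · exact ⟨MeasurableEmbedding.id, Measure.comap_id _⟩
    · intro q _
      simp [hrK q]
  | succ j ih =>
    intro hj
    obtain ⟨ih1, ih2⟩ := ih (by omega)
    obtain ⟨k, hk⟩ : ∃ k, K - (j + 1) = k := ⟨_, rfl⟩
    have hk' : K - j = k + 1 := by omega
    rw [hk'] at ih1 ih2
    rw [hk]
    by_cases hq : ∃ q, r q = k
    · obtain ⟨q, hq⟩ := hq
      have hEq : ∀ y x x', F (Function.update y q x) q - a q * x =
          F (Function.update y q x') q - a q * x' := by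
        intro y x x'
        have := h q (Function.update y q x) (Function.update y q x') (by
          intro q' hq'
          have : q' ≠ q := by rintro rfl; exact lt_irrefl _ hq'
          simp [this])
        simpa using this
      obtain ⟨e1, e2⟩ := comap_update hμ q (ha q) (F := fun y => F y q)
        ((measurable_pi_apply q).comp hF) hEq
      have hcomp : G k = (fun y => Function.update y q (F y q)) ∘ G (k + 1) := by
        funext y q'
        simp only [Function.comp]
        by_cases hqq : q' = q
        · subst hqq
          have h2 := h q' (G (k + 1) y) y (by
            intro q'' hq''
            have : ¬ k + 1 ≤ r q'' := by omega
            simp [hG, this])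
          have h3 : G (k + 1) y q' = y q' := by simp [hG, hq]
          rw [h3, sub_left_inj] at h2
          rw [Function.update_self, h2]
          simp [hG, hq]
        · have : r q' ≠ k := fun h' => hqq (hr (h'.trans hq.symm))
          have h3 : (k ≤ r q') = (k + 1 ≤ r q') := by
            apply propext; omega
          simp [hqq, hG, h3]
      refine ⟨hcomp ▸ e1.comp ih1, ?_⟩
      rw [hcomp, ← Measure.comap_comap (fun s hs => ih1.measurableSet_image.2 hs) e1.injective
        (fun s hs => e1.measurableSet_image.2 hs)]
      rw [e2, Measure.comap_smul, ih2, smul_smul]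
      congr 1
      rw [← Finset.mul_prod_erase _ _ (Finset.mem_univ q),
        ← Finset.mul_prod_erase (s := Finset.univ) (a := q) (h := Finset.mem_univ q)]
      simp only [hq, le_refl, if_true, Nat.not_succ_le_self, if_false, one_mul]
      congr 1
      refine Finset.prod_congr rfl fun q' hq' => ?_
      have : r q' ≠ k := fun h' => (Finset.ne_of_mem_erase hq') (hr (h'.trans hq.symm))
      have h3 : (k ≤ r q') = (k + 1 ≤ r q') := by
        apply propext; omega
      simp only [h3]
    · have h3 : ∀ q', (k ≤ r q') = (k + 1 ≤ r q') := by
        intro q'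
        have : r q' ≠ k := fun h' => hq ⟨q', h'⟩
        apply propext; omega
      have h4 : G k = G (k + 1) := by
        funext y q'
        simp only [hG, h3]
      rw [h4]
      refine ⟨ih1, ?_⟩
      rw [ih2]
      simp only [h3]

/-- A measurable function that is constant on the fibres of a measurable map `p` with measurable
range factors measurably through `p`. -/
theorem exists_measurable_factor {N Z : Type*} [MeasurableSpace N] [StandardBorelSpace N]
    [MeasurableSpace Z] [StandardBorelSpace Z] {p : N → Z} (hp : Measurable p)
    (hr : MeasurableSet (Set.range p)) {D : N → R} (hD : Measurable D)
    (h : ∀ u u', p u = p u' → D u = D u') : ∃ G : Z → R, Measurable G ∧ ∀ u, G (p u) = D u := by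
  have : StandardBorelSpace (Set.range p) := hr.standardBorel
  have hp' : Measurable (Set.rangeFactorization p) := hp.subtype_mk
  let g : Set.range p → R := fun z => D z.2.choose
  have hg : ∀ u, g (Set.rangeFactorization p u) = D u := fun u =>
    h _ _ (Set.rangeFactorization p u).2.choose_spec
  have hgm : Measurable g := by
    rw [← hp'.measurable_comp_iff_of_surjective Set.rangeFactorization_surjective]
    convert hD using 1
    exact funext hg
  obtain ⟨G, hG, hGg⟩ := (MeasurableEmbedding.subtype_coe hr).exists_measurable_extend hgm
    (fun _ => ⟨0⟩)
  exact ⟨G, hG, fun u => (congrFun hGg (Set.rangeFactorization p u)).trans (hg u)⟩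

include hμ in
/-- Two systems of coordinates `Φ`, `Ψ` on `N` related by a triangular transformation with
diagonal coefficients `a` define measures that differ by the factor `∏ ‖a q‖`. -/
theorem comap_triangular_of_embedding {N : Type*} [MeasurableSpace N] [StandardBorelSpace N]
    (r : ι → ℕ) (hr : Function.Injective r) {a : ι → R} (ha : ∀ q, a q ≠ 0)
    {Φ Ψ : N → ι → R} (hΦ : MeasurableEmbedding Φ) (hΨ : Measurable Ψ)
    (hrange : ∀ q, MeasurableSet (Set.range fun (u : N) (q' : {q' // r q' < r q}) => Φ u q'.1))
    (h : ∀ q u u', (∀ q', r q' < r q → Φ u q' = Φ u' q') →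
      Ψ u q - a q * Φ u q = Ψ u' q - a q * Φ u' q) :
    MeasurableEmbedding Ψ ∧ (Measure.pi fun _ : ι => μ).comap Ψ =
      (∏ q, ‖a q‖ₑ) • (Measure.pi fun _ : ι => μ).comap Φ := by
  have hΦm := hΦ.measurable
  have hcoord : ∀ q, Measurable fun u => Φ u q := fun q => (measurable_pi_apply q).comp hΦm
  have key : ∀ q, ∃ G : ({q' // r q' < r q} → R) → R, Measurable G ∧
      ∀ u, G (fun q' => Φ u q'.1) = Ψ u q - a q * Φ u q := fun q =>
    exists_measurable_factor (p := fun u (q' : {q' // r q' < r q}) => Φ u q'.1)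
      (measurable_pi_lambda _ fun q' => hcoord q'.1) (hrange q)
      (((measurable_pi_apply q).comp hΨ).sub ((hcoord q).const_mul _))
      (fun u u' huu => h q u u' fun q' hq' => congrFun huu ⟨q', hq'⟩)
  choose G hG hGΦ using key
  let F : (ι → R) → ι → R := fun y q => a q * y q + G q (fun q' => y q'.1)
  have hFm : Measurable F := measurable_pi_lambda _ fun q =>
    ((measurable_pi_apply q).const_mul _).add
      ((hG q).comp (measurable_pi_lambda _ fun q' => measurable_pi_apply q'.1))
  obtain ⟨h1, h2⟩ := comap_triangular hμ r hr ha hFm (by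
    intro q y y' hy
    simp only [F, add_sub_cancel_left]
    congr 1
    funext q'
    exact hy q'.1 q'.2)
  have hcomp : Ψ = F ∘ Φ := by
    funext u q
    simp only [F, Function.comp, hGΦ]
    ring
  rw [hcomp]
  refine ⟨h1.comp hΦ, ?_⟩
  rw [← Measure.comap_comap (fun s hs => hΦ.measurableSet_image.2 hs) h1.injective
    (fun s hs => h1.measurableSet_image.2 hs), h2, Measure.comap_smul]

end Triangular

/-! ### The multiplicative Haar measure on the units -/

section Units

theorem standardBorelSpace_of_measurableEmbedding {X Y : Type*} [MeasurableSpace X]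
    [MeasurableSpace Y] [StandardBorelSpace Y] {f : X → Y} (hf : MeasurableEmbedding f) :
    StandardBorelSpace X := by
  have : StandardBorelSpace (Set.range f) := hf.measurableSet_range.standardBorel
  let _ := upgradeStandardBorel (Set.range f)
  let e := hf.equivRange
  refine ⟨⟨TopologicalSpace.induced e inferInstance, ?_, ?_⟩⟩
  · let _ : TopologicalSpace X := TopologicalSpace.induced e inferInstance
    refine ⟨?_⟩
    exact e.measurableEmbedding.comap_eq.symm.trans ((congrArg (MeasurableSpace.comap e)
      (eq_borel_upgradeStandardBorel (Set.range f))).trans borel_comap.symm)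
  · exact e.toEquiv.polishSpace_induced

theorem sigmaFinite_comap {X Y : Type*} [MeasurableSpace X] [MeasurableSpace Y] {f : X → Y}
    (hf : MeasurableEmbedding f) (μ : Measure Y) [SigmaFinite μ] : SigmaFinite (μ.comap f) :=
  SigmaFinite.of_map _ hf.measurable.aemeasurable (by rw [hf.map_comap]; infer_instance)

theorem lintegral_fin_prod_eq_prod {X : Type*} [MeasurableSpace X] :
    ∀ {m : ℕ} (τ : Fin m → Measure X) [∀ i, SigmaFinite (τ i)] {f : Fin m → X → ℝ≥0∞},
      (∀ i, Measurable (f i)) →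
      ∫⁻ x, ∏ i, f i (x i) ∂Measure.pi τ = ∏ i, ∫⁻ x, f i x ∂τ i
  | 0, τ, _, f, _ => by simp
  | m + 1, τ, _, f, hf => by
    have h1 := (measurePreserving_piFinSuccAbove τ 0)
    have h2 : ∫⁻ x, ∏ i, f i (x i) ∂Measure.pi τ =
        ∫⁻ z : X × (Fin m → X), f 0 z.1 * ∏ i : Fin m, f i.succ (z.2 i)
          ∂((τ 0).prod (Measure.pi fun j : Fin m => τ j.succ)) := by
      refine Eq.trans (lintegral_congr fun x => ?_) (h1.lintegral_comp_emb
        (MeasurableEquiv.measurableEmbedding _)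
        (fun z : X × (Fin m → X) => f 0 z.1 * ∏ i : Fin m, f i.succ (z.2 i)))
      rw [Fin.prod_univ_succ]
      rfl
    rw [h2, lintegral_prod_mul (f := f 0) (g := fun y : Fin m → X => ∏ i : Fin m, f i.succ (y i))
      (hf 0).aemeasurable, Fin.prod_univ_succ,
      lintegral_fin_prod_eq_prod (fun j : Fin m => τ j.succ) fun i => hf i.succ]
    exact (Finset.measurable_prod _ fun i _ =>
      (hf i.succ).comp (measurable_pi_apply i)).aemeasurable

theorem pi_withDensity {X : Type*} [MeasurableSpace X] {m : ℕ} (τ : Fin m → Measure X)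
    [∀ i, SigmaFinite (τ i)] {f : Fin m → X → ℝ≥0∞} (hf : ∀ i, Measurable (f i))
    [∀ i, SigmaFinite ((τ i).withDensity (f i))] :
    Measure.pi (fun i => (τ i).withDensity (f i)) =
      (Measure.pi τ).withDensity fun x => ∏ i, f i (x i) := by
  refine Measure.pi_eq fun s hs => ?_
  rw [withDensity_apply _ (MeasurableSet.univ_pi hs), Measure.restrict_pi_pi,
    lintegral_fin_prod_eq_prod _ hf]
  exact Finset.prod_congr rfl fun i _ => (withDensity_apply _ (hs i)).symm

variable {R : Type*} [NormedCommRing R] [NormMulClass R] [NormOneClass R] [IsDomain R]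
  [ProperSpace R] [MeasurableSpace R] [BorelSpace R]

theorem borelSpace_units : BorelSpace Rˣ := by
  refine ⟨?_⟩
  have h := (Units.isOpenEmbedding_val (R := R)).isEmbedding.eq_induced
  have h2 : (Units.instMeasurableSpace : MeasurableSpace Rˣ) = MeasurableSpace.comap Units.val
    (borel R) := by
    rw [← BorelSpace.measurable_eq (α := R)]
    rfl
  rw [h, h2, borel_comap]

theorem measurableEmbedding_unitsVal : MeasurableEmbedding (Units.val : Rˣ → R) := by
  have := borelSpace_units (R := R)
  exact (Units.isOpenEmbedding_val (R := R)).measurableEmbedding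

theorem measurable_unitsVal : Measurable (Units.val : Rˣ → R) :=
  measurableEmbedding_unitsVal.measurable

theorem standardBorelSpace_units : StandardBorelSpace Rˣ :=
  standardBorelSpace_of_measurableEmbedding (measurableEmbedding_unitsVal (R := R))

theorem measurableMul₂_units : MeasurableMul₂ Rˣ := by
  refine ⟨?_⟩
  rw [← measurableEmbedding_unitsVal.measurable_comp_iff]
  exact (measurable_unitsVal.comp measurable_fst).mul (measurable_unitsVal.comp measurable_snd)

theorem measurableInv_units : MeasurableInv Rˣ := by
  have := borelSpace_units (R := R)
  exact ⟨continuous_inv.measurable⟩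

theorem norm_unit_ne_zero (x : Rˣ) : ‖x.1‖ₑ ≠ 0 := by simp

variable {μ : Measure R} [μ.IsAddHaarMeasure] (hμ : IsModulus μ)

include hμ in
theorem IsModulus.comap_mul_left {a : R} (ha : a ≠ 0) :
    MeasurableEmbedding (a * ·) ∧ μ.comap (a * ·) = ‖a‖ₑ • μ := by
  have h : MeasurableEmbedding (a * ·) :=
    (measurable_const_mul a).measurableEmbedding (mul_right_injective₀ ha)
  refine ⟨h, ?_⟩
  ext s hs
  rw [h.comap_apply, hμ a ha s hs]
  rfl

theorem enorm_unit_ne_top (x : Rˣ) : ‖x.1‖ₑ ≠ ⊤ := enorm_ne_top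

theorem measurable_enorm_unit : Measurable fun s : Rˣ => ‖s.1‖ₑ :=
  measurable_unitsVal.enorm

theorem sigmaFinite_unitMeasure : SigmaFinite (unitMeasure μ) := by
  have := sigmaFinite_comap (measurableEmbedding_unitsVal (R := R)) μ
  exact SigmaFinite.withDensity_of_ne_top (Filter.Eventually.of_forall fun x => by simp)

theorem lintegral_unitMeasure {f : Rˣ → ℝ≥0∞} (hf : Measurable f) :
    ∫⁻ s, f s ∂unitMeasure μ = ∫⁻ s, ‖s.1‖ₑ⁻¹ * f s ∂μ.comap Units.val :=
  lintegral_withDensity_eq_lintegral_mul _ measurable_enorm_unit.inv hf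

include hμ in
/-- In the coordinate `s ↦ b s` on `Rˣ`, the Haar measure is `ds / |s|`. -/
theorem comap_mul_val {b : R} (hb : b ≠ 0) :
    MeasurableEmbedding (fun s : Rˣ => s.1 * b) ∧
      (unitMeasure μ).withDensity (fun s => ‖s.1 * b‖ₑ) = μ.comap (fun s : Rˣ => s.1 * b) := by
  have he : (fun s : Rˣ => s.1 * b) = (b * ·) ∘ Units.val := by
    funext s; exact mul_comm _ _
  obtain ⟨h1, h2⟩ := hμ.comap_mul_left hb
  have hv := measurableEmbedding_unitsVal (R := R)
  refine ⟨he ▸ h1.comp hv, ?_⟩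
  rw [he, ← Measure.comap_comap (fun s hs => hv.measurableSet_image.2 hs) h1.injective
    (fun s hs => h1.measurableSet_image.2 hs), h2, Measure.comap_smul]
  ext s hs
  have hm : Measurable fun s : Rˣ => ‖s.1 * b‖ₑ := (measurable_unitsVal.mul_const b).enorm
  rw [withDensity_apply _ hs, ← lintegral_indicator hs,
    lintegral_unitMeasure (hm.indicator hs), Measure.smul_apply, smul_eq_mul,
    ← lintegral_indicator_one hs, ← lintegral_const_mul _ (measurable_one.indicator hs)]
  refine lintegral_congr fun x => ?_
  by_cases hx : x ∈ s
  · simp only [Set.indicator_of_mem hx, enorm_mul, Pi.one_apply, mul_one]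
    rw [← mul_assoc, ENNReal.inv_mul_cancel (norm_unit_ne_zero x) (enorm_unit_ne_top x), one_mul]
  · simp [hx]

include hμ in
theorem isMulLeftInvariant_unitMeasure : (unitMeasure μ).IsMulLeftInvariant := by
  have := measurableMul₂_units (R := R)
  refine ⟨fun g => ?_⟩
  have hv := measurableEmbedding_unitsVal (R := R)
  -- the measure `ds / |s|` is determined by its products with `|s|` and with `|g s|`
  have h1 := (comap_mul_val hμ (b := 1) one_ne_zero).2
  simp only [mul_one] at h1
  have hg : MeasurableEmbedding (fun s : Rˣ => g * s) := measurableEmbedding_mulLeft g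
  ext s hs
  rw [Measure.map_apply hg.measurable hs]
  have h2 := (comap_mul_val hμ g.ne_zero).2
  have h3 : (fun s : Rˣ => s.1 * g.1) = Units.val ∘ (fun s => g * s) := by
    funext s; exact mul_comm _ _
  have h4 : Measure.comap (Units.val ∘ fun s => g * s) μ =
      Measure.comap (fun s => g * s) (Measure.comap Units.val μ) :=
    (Measure.comap_comap (fun s hs => hg.measurableSet_image.2 hs) hv.injective
    (fun s hs => hv.measurableSet_image.2 hs) μ).symm
  have h3' : (fun s : Rˣ => Units.val s) = Units.val := rfl
  rw [h3, h4, ← h3', ← h1] at h2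
  have key : ∀ f : Rˣ → ℝ≥0∞, Measurable f →
      ∫⁻ x, ‖x.1 * g.1‖ₑ * f (g * x) ∂unitMeasure μ = ∫⁻ x, ‖x.1‖ₑ * f x ∂unitMeasure μ := by
    intro f hf
    have hfg : Measurable fun x => f (g * x) := hf.comp hg.measurable
    have hm : Measurable fun s : Rˣ => ‖s.1 * g.1‖ₑ := (measurable_unitsVal.mul_const _).enorm
    rw [← Pi.mul_def, ← lintegral_withDensity_eq_lintegral_mul _ hm hfg, h2,
      ← hg.lintegral_map, hg.map_comap, (mul_left_surjective g).range_eq, Measure.restrict_univ,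
      lintegral_withDensity_eq_lintegral_mul _ measurable_enorm_unit hf]
    rfl
  have hs' : Measurable fun x : Rˣ => ‖x.1‖ₑ⁻¹ * s.indicator 1 x :=
    measurable_enorm_unit.inv.mul (measurable_one.indicator hs)
  have := key _ hs'
  rw [← lintegral_indicator_one (hg.measurable hs), ← lintegral_indicator_one hs]
  refine Eq.trans (lintegral_congr fun x => ?_) (this.trans (lintegral_congr fun x => ?_))
  · have h5 : x.1 * g.1 = (g * x).1 := mul_comm _ _
    rw [← mul_assoc, h5, ENNReal.mul_inv_cancel
      (norm_unit_ne_zero (g * x)) (enorm_unit_ne_top (g * x)), one_mul]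
    rfl
  · rw [← mul_assoc, ENNReal.mul_inv_cancel (norm_unit_ne_zero x) (enorm_unit_ne_top x), one_mul]

theorem unitMeasure_ne_zero : unitMeasure μ ≠ 0 := by
  intro h
  have h1 := congrArg (fun ν => ν Set.univ) h
  simp only [unitMeasure, Measure.coe_zero, Pi.zero_apply] at h1
  rw [withDensity_apply _ MeasurableSet.univ, Measure.restrict_univ,
    lintegral_eq_zero_iff (f := fun s : Rˣ => ‖s.1‖ₑ⁻¹) measurable_enorm_unit.inv] at h1
  have h2 : (μ.comap (Units.val : Rˣ → R)) Set.univ = 0 := by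
    rw [← nonpos_iff_eq_zero]
    refine le_trans (measure_mono ?_) (le_of_eq h1)
    intro x _
    simp
  rw [measurableEmbedding_unitsVal.comap_apply, Set.image_univ] at h2
  exact (Units.isOpenEmbedding_val (R := R)).isOpen_range.measure_ne_zero μ ⟨1, 1, rfl⟩ h2

include hμ in
theorem isInvInvariant_unitMeasure : (unitMeasure μ).IsInvInvariant := by
  have := measurableMul₂_units (R := R)
  have := measurableInv_units (R := R)
  have := sigmaFinite_unitMeasure (μ := μ)
  have := isMulLeftInvariant_unitMeasure hμ
  set ν := unitMeasure μ
  have hν : ν ≠ 0 := unitMeasure_ne_zero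
  have hR : ν.IsMulRightInvariant := by
    refine ⟨fun g => ?_⟩
    simp only [mul_comm _ g]
    exact map_mul_left_eq_self ν g
  obtain ⟨s, hs, hs0, hs'⟩ : ∃ s, MeasurableSet s ∧ ν s ≠ 0 ∧ ν s ≠ ⊤ := by
    by_contra! hcon
    apply hν
    rw [← Measure.measure_univ_eq_zero, ← iUnion_spanningSets ν, measure_iUnion_null_iff]
    intro i
    by_contra hi
    exact (measure_spanningSets_lt_top ν i).ne (hcon _ (measurableSet_spanningSets ν i) hi)
  have hc := measure_eq_div_smul ν.inv ν hs0 hs'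
  set c := ν.inv s / ν s
  -- `ν⁻¹ = c ν` and inversion is an involution, so `c² = 1`
  have h1 : ν.inv s = c * ν s := by
    conv_lhs => rw [hc]
    rfl
  have h2 : ν s = c * ν.inv s := by
    have h3 : ν.inv s⁻¹ = c * ν s⁻¹ := by
      conv_lhs => rw [hc]
      rfl
    rw [Measure.inv_apply, _root_.inv_inv, ← Measure.inv_apply] at h3
    exact h3
  have h4 : c * c = 1 := by
    rw [h1, ← mul_assoc] at h2
    have h5 : 1 * ν s = (c * c) * ν s := by rwa [one_mul]
    exact ((ENNReal.mul_left_inj hs0 hs').1 h5).symm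
  have h6 : c = 1 := by
    rcases lt_trichotomy c 1 with h | h | h
    · exact absurd h4 (ne_of_lt (by
        calc c * c ≤ c * 1 := by gcongr
          _ < 1 := by rwa [mul_one]))
    · exact h
    · exact absurd h4 (ne_of_gt (by
        calc 1 < c * 1 := by rwa [mul_one]
          _ ≤ c * c := by gcongr))
  exact ⟨by rw [hc, h6, one_smul]⟩

include hμ in
/-- Integration over a subset of `R^m` that lies in the image of the units under `s ↦ s b`. -/
theorem lintegral_pi_unitMeasure {m : ℕ} {b : Fin m → R} (hb : ∀ k, b k ≠ 0)
    {h : (Fin m → R) → ℝ≥0∞} (hh : Measurable h)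
    (h0 : ∀ x, (¬ ∃ s : Fin m → Rˣ, x = fun k => (s k).1 * b k) → h x = 0) :
    ∫⁻ x, h x ∂Measure.pi (fun _ => μ) =
      ∫⁻ s, (∏ k, ‖(s k).1 * b k‖ₑ) * h (fun k => (s k).1 * b k)
        ∂Measure.pi fun _ : Fin m => unitMeasure μ := by
  have := sigmaFinite_unitMeasure (μ := μ)
  have hemb := fun k => (comap_mul_val hμ (hb k)).1
  have hτ : ∀ k, SigmaFinite ((unitMeasure μ).withDensity fun s => ‖s.1 * b k‖ₑ) := fun k => by
    rw [(comap_mul_val hμ (hb k)).2]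
    exact sigmaFinite_comap (hemb k) μ
  have hd : ∀ k, Measurable fun s : Rˣ => ‖s.1 * b k‖ₑ := fun k =>
    (measurable_unitsVal.mul_const _).enorm
  have hmap : Measurable fun (s : Fin m → Rˣ) (k : Fin m) => (s k).1 * b k :=
    measurable_pi_lambda _ fun k => (hemb k).measurable.comp (measurable_pi_apply k)
  have hprod : Measurable fun s : Fin m → Rˣ => ∏ k, ‖(s k).1 * b k‖ₑ :=
    Finset.measurable_prod _ fun k _ => (hd k).comp (measurable_pi_apply k)
  have h1 := pi_withDensity (fun _ : Fin m => unitMeasure μ) hd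
  have h2 : ∀ k, Measure.map (fun s : Rˣ => s.1 * b k)
      ((unitMeasure μ).withDensity fun s => ‖s.1 * b k‖ₑ) =
        μ.restrict (Set.range fun s : Rˣ => s.1 * b k) := fun k => by
    rw [(comap_mul_val hμ (hb k)).2, (hemb k).map_comap]
  have h3 : ∀ k, SigmaFinite (Measure.map (fun s : Rˣ => s.1 * b k)
      ((unitMeasure μ).withDensity fun s => ‖s.1 * b k‖ₑ)) := fun k => by
    rw [h2 k]; infer_instance
  have h4 := Measure.pi_map_pi (μ := fun k => (unitMeasure μ).withDensity fun s => ‖s.1 * b k‖ₑ)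
    (f := fun k (s : Rˣ) => s.1 * b k) fun k => (hemb k).measurable.aemeasurable
  rw [h1] at h4
  simp only [h2] at h4
  rw [← Measure.restrict_pi_pi] at h4
  have h5 : ∫⁻ x, h x ∂Measure.pi (fun _ => μ) =
      ∫⁻ x in Set.univ.pi fun k => Set.range fun s : Rˣ => s.1 * b k, h x
        ∂Measure.pi (fun _ => μ) := by
    rw [← lintegral_indicator (MeasurableSet.univ_pi fun k => (hemb k).measurableSet_range)]
    refine lintegral_congr fun x => ?_
    by_cases hx : x ∈ Set.univ.pi fun k => Set.range fun s : Rˣ => s.1 * b k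
    · rw [Set.indicator_of_mem hx]
    · rw [Set.indicator_of_notMem hx, h0]
      rintro ⟨s, rfl⟩
      exact hx fun k _ => ⟨s k, rfl⟩
  rw [h5, ← h4, lintegral_map hh hmap,
    lintegral_withDensity_eq_lintegral_mul _ hprod (g := fun s => h fun k => (s k).1 * b k)
      (hh.comp hmap)]
  rfl

end Units

/-! ### Coordinates on the unipotent group -/

section UnipAlgebra

variable {n : ℕ} {R : Type*} [CommRing R]

theorem transpose_mul_antidiag_mul_apply (u v : Matrix (Fin n) (Fin n) R) (a b : Fin n) :
    (uᵀ * antidiag n R * v) a b = ∑ k, u k a * v k.rev b := by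
  rw [Matrix.mul_assoc, Matrix.mul_apply]
  refine Finset.sum_congr rfl fun k _ => ?_
  rw [Matrix.transpose_apply, Matrix.mul_apply, Finset.sum_eq_single k.rev]
  · simp [antidiag]
  · intro l _ hl
    simp [antidiag, hl]
  · simp

theorem antidiag_mul_self : antidiag n R * antidiag n R = 1 := by
  ext i j
  rw [Matrix.mul_apply, Finset.sum_eq_single i.rev]
  · by_cases h : i = j
    · subst h; simp [antidiag]
    · have : j ≠ i.rev.rev := by rw [Fin.rev_rev]; exact fun h' => h h'.symm
      simp [antidiag, h, Ne.symm h]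
  · intro l _ hl
    simp [antidiag, hl]
  · simp

/-- Lower-triangular unipotent matrices preserving the anti-diagonal form. -/
def IsUnip (u : Matrix (Fin n) (Fin n) R) : Prop :=
  uᵀ * antidiag n R * u = antidiag n R ∧ (∀ i j : Fin n, i < j → u i j = 0) ∧ ∀ i, u i i = 1

theorem isUnip_of_mem (g : unipGroup n R) : IsUnip g.1.1 := g.2

theorem IsUnip.sum_eq_zero {u : Matrix (Fin n) (Fin n) R} (hu : IsUnip u) {a b : Fin n}
    (h : b ≠ a.rev) : ∑ k, u k a * u k.rev b = 0 := by
  rw [← transpose_mul_antidiag_mul_apply, hu.1]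
  simp [antidiag, h]

/-- The orthogonality relations identify, up to terms closer to the diagonal, an entry with minus
its reflection in the anti-diagonal. -/
theorem IsUnip.sub_add_sub_eq_zero {u u' : Matrix (Fin n) (Fin n) R} (hu : IsUnip u)
    (hu' : IsUnip u') {i j : Fin n} (hij : j < i)
    (h : ∀ k l : Fin n, (k : ℕ) + j < i + l → u k l = u' k l) :
    (u i j - u' i j) + (u j.rev i.rev - u' j.rev i.rev) = 0 := by
  have hne : i.rev ≠ j.rev := fun h' => hij.ne' (Fin.rev_injective h')
  have h1 := hu.sum_eq_zero (a := j) (b := i.rev) hne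
  have h2 := hu'.sum_eq_zero (a := j) (b := i.rev) hne
  have h3 : ∑ k, (u k j * u k.rev i.rev - u' k j * u' k.rev i.rev) = 0 := by
    rw [Finset.sum_sub_distrib, h1, h2, sub_zero]
  rw [Fintype.sum_eq_add j i hij.ne] at h3
  · rw [hu.2.2, hu'.2.2, hu.2.2, hu'.2.2] at h3
    rw [← h3]; ring
  · rintro k ⟨hkj, hki⟩
    rcases lt_or_gt_of_ne hkj with hk | hk
    · rw [hu.2.1 k j hk, hu'.2.1 k j hk]; ring
    · rcases lt_or_gt_of_ne hki with hk' | hk'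
      · have e1 : u k j = u' k j := h k j (by have : (k : ℕ) < i := hk'; omega)
        have e2 : u k.rev i.rev = u' k.rev i.rev := h _ _ (by
          have : (j : ℕ) < k := hk
          have := k.isLt
          have := i.isLt
          rw [Fin.val_rev, Fin.val_rev]
          omega)
        rw [e1, e2, sub_self]
      · have : k.rev < i.rev := Fin.rev_lt_rev.2 hk'
        rw [hu.2.1 _ _ this, hu'.2.1 _ _ this]; ring

variable [IsDomain R] [CharZero R]

/-- The entries of an element of `N` at distance less than `D` from the diagonal are determined by
those among them that are coordinates. -/
theorem IsUnip.eq_of_coords_eq {u u' : Matrix (Fin n) (Fin n) R} (hu : IsUnip u)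
    (hu' : IsUnip u') (D : ℕ)
    (h : ∀ q : unipIndex n, (q.1.1 : ℕ) < q.1.2 + D → u q.1.1 q.1.2 = u' q.1.1 q.1.2) :
    ∀ i j : Fin n, (i : ℕ) < j + D → u i j = u' i j := by
  suffices H : ∀ e : ℕ, ∀ i j : Fin n, (i : ℕ) < j + D → (i : ℕ) = j + e → u i j = u' i j by
    intro i j hij
    rcases lt_or_ge i j with hlt | hge
    · rw [hu.2.1 i j hlt, hu'.2.1 i j hlt]
    · have : (j : ℕ) ≤ i := hge
      exact H (i - j) i j hij (by omega)
  -- induction on the distance from the diagonal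
  intro e
  induction e using Nat.strong_induction_on with
  | _ e ih =>
    intro i j hij he
    have hi := i.isLt
    have hj := j.isLt
    rcases Nat.eq_zero_or_pos e with h0 | h0
    · have : i = j := Fin.ext (by omega)
      rw [this, hu.2.2, hu'.2.2]
    have hji : j < i := by show (j : ℕ) < i; omega
    by_cases hfree : (i : ℕ) + j + 2 ≤ n
    · exact h ⟨(i, j), hji, hfree⟩ hij
    have hag : ∀ k l : Fin n, (k : ℕ) + j < i + l → u k l = u' k l := by
      intro k l hkl
      rcases lt_or_ge k l with hlt | hge
      · rw [hu.2.1 k l hlt, hu'.2.1 k l hlt]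
      · have : (l : ℕ) ≤ k := hge
        exact ih (k - l) (by omega) k l (by omega) (by omega)
    have key := hu.sub_add_sub_eq_zero hu' hji hag
    have hri := Fin.val_rev i
    have hrj := Fin.val_rev j
    by_cases hmid : (i : ℕ) + j + 1 = n
    -- on the anti-diagonal, twice the entry is determined
    · have e1 : j.rev = i := Fin.ext (by omega)
      have e2 : i.rev = j := Fin.ext (by omega)
      rw [e1, e2, ← two_mul] at key
      rcases mul_eq_zero.1 key with h2 | h2
      · exact absurd h2 two_ne_zero
      · exact sub_eq_zero.1 h2
    · have hlt : i.rev < j.rev := Fin.rev_lt_rev.2 hji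
      have e1 : u j.rev i.rev = u' j.rev i.rev := h ⟨(j.rev, i.rev), hlt, by
        show (j.rev : ℕ) + i.rev + 2 ≤ n
        omega⟩ (by
        show (j.rev : ℕ) < i.rev + D
        omega)
      rw [e1, sub_self, add_zero] at key
      exact sub_eq_zero.1 key

/-- A numbering of the coordinates of `N`: by the distance from the diagonal, then by column. -/
def unipRank (q : unipIndex n) : ℕ := ((q.1.1 : ℕ) - q.1.2) * n + q.1.2

theorem unipRank_lt_of_lt {q q' : unipIndex n}
    (h : (q'.1.1 : ℕ) - q'.1.2 < q.1.1 - q.1.2) : unipRank q' < unipRank q := by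
  have h1 := q'.1.2.isLt
  have h2 := Nat.mul_le_mul_right n (Nat.succ_le_of_lt h)
  rw [Nat.succ_mul] at h2
  unfold unipRank
  omega

theorem unipRank_injective : Function.Injective (unipRank (n := n)) := by
  intro q q' h
  have h1 : (q.1.1 : ℕ) - q.1.2 = q'.1.1 - q'.1.2 := by
    by_contra hne
    rcases lt_or_gt_of_ne hne with h2 | h2
    · exact (unipRank_lt_of_lt h2).ne h
    · exact (unipRank_lt_of_lt h2).ne' h
  unfold unipRank at h
  rw [h1] at h
  have h2 : (q.1.2 : ℕ) < q.1.1 := q.2.1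
  have h3 : (q'.1.2 : ℕ) < q'.1.1 := q'.2.1
  exact Subtype.ext (Prod.ext (Fin.ext (by omega)) (Fin.ext (by omega)))

/-- The row `i - 1` attached to a coordinate `(i, j)` of `N`. -/
def unipRow (q : unipIndex n) : Fin n := ⟨q.1.1 - 1, by omega⟩

theorem unipRow_val (q : unipIndex n) : (unipRow q : ℕ) + 1 = q.1.1 := by
  have : (q.1.2 : ℕ) < q.1.1 := q.2.1
  show (q.1.1 : ℕ) - 1 + 1 = q.1.1
  omega

theorem mul_mul_transpose_apply (u B : Matrix (Fin n) (Fin n) R) (i j : Fin n) :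
    (u * B * uᵀ) i j = ∑ x : Fin n × Fin n, u i x.1 * B x.1 x.2 * u j x.2 := by
  rw [Matrix.mul_apply, Fintype.sum_prod_type_right]
  refine Finset.sum_congr rfl fun l _ => ?_
  rw [Matrix.mul_apply, Finset.sum_mul]
  rfl

/-- The action of `N` on the coordinates of `W₀` at the positions `(i - 1, n + 1 - j)` is
triangular in the coordinates `u_ij`: the diagonal coefficients are entries just above the
anti-diagonal. -/
theorem IsUnip.conj_sub_conj {u u' : Matrix (Fin n) (Fin n) R} (hu : IsUnip u)
    (hu' : IsUnip u') {B : Matrix (Fin n) (Fin n) R}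
    (hB : ∀ i j : Fin n, (i : ℕ) + (j : ℕ) + 2 < n → B i j = 0) (q : unipIndex n)
    (h : ∀ q' : unipIndex n, unipRank q' < unipRank q → u q'.1.1 q'.1.2 = u' q'.1.1 q'.1.2) :
    (u * B * uᵀ) (unipRow q) q.1.2.rev - (u' * B * u'ᵀ) (unipRow q) q.1.2.rev =
      -B (unipRow q) q.1.1.rev * (u q.1.1 q.1.2 - u' q.1.1 q.1.2) := by
  have hq : (q.1.2 : ℕ) < q.1.1 := q.2.1
  have hq2 := q.2.2
  have hrow := unipRow_val q
  have hag := hu.eq_of_coords_eq hu' (q.1.1 - q.1.2) fun q' hq' =>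
    h q' (unipRank_lt_of_lt (by have : (q'.1.2 : ℕ) < q'.1.1 := q'.2.1; omega))
  have key := hu.sub_add_sub_eq_zero hu' q.2.1 fun k l hkl => hag k l (by omega)
  have e1 := Fin.val_rev q.1.1
  have e2 := Fin.val_rev q.1.2
  have b1 := q.1.1.isLt
  rw [mul_mul_transpose_apply, mul_mul_transpose_apply, ← Finset.sum_sub_distrib,
    Fintype.sum_eq_single (unipRow q, q.1.1.rev)]
  · rw [hu.2.2, hu'.2.2]
    linear_combination B (unipRow q) q.1.1.rev * key
  rintro ⟨k, l⟩ hkl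
  simp only
  rw [sub_eq_zero]
  rcases lt_or_ge (unipRow q) k with hk | hk
  · rw [hu.2.1 _ _ hk, hu'.2.1 _ _ hk]
    ring
  rcases lt_or_ge q.1.2.rev l with hl | hl
  · rw [hu.2.1 _ _ hl, hu'.2.1 _ _ hl]
    ring
  by_cases hkl2 : (k : ℕ) + l + 2 < n
  · rw [hB k l hkl2]
    ring
  have hk' : (k : ℕ) ≤ unipRow q := hk
  have hl' : (l : ℕ) ≤ q.1.2.rev := hl
  have hl3 : u q.1.2.rev l = u' q.1.2.rev l := by
    refine hag _ _ ?_
    by_contra hcon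
    refine hkl (Prod.ext (Fin.ext ?_) (Fin.ext ?_))
    · show (k : ℕ) = unipRow q
      omega
    · show (l : ℕ) = q.1.1.rev
      omega
  have hk3 : u (unipRow q) k = u' (unipRow q) k := by
    by_cases hlt : (unipRow q : ℕ) < k + (q.1.1 - q.1.2)
    · exact hag _ _ hlt
    · refine h ⟨(unipRow q, k), ?_, ?_⟩ ?_
      · show (k : ℕ) < unipRow q
        omega
      · show (unipRow q : ℕ) + k + 2 ≤ n
        omega
      · have h3 : (unipRow q : ℕ) - k = q.1.1 - q.1.2 := by omega
        unfold unipRank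
        simp only [h3]
        omega
  rw [hk3, hl3]

end UnipAlgebra

/-! ### The Cayley transform -/

section Cayley

variable {n : ℕ} {R : Type*} [CommRing R] [IsDomain R] [CharZero R]

/-- The element `X` of the Lie algebra of `N` with given coordinates: `X` is strictly lower
triangular and `Xᵀ A = -A X`, so that the entries below the anti-diagonal are minus the
reflections of those above it, and the entries on the anti-diagonal vanish. -/
def lieElement (y : unipIndex n → R) : Matrix (Fin n) (Fin n) R := Matrix.of fun i j =>
  if h : j < i ∧ (i : ℕ) + j + 2 ≤ n then y ⟨(i, j), h⟩
  else if h : i.rev < j.rev ∧ (j.rev : ℕ) + i.rev + 2 ≤ n then -y ⟨(j.rev, i.rev), h⟩ else 0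

theorem lieElement_of_le (y : unipIndex n → R) {i j : Fin n} (h : i ≤ j) :
    lieElement y i j = 0 := by
  have h1 : ¬ (j < i ∧ (i : ℕ) + j + 2 ≤ n) := fun h' => absurd h'.1 (not_lt.2 h)
  have h2 : ¬ (i.rev < j.rev ∧ (j.rev : ℕ) + i.rev + 2 ≤ n) := fun h' =>
    absurd (Fin.rev_lt_rev.1 h'.1) (not_lt.2 h)
  simp only [lieElement, Matrix.of_apply]
  rw [dif_neg h1, dif_neg h2]

theorem lieElement_coord (y : unipIndex n → R) (q : unipIndex n) :
    lieElement y q.1.1 q.1.2 = y q := by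
  simp only [lieElement, Matrix.of_apply]
  rw [dif_pos q.2]

theorem lieElement_rev (y : unipIndex n → R) (i j : Fin n) :
    lieElement y j.rev i.rev = -lieElement y i j := by
  have hi := i.isLt
  have hj := j.isLt
  have hri := Fin.val_rev i
  have hrj := Fin.val_rev j
  simp only [lieElement, Matrix.of_apply, Fin.rev_rev]
  by_cases h1 : j < i ∧ (i : ℕ) + j + 2 ≤ n
  · have h2 : ¬ (i.rev < j.rev ∧ (j.rev : ℕ) + i.rev + 2 ≤ n) := fun h' => by omega
    simp only [dif_pos h1, dif_neg h2]
  · by_cases h2 : i.rev < j.rev ∧ (j.rev : ℕ) + i.rev + 2 ≤ n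
    · simp only [dif_neg h1, dif_pos h2, neg_neg]
    · simp only [dif_neg h1, dif_neg h2, neg_zero]

theorem lieElement_congr {y y' : unipIndex n → R} (D : ℕ)
    (h : ∀ q : unipIndex n, (q.1.1 : ℕ) < q.1.2 + D → y q = y' q) (i j : Fin n)
    (hij : (i : ℕ) < j + D) : lieElement y i j = lieElement y' i j := by
  have hi := i.isLt
  have hj := j.isLt
  have hri := Fin.val_rev i
  have hrj := Fin.val_rev j
  simp only [lieElement, Matrix.of_apply]
  split_ifs with h1 h2
  · exact h _ hij
  · rw [h]
    show (j.rev : ℕ) < i.rev + D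
    omega
  · rfl

theorem lieElement_transpose_mul (y : unipIndex n → R) :
    (lieElement y)ᵀ * antidiag n R = -(antidiag n R * lieElement y) := by
  ext i j
  rw [Matrix.neg_apply, Matrix.mul_apply, Matrix.mul_apply, Finset.sum_eq_single j.rev,
    Finset.sum_eq_single i.rev]
  · have := lieElement_rev y j.rev i
    rw [Fin.rev_rev] at this
    simp [antidiag, this]
  · intro l _ hl
    simp [antidiag, hl]
  · simp
  · intro l _ hl
    have : ¬ j = l.rev := fun h => hl (by rw [h, Fin.rev_rev])
    simp [antidiag, this]
  · simp

theorem isUnit_det_one_sub_lieElement (y : unipIndex n → R) : IsUnit (1 - lieElement y).det := by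
  have h : (1 - lieElement y).BlockTriangular OrderDual.toDual := by
    intro i j hij
    have hij' : i < j := hij
    rw [Matrix.sub_apply, Matrix.one_apply_ne hij'.ne, lieElement_of_le y hij'.le, sub_zero]
  rw [Matrix.det_of_isLowerTriangular _ h, Finset.prod_eq_one]
  · exact isUnit_one
  · intro i _
    rw [Matrix.sub_apply, Matrix.one_apply_eq, lieElement_of_le y le_rfl, sub_zero]

/-- The Cayley transform of an element of the Lie algebra of `N`. -/
noncomputable def cayley (y : unipIndex n → R) : Matrix (Fin n) (Fin n) R :=
  (1 + lieElement y) * (1 - lieElement y)⁻¹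

theorem cayley_mul (y : unipIndex n → R) :
    cayley y * (1 - lieElement y) = 1 + lieElement y := by
  rw [cayley, Matrix.mul_assoc, Matrix.nonsing_inv_mul _ (isUnit_det_one_sub_lieElement y),
    Matrix.mul_one]

theorem cayley_eq (y : unipIndex n → R) :
    cayley y = 1 + lieElement y + cayley y * lieElement y := by
  rw [← cayley_mul, Matrix.mul_sub, Matrix.mul_one, sub_add_cancel]

theorem cayley_of_lt (y : unipIndex n → R) {i j : Fin n} (hij : i < j) : cayley y i j = 0 := by
  have h1 : (1 + lieElement y).BlockTriangular OrderDual.toDual := by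
    intro i j hij
    have hij' : i < j := hij
    rw [Matrix.add_apply, Matrix.one_apply_ne hij'.ne, lieElement_of_le y hij'.le, add_zero]
  have h2 : (1 - lieElement y).BlockTriangular OrderDual.toDual := by
    intro i j hij
    have hij' : i < j := hij
    rw [Matrix.sub_apply, Matrix.one_apply_ne hij'.ne, lieElement_of_le y hij'.le, sub_zero]
  have : Invertible (1 - lieElement y) :=
    Matrix.invertibleOfIsUnitDet _ (isUnit_det_one_sub_lieElement y)
  exact (h1.mul (Matrix.blockTriangular_inv_of_blockTriangular h2)) hij

theorem cayley_diag (y : unipIndex n → R) (i : Fin n) : cayley y i i = 1 := by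
  rw [cayley_eq, Matrix.add_apply, Matrix.add_apply, Matrix.one_apply_eq,
    lieElement_of_le y le_rfl, Matrix.mul_apply, Finset.sum_eq_zero, add_zero, add_zero]
  intro k _
  rcases lt_or_ge i k with h | h
  · rw [cayley_of_lt y h, zero_mul]
  · rw [lieElement_of_le y h, mul_zero]

theorem isUnip_cayley (y : unipIndex n → R) : IsUnip (cayley y) := by
  refine ⟨?_, fun i j => cayley_of_lt y, cayley_diag y⟩
  set X := lieElement y
  set A := antidiag n R
  have hX : Xᵀ * A = -(A * X) := lieElement_transpose_mul y
  have hu := isUnit_det_one_sub_lieElement y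
  have h1 : (1 - X)ᵀ * ((cayley y)ᵀ * A * cayley y) * (1 - X) = (1 - X)ᵀ * A * (1 - X) := by
    calc (1 - X)ᵀ * ((cayley y)ᵀ * A * cayley y) * (1 - X)
        = (cayley y * (1 - X))ᵀ * A * (cayley y * (1 - X)) := by
          rw [Matrix.transpose_mul]
          simp only [Matrix.mul_assoc]
      _ = (1 + X)ᵀ * A * (1 + X) := by rw [cayley_mul]
      _ = (1 - X)ᵀ * A * (1 - X) := by
          rw [Matrix.transpose_add, Matrix.transpose_sub, Matrix.transpose_one, Matrix.add_mul,
            Matrix.sub_mul, hX]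
          simp only [Matrix.one_mul, Matrix.mul_add, Matrix.mul_sub, Matrix.mul_one,
            Matrix.add_mul, Matrix.sub_mul, Matrix.neg_mul]
          abel
  have hu' : IsUnit (1 - X)ᵀ.det := by rwa [Matrix.det_transpose]
  calc (cayley y)ᵀ * A * cayley y
      = ((1 - X)ᵀ)⁻¹ * ((1 - X)ᵀ * ((cayley y)ᵀ * A * cayley y) * (1 - X) * (1 - X)⁻¹) := by
        rw [Matrix.mul_nonsing_inv_cancel_right _ _ hu, Matrix.nonsing_inv_mul_cancel_left _ _ hu']
    _ = A := by
        rw [h1, Matrix.mul_nonsing_inv_cancel_right _ _ hu,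
          Matrix.nonsing_inv_mul_cancel_left _ _ hu']

/-- The Cayley transform is triangular in the entries, with diagonal coefficients `2`. -/
theorem cayley_sub_cayley {y y' : unipIndex n → R} {i j : Fin n}
    (hX : ∀ k l : Fin n, (k : ℕ) + j < i + l → lieElement y k l = lieElement y' k l)
    (hg : ∀ k l : Fin n, (k : ℕ) + j < i + l → cayley y k l = cayley y' k l) :
    cayley y i j - cayley y' i j = 2 * (lieElement y i j - lieElement y' i j) := by
  have h1 : (cayley y * lieElement y) i j - (cayley y' * lieElement y') i j =
      lieElement y i j - lieElement y' i j := by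
    rw [Matrix.mul_apply, Matrix.mul_apply, ← Finset.sum_sub_distrib, Fintype.sum_eq_single i]
    · rw [cayley_diag, cayley_diag, one_mul, one_mul]
    · intro k hk
      rcases lt_or_gt_of_ne hk with hk | hk
      · rcases lt_or_ge j k with hjk | hjk
        · have a1 : (k : ℕ) < i := hk
          have a2 : (j : ℕ) < k := hjk
          rw [hX k j (by omega), hg i k (by omega), sub_self]
        · rw [lieElement_of_le y hjk, lieElement_of_le y' hjk]
          ring
      · rw [cayley_of_lt y hk, cayley_of_lt y' hk]
        ring
  have e1 := congrFun (congrFun (cayley_eq y) i) j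
  have e2 := congrFun (congrFun (cayley_eq y') i) j
  rw [Matrix.add_apply, Matrix.add_apply] at e1 e2
  linear_combination e1 - e2 + h1

theorem cayley_congr {y y' : unipIndex n → R} (D : ℕ)
    (h : ∀ q : unipIndex n, (q.1.1 : ℕ) < q.1.2 + D → y q = y' q) :
    ∀ i j : Fin n, (i : ℕ) < j + D → cayley y i j = cayley y' i j := by
  have hX := lieElement_congr D h
  suffices H : ∀ e : ℕ, ∀ i j : Fin n, (i : ℕ) < j + D → (i : ℕ) = j + e →
      cayley y i j = cayley y' i j by
    intro i j hij
    rcases lt_or_ge i j with hlt | hge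
    · rw [cayley_of_lt y hlt, cayley_of_lt y' hlt]
    · have : (j : ℕ) ≤ i := hge
      exact H (i - j) i j hij (by omega)
  intro e
  induction e using Nat.strong_induction_on with
  | _ e ih =>
    intro i j hij he
    rcases Nat.eq_zero_or_pos e with h0 | h0
    · have : i = j := Fin.ext (by omega)
      rw [this, cayley_diag, cayley_diag]
    have key := cayley_sub_cayley (y := y) (y' := y') (i := i) (j := j)
      (fun k l hkl => hX k l (by omega))
      (fun k l hkl => by
        rcases lt_or_ge k l with hlt | hge
        · rw [cayley_of_lt y hlt, cayley_of_lt y' hlt]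
        · have : (l : ℕ) ≤ k := hge
          exact ih (k - l) (by omega) k l (by omega) (by omega))
    rw [hX i j hij, sub_self, mul_zero] at key
    exact sub_eq_zero.1 key

end Cayley

/-! ### Measurability on the unipotent group -/

section UnipMeasure

variable {n : ℕ} {R : Type*} [NormedCommRing R] [NormMulClass R] [NormOneClass R] [IsDomain R]
  [CharZero R] [ProperSpace R] [MeasurableSpace R] [BorelSpace R]

theorem measurable_matrix_apply (i j : Fin n) :
    Measurable fun M : Matrix (Fin n) (Fin n) R => M i j :=
  (measurable_pi_apply j).comp (measurable_pi_apply (X := fun _ : Fin n => Fin n → R) i)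

theorem measurable_matrix_of {X : Type*} [MeasurableSpace X]
    {f : X → Matrix (Fin n) (Fin n) R} (h : ∀ i j, Measurable fun x => f x i j) : Measurable f :=
  measurable_pi_lambda _ fun i => measurable_pi_lambda _ fun j => h i j

theorem measurable_matrix_mul {X : Type*} [MeasurableSpace X]
    {f g : X → Matrix (Fin n) (Fin n) R} (hf : Measurable f) (hg : Measurable g) :
    Measurable fun x => f x * g x := by
  refine measurable_matrix_of fun i j => ?_
  simp only [Matrix.mul_apply]
  exact Finset.measurable_sum _ fun k _ =>
    ((measurable_matrix_apply i k).comp hf).mul ((measurable_matrix_apply k j).comp hg)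

theorem measurable_matrix_transpose {X : Type*} [MeasurableSpace X]
    {f : X → Matrix (Fin n) (Fin n) R} (hf : Measurable f) : Measurable fun x => (f x)ᵀ :=
  measurable_matrix_of fun i j => (measurable_matrix_apply j i).comp hf

theorem borelSpace_matrix : BorelSpace (Matrix (Fin n) (Fin n) R) :=
  inferInstanceAs (BorelSpace (Fin n → Fin n → R))

theorem sigmaCompactSpace_matrix : SigmaCompactSpace (Matrix (Fin n) (Fin n) R) :=
  inferInstanceAs (SigmaCompactSpace (Fin n → Fin n → R))

theorem standardBorelSpace_matrix : StandardBorelSpace (Matrix (Fin n) (Fin n) R) :=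
  inferInstanceAs (StandardBorelSpace (Fin n → Fin n → R))

theorem isClosed_isUnip : IsClosed {u : Matrix (Fin n) (Fin n) R | IsUnip u} := by
  have hc : ∀ i j : Fin n, Continuous fun u : Matrix (Fin n) (Fin n) R => u i j := fun i j =>
    continuous_id.matrix_elem i j
  have h1 : IsClosed {u : Matrix (Fin n) (Fin n) R | uᵀ * antidiag n R * u = antidiag n R} :=
    isClosed_eq ((continuous_id.matrix_transpose.matrix_mul continuous_const).matrix_mul
      continuous_id) continuous_const
  have h2 : IsClosed {u : Matrix (Fin n) (Fin n) R | ∀ i j : Fin n, i < j → u i j = 0} := by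
    simp only [Set.ofPred_forall]
    exact isClosed_iInter fun i => isClosed_iInter fun j => isClosed_iInter fun _ =>
      isClosed_eq (hc i j) continuous_const
  have h3 : IsClosed {u : Matrix (Fin n) (Fin n) R | ∀ i : Fin n, u i i = 1} := by
    simp only [Set.ofPred_forall]
    exact isClosed_iInter fun i => isClosed_eq (hc i i) continuous_const
  exact h1.inter (h2.inter h3)

/-- The element of `N` with a given matrix. -/
def unipOfMatrix (u : Matrix (Fin n) (Fin n) R) (hu : IsUnip u) : unipGroup n R :=
  ⟨⟨u, antidiag n R * uᵀ * antidiag n R, by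
      rw [mul_eq_one_comm, Matrix.mul_assoc, Matrix.mul_assoc, ← Matrix.mul_assoc uᵀ, hu.1,
        antidiag_mul_self], by
      rw [Matrix.mul_assoc, Matrix.mul_assoc, ← Matrix.mul_assoc uᵀ, hu.1,
        antidiag_mul_self]⟩, hu⟩

theorem range_unipVal : Set.range (fun g : unipGroup n R => g.1.1) = {u | IsUnip u} := by
  ext u
  exact ⟨fun ⟨g, hg⟩ => hg ▸ isUnip_of_mem g, fun hu => ⟨unipOfMatrix u hu, rfl⟩⟩

theorem measurableEmbedding_unipVal :
    MeasurableEmbedding (fun g : unipGroup n R => g.1.1) := by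
  have := borelSpace_matrix (n := n) (R := R)
  rw [MeasurableEmbedding.iff_comap_eq]
  refine ⟨fun g g' h => Subtype.ext (Units.ext h), ?_, ?_⟩
  · exact (MeasurableSpace.comap_comp (g := fun g : unipGroup n R => g.1)
      (f := Units.val)).symm
  · rw [range_unipVal]
    exact isClosed_isUnip.measurableSet

theorem measurable_unipVal : Measurable (fun g : unipGroup n R => g.1.1) :=
  measurableEmbedding_unipVal.measurable

theorem standardBorelSpace_unipGroup : StandardBorelSpace (unipGroup n R) :=
  have := standardBorelSpace_matrix (n := n) (R := R)
  standardBorelSpace_of_measurableEmbedding (measurableEmbedding_unipVal (n := n) (R := R))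

theorem unipCoords_injective : Function.Injective (unipCoords n (R := R)) := by
  intro g g' h
  refine Subtype.ext (Units.ext ?_)
  ext i j
  refine (isUnip_of_mem g).eq_of_coords_eq (isUnip_of_mem g') (n + 1)
    (fun q _ => congrFun h q) i j ?_
  have := i.isLt
  omega

theorem measurable_unipCoords : Measurable (unipCoords n (R := R)) :=
  measurable_pi_lambda _ fun q => (measurable_matrix_apply q.1.1 q.1.2).comp measurable_unipVal

theorem measurableEmbedding_unipCoords : MeasurableEmbedding (unipCoords n (R := R)) :=
  have := standardBorelSpace_unipGroup (n := n) (R := R)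
  measurable_unipCoords.measurableEmbedding unipCoords_injective

theorem measurableSet_range_unipCoords (s : Set (unipIndex n)) :
    MeasurableSet (Set.range fun (g : unipGroup n R) (q : s) => unipCoords n g q.1) := by
  have := sigmaCompactSpace_matrix (n := n) (R := R)
  have h1 : (Set.range fun (g : unipGroup n R) (q : s) => unipCoords n g q.1) =
      (fun (u : Matrix (Fin n) (Fin n) R) (q : s) => u q.1.1.1 q.1.1.2) '' {u | IsUnip u} := by
    rw [← range_unipVal, ← Set.range_comp]
    rfl
  have h2 : IsSigmaCompact ((fun (u : Matrix (Fin n) (Fin n) R) (q : s) => u q.1.1.1 q.1.1.2) ''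
      {u | IsUnip u}) := by
    refine (isSigmaCompact_univ.of_isClosed_subset isClosed_isUnip (Set.subset_univ _)).image ?_
    exact continuous_pi fun q => continuous_id.matrix_elem q.1.1.1 q.1.1.2
  rw [h1]
  obtain ⟨K, hK, hU⟩ := h2
  rw [← hU]
  exact MeasurableSet.iUnion fun i => (hK i).measurableSet

variable {μ : Measure R} [μ.IsAddHaarMeasure] (hμ : IsModulus μ)

theorem measurable_lieElement :
    Measurable (lieElement : (unipIndex n → R) → Matrix (Fin n) (Fin n) R) := by
  refine measurable_matrix_of fun i j => ?_
  simp only [lieElement, Matrix.of_apply]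
  split_ifs with h1 h2
  · exact measurable_pi_apply _
  · exact (measurable_pi_apply _).neg
  · exact measurable_const

theorem measurable_cayley :
    Measurable (cayley : (unipIndex n → R) → Matrix (Fin n) (Fin n) R) := by
  refine measurable_matrix_of fun i j => ?_
  have hX : ∀ i j, Measurable fun y : unipIndex n → R => lieElement y i j := fun i j =>
    (measurable_matrix_apply i j).comp measurable_lieElement
  -- the identity `g = 1 + X + g X` expresses the columns of `g` through those further to the right
  induction h : n - (j : ℕ) using Nat.strong_induction_on generalizing j with
  | _ e ih =>
    have h1 : (fun y : unipIndex n → R => cayley y i j) = fun y => (1 : Matrix _ _ R) i j +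
        lieElement y i j + ∑ k ∈ Finset.univ.filter (j < ·), cayley y i k * lieElement y k j := by
      funext y
      conv_lhs => rw [cayley_eq]
      rw [Matrix.add_apply, Matrix.add_apply, Matrix.mul_apply, Finset.sum_filter]
      congr 1
      refine Finset.sum_congr rfl fun k _ => ?_
      split_ifs with hk
      · rfl
      · rw [lieElement_of_le y (not_lt.1 hk), mul_zero]
    rw [h1]
    refine (measurable_const.add (hX i j)).add (Finset.measurable_sum _ fun k hk => ?_)
    have hk' : (j : ℕ) < k := (Finset.mem_filter.1 hk).2
    have := k.isLt
    exact (ih (n - k) (by omega) k rfl).mul (hX k j)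

include hμ in
/-- The Cayley transform shows that `N` is not negligible in its space of coordinates. -/
theorem measure_range_unipCoords_ne_zero :
    (Measure.pi fun _ : unipIndex n => μ) (Set.range (unipCoords n (R := R))) ≠ 0 := by
  let F : (unipIndex n → R) → unipIndex n → R := fun y q => cayley y q.1.1 q.1.2
  have hF : Measurable F := measurable_pi_lambda _ fun q =>
    (measurable_matrix_apply q.1.1 q.1.2).comp measurable_cayley
  obtain ⟨h1, h2⟩ := comap_triangular hμ unipRank unipRank_injective (a := fun _ => (2 : R))
    (fun _ => two_ne_zero) hF (by
      intro q y y' hy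
      have hlt : (q.1.2 : ℕ) < q.1.1 := q.2.1
      have h' : ∀ q' : unipIndex n, (q'.1.1 : ℕ) < q'.1.2 + (q.1.1 - q.1.2) → y q' = y' q' :=
        fun q' hq' => hy q' (unipRank_lt_of_lt (by
          have : (q'.1.2 : ℕ) < q'.1.1 := q'.2.1
          omega))
      have key := cayley_sub_cayley (y := y) (y' := y') (i := q.1.1) (j := q.1.2)
        (fun k l hkl => lieElement_congr _ h' k l (by omega))
        (fun k l hkl => cayley_congr _ h' k l (by omega))
      rw [lieElement_coord, lieElement_coord] at key
      simp only [F]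
      linear_combination key)
  have h3 : (Measure.pi fun _ : unipIndex n => μ) (Set.range F) ≠ 0 := by
    rw [← Set.image_univ, ← h1.comap_apply, h2, Measure.smul_apply, smul_eq_mul]
    refine mul_ne_zero (Finset.prod_ne_zero_iff.2 fun q _ => by simp) ?_
    exact isOpen_univ.measure_ne_zero _ Set.univ_nonempty
  refine fun h => h3 (measure_mono_null ?_ h)
  rintro _ ⟨y, rfl⟩
  exact ⟨unipOfMatrix _ (isUnip_cayley y), rfl⟩

end UnipMeasure

/-! ### Determinants of Hessenberg matrices -/

section Hessenberg

/-- Expansion of the determinant of a lower Hessenberg matrix whose last row is `r`, where `P k` is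
the determinant of the leading `k × k` block of `H`. -/
theorem det_hessenberg {S : Type*} [CommRing S] {H : ℕ → ℕ → S}
    (hH : ∀ i j, i + 1 < j → H i j = 0) {P : ℕ → S} (h0 : P 0 = 1)
    (hP : ∀ k, P (k + 1) = ∑ j ∈ Finset.range (k + 1),
      (-1) ^ (k - j) * H k j * (∏ i ∈ Finset.Ico j k, H i (i + 1)) * P j) (k : ℕ) (r : ℕ → S) :
    (Matrix.of fun i j : Fin (k + 1) => if (i : ℕ) < k then H i j else r j).det =
      ∑ j ∈ Finset.range (k + 1),
        (-1) ^ (k - j) * r j * (∏ i ∈ Finset.Ico j k, H i (i + 1)) * P j := by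
  induction k generalizing r with
  | zero => simp [h0]
  | succ k ih =>
    have hk1 : (Fin.last (k + 1)) ≠ (Fin.last k).castSucc := by
      intro h
      have := congrArg Fin.val h
      simp at this
    rw [Matrix.det_succ_column _ (Fin.last (k + 1)), Fintype.sum_eq_add _ _ hk1]
    · have e1 : ((Matrix.of fun i j : Fin (k + 2) =>
          if (i : ℕ) < k + 1 then H i j else r j).submatrix
          (Fin.last (k + 1)).succAbove (Fin.last (k + 1)).succAbove) =
          Matrix.of fun i j : Fin (k + 1) => if (i : ℕ) < k then H i j else H k j := by
        ext i j
        have hi := i.isLt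
        simp only [Matrix.submatrix_apply, Matrix.of_apply, Fin.succAbove_last, Fin.val_castSucc]
        rw [if_pos hi]
        split_ifs with h
        · rfl
        · rw [show (i : ℕ) = k by omega]
      have e2 : ((Matrix.of fun i j : Fin (k + 2) =>
          if (i : ℕ) < k + 1 then H i j else r j).submatrix
          (Fin.last k).castSucc.succAbove (Fin.last (k + 1)).succAbove) =
          Matrix.of fun i j : Fin (k + 1) => if (i : ℕ) < k then H i j else r j := by
        ext i j
        have hi := i.isLt
        simp only [Matrix.submatrix_apply, Matrix.of_apply, Fin.succAbove_last, Fin.val_castSucc]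
        by_cases h : (i : ℕ) < k
        · have : (Fin.last k).castSucc.succAbove i = i.castSucc :=
            Fin.succAbove_of_castSucc_lt _ _ (by
              show (i : ℕ) < k
              exact h)
          rw [this, if_pos h, if_pos (by rw [Fin.val_castSucc]; omega), Fin.val_castSucc]
        · have : (Fin.last k).castSucc.succAbove i = i.succ :=
            Fin.succAbove_of_le_castSucc _ _ (by
              show k ≤ (i : ℕ)
              omega)
          rw [this, if_neg h, if_neg (by rw [Fin.val_succ]; omega)]
      rw [e1, e2, ih, ih, ← hP]
      simp only [Matrix.of_apply, Fin.val_last, Fin.val_castSucc, lt_irrefl, if_false,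
        Nat.lt_succ_self, if_true]
      rw [Finset.sum_range_succ _ (k + 1), Nat.sub_self, pow_zero, Finset.Ico_self,
        Finset.prod_empty, add_comm, Finset.mul_sum]
      congr 1
      · refine Finset.sum_congr rfl fun j hj => ?_
        have hj' : j ≤ k := Nat.lt_succ_iff.1 (Finset.mem_range.1 hj)
        rw [Finset.prod_Ico_succ_top hj', Nat.succ_sub hj', pow_succ]
        have : (-1 : S) ^ (k + (k + 1)) = -1 := by
          rw [← add_assoc, ← two_mul, pow_succ, pow_mul]
          simp
        rw [this]
        ring
      · have : (-1 : S) ^ (k + 1 + (k + 1)) = 1 := by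
          rw [← two_mul, pow_mul]
          simp
        rw [this]
        ring
    · rintro i ⟨hi1, hi2⟩
      have hi := i.isLt
      have h1 : (i : ℕ) ≠ k + 1 := fun h => hi1 (Fin.ext h)
      have h2 : (i : ℕ) ≠ k := fun h => hi2 (Fin.ext h)
      simp only [Matrix.of_apply, Fin.val_last]
      rw [if_pos (by omega), hH _ _ (by omega)]
      ring

variable {R : Type*} [CommRing R]

/-- The characteristic polynomials `det (x + M_k)` of the leading `k × k` blocks `M_k` of a lower
Hessenberg matrix `M`, given by their recursion. -/
noncomputable def hessPoly (M : ℕ → ℕ → R) : ℕ → R[X]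
  | 0 => 1
  | k + 1 => X * hessPoly M k + ∑ j : Fin (k + 1),
      C ((-1) ^ (k - (j : ℕ)) * M k j * ∏ i ∈ Finset.Ico (j : ℕ) k, M i (i + 1)) * hessPoly M j

theorem hessPoly_succ (M : ℕ → ℕ → R) (k : ℕ) :
    hessPoly M (k + 1) = X * hessPoly M k + ∑ j ∈ Finset.range (k + 1),
      C ((-1) ^ (k - j) * M k j * ∏ i ∈ Finset.Ico j k, M i (i + 1)) * hessPoly M j := by
  rw [hessPoly, Finset.sum_range]

theorem det_eq_hessPoly {M : ℕ → ℕ → R} {n : ℕ} (hM : ∀ i j, i + 1 < j → M i j = 0) :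
    (Matrix.of fun i j : Fin n => (if i = j then (X : R[X]) else 0) + C (M i j)).det =
      hessPoly M n := by
  rcases n with _ | k
  · simp [hessPoly]
  let H : ℕ → ℕ → R[X] := fun i j => (if i = j then (X : R[X]) else 0) + C (M i j)
  have hH1 : ∀ i, H i (i + 1) = C (M i (i + 1)) := fun i => by simp [H]
  have hP : ∀ k, hessPoly M (k + 1) = ∑ j ∈ Finset.range (k + 1),
      (-1) ^ (k - j) * H k j * (∏ i ∈ Finset.Ico j k, H i (i + 1)) * hessPoly M j := by
    intro k
    have e : ∀ j ∈ Finset.range (k + 1),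
        (-1) ^ (k - j) * H k j * (∏ i ∈ Finset.Ico j k, H i (i + 1)) * hessPoly M j =
        (if k = j then X * hessPoly M k else 0) +
          C ((-1) ^ (k - j) * M k j * ∏ i ∈ Finset.Ico j k, M i (i + 1)) * hessPoly M j := by
      intro j _
      simp only [hH1, map_mul, map_pow, map_neg, map_one, map_prod]
      by_cases hkj : k = j
      · subst hkj
        simp [H]
        ring
      · simp [H, hkj]
    rw [Finset.sum_congr rfl e, Finset.sum_add_distrib, hessPoly_succ]
    simp
  have := det_hessenberg (H := H) (fun i j hij => by
    have h1 : ¬ i = j := by omega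
    simp [H, hM i j hij, h1]) (P := hessPoly M) (by simp [hessPoly]) hP k (H k)
  rw [hP, ← this]
  congr 1
  ext1 i j
  have hi := i.isLt
  have h1 : (if (i : ℕ) < k then H i j else H k j) = H i j := by
    split_ifs with h
    · rfl
    · congr 1
      omega
  simp only [Matrix.of_apply, h1, H, Fin.ext_iff]

theorem hessPoly_coeff (M : ℕ → ℕ → R) (k i : ℕ) (h : k ≤ i) :
    (hessPoly M k).coeff i = if i = k then 1 else 0 := by
  induction k using Nat.strong_induction_on generalizing i with
  | _ k ih =>
    rcases k with _ | k
    · rw [hessPoly, Polynomial.coeff_one]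
    · obtain ⟨i, rfl⟩ : ∃ i', i = i' + 1 := ⟨i - 1, by omega⟩
      rw [hessPoly_succ, Polynomial.coeff_add, Polynomial.coeff_X_mul, ih k (by omega) i (by omega),
        Polynomial.finsetSum_coeff, Finset.sum_eq_zero, add_zero]
      · simp
      · intro j hj
        have hj' := Finset.mem_range.1 hj
        rw [Polynomial.coeff_C_mul, ih j hj' (i + 1) (by omega), if_neg (by omega), mul_zero]

/-- The coefficient of `x^(k-1-d)` in `det (x + M_k)` is an affine function of the `d`-th
subdiagonal of `M`, once the superdiagonal and the diagonals before the `d`-th are fixed. -/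
theorem hessPoly_coeff_sub {M M' : ℕ → ℕ → R} {d : ℕ}
    (h1 : ∀ i, M i (i + 1) = M' i (i + 1)) (h2 : ∀ i j, j ≤ i → i < j + d → M i j = M' i j)
    (k i : ℕ) (hki : k ≤ i + d + 1) :
    (hessPoly M k).coeff i - (hessPoly M' k).coeff i =
      if i + d + 1 = k then (-1) ^ d * ∑ j ∈ Finset.range (i + 1),
        (∏ l ∈ Finset.Ico j (j + d), M l (l + 1)) * (M (j + d) j - M' (j + d) j) else 0 := by
  induction k using Nat.strong_induction_on generalizing i with
  | _ k ih =>
    rcases k with _ | k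
    · rw [hessPoly, hessPoly, sub_self, if_neg (by omega)]
    have hX : (X * hessPoly M k).coeff i - (X * hessPoly M' k).coeff i =
        if i + d + 1 = k + 1 then (-1) ^ d * ∑ j ∈ Finset.range i,
        (∏ l ∈ Finset.Ico j (j + d), M l (l + 1)) * (M (j + d) j - M' (j + d) j) else 0 := by
      rcases i with _ | i
      · simp
      · rw [Polynomial.coeff_X_mul, Polynomial.coeff_X_mul, ih k (by omega) i (by omega)]
        have : (i + d + 1 = k) = (i + 1 + d + 1 = k + 1) := propext (by omega)
        simp only [this]
    have hS : (∑ j ∈ Finset.range (k + 1), C ((-1) ^ (k - j) * M k j *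
          ∏ i ∈ Finset.Ico j k, M i (i + 1)) * hessPoly M j).coeff i -
        (∑ j ∈ Finset.range (k + 1), C ((-1) ^ (k - j) * M' k j *
          ∏ i ∈ Finset.Ico j k, M' i (i + 1)) * hessPoly M' j).coeff i =
        if i + d + 1 = k + 1 then (-1) ^ d * ((∏ l ∈ Finset.Ico i (i + d), M l (l + 1)) *
          (M (i + d) i - M' (i + d) i)) else 0 := by
      simp only [Polynomial.finsetSum_coeff, Polynomial.coeff_C_mul, ← h1]
      rw [← Finset.sum_sub_distrib]
      have e : ∀ j ∈ Finset.range (k + 1),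
          (-1) ^ (k - j) * M k j * (∏ i ∈ Finset.Ico j k, M i (i + 1)) * (hessPoly M j).coeff i -
          (-1) ^ (k - j) * M' k j * (∏ i ∈ Finset.Ico j k, M i (i + 1)) * (hessPoly M' j).coeff i =
          if j = i ∧ i + d = k then (-1) ^ d * ((∏ l ∈ Finset.Ico i (i + d), M l (l + 1)) *
          (M (i + d) i - M' (i + d) i)) else 0 := by
        intro j hj
        have hj' := Finset.mem_range.1 hj
        rcases lt_or_ge k (j + d) with hlt | hge
        · have h3 := ih j hj' i (by omega)
          rw [if_neg (by omega), sub_eq_zero] at h3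
          rw [h2 k j (by omega) hlt, h3, sub_self, if_neg (by omega)]
        · rw [hessPoly_coeff M j i (by omega), hessPoly_coeff M' j i (by omega)]
          by_cases hij : i = j
          · subst hij
            by_cases hk : i + d = k
            · subst hk
              simp only [if_true, and_self, Nat.add_sub_cancel_left]
              ring
            · omega
          · rw [if_neg hij, if_neg (fun h => hij h.1.symm)]
            ring
      rw [Finset.sum_congr rfl e]
      by_cases hk : i + d = k
      · have hi : i ∈ Finset.range (k + 1) := Finset.mem_range.2 (by omega)
        rw [if_pos (by omega)]
        simp only [hk, and_true]
        rw [Finset.sum_ite_eq' , if_pos hi]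
      · rw [if_neg (by omega)]
        simp [hk]
    rw [hessPoly_succ, hessPoly_succ, Polynomial.coeff_add, Polynomial.coeff_add, add_sub_add_comm,
      hX, hS]
    split_ifs
    · rw [Finset.sum_range_succ, mul_add]
    · rw [add_zero]

end Hessenberg

/-! ### The invariant polynomial -/

section Inv

variable {n : ℕ} {R : Type*} [CommRing R]

/-- The entries of the matrix `B A`, indexed by natural numbers. It is lower Hessenberg and
symmetric under reflection in the anti-diagonal. Entries out of range are `0`. -/
def hessMat (B : W0 n R) (i j : ℕ) : R :=
  if h : i < n ∧ j < n then B.1 ⟨i, h.1⟩ (Fin.rev ⟨j, h.2⟩) else 0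

theorem hessMat_fin (B : W0 n R) (i j : Fin n) : hessMat B i j = B.1 i j.rev := by
  rw [hessMat, dif_pos ⟨i.isLt, j.isLt⟩]

theorem apply_eq_hessMat (B : W0 n R) (i j : Fin n) : B.1 i j = hessMat B i (n - 1 - j) := by
  have hj := j.isLt
  have := hessMat_fin B i j.rev
  rw [Fin.rev_rev] at this
  rw [← this, Fin.val_rev]
  congr 1
  omega

theorem hessMat_eq_zero (B : W0 n R) (i j : ℕ) (h : i + 1 < j) : hessMat B i j = 0 := by
  unfold hessMat
  split_ifs with h'
  · refine B.2.2 _ _ ?_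
    rw [Fin.val_rev]
    show i + (n - (j + 1)) + 2 < n
    omega
  · rfl

theorem hessMat_symm (B : W0 n R) {i j : ℕ} (hi : i < n) (hj : j < n) :
    hessMat B i j = hessMat B (n - 1 - j) (n - 1 - i) := by
  have h1 := hessMat_fin B ⟨i, hi⟩ ⟨j, hj⟩
  have h2 := hessMat_fin B (Fin.rev ⟨j, hj⟩) (Fin.rev ⟨i, hi⟩)
  rw [Fin.rev_rev, ← B.2.1.apply] at h2
  rw [Fin.val_rev, Fin.val_rev] at h2
  have e1 : n - 1 - j = n - (j + 1) := by omega
  have e2 : n - 1 - i = n - (i + 1) := by omega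
  rw [e1, e2]
  exact h1.trans h2.symm

theorem sign_revPerm (n : ℕ) :
    ((Equiv.Perm.sign (Fin.revPerm : Equiv.Perm (Fin n)) : ℤˣ) : ℤ) = (-1) ^ (n / 2) := by
  rw [Equiv.Perm.sign_eq_prod_prod_Iio]
  have h1 : ∀ j : Fin n, (∏ i ∈ Finset.Iio j,
      (if Fin.revPerm i < Fin.revPerm j then 1 else -1 : ℤˣ)) = (-1) ^ (j : ℕ) := by
    intro j
    rw [Finset.prod_congr rfl (g := fun _ => (-1 : ℤˣ))]
    · rw [Finset.prod_const, Fin.card_Iio]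
    · intro i hi
      rw [if_neg]
      simp only [Fin.revPerm_apply, Fin.rev_lt_rev, not_lt]
      exact (Finset.mem_Iio.1 hi).le
  simp only [h1]
  rw [Finset.prod_pow_eq_pow_sum, Fin.sum_univ_eq_sum_range (fun i => i) n, Finset.sum_range_id]
  push_cast
  rcases Nat.even_or_odd' n with ⟨k, rfl | rfl⟩
  · rcases k with _ | k
    · simp
    · have : 2 * (k + 1) * (2 * (k + 1) - 1) / 2 = 2 * (k * (k + 1)) + (k + 1) := by
        rw [show 2 * (k + 1) - 1 = 2 * k + 1 by omega,
          show 2 * (k + 1) * (2 * k + 1) = 2 * (2 * (k * (k + 1)) + (k + 1)) by ring,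
          Nat.mul_div_cancel_left _ two_pos]
      rw [this, Nat.mul_div_cancel_left _ two_pos, pow_add, pow_mul]
      simp
  · have : (2 * k + 1) * (2 * k + 1 - 1) / 2 = 2 * (k * k) + k := by
      rw [show 2 * k + 1 - 1 = 2 * k by omega,
        show (2 * k + 1) * (2 * k) = 2 * (2 * (k * k) + k) by ring,
        Nat.mul_div_cancel_left _ two_pos]
    rw [this, show (2 * k + 1) / 2 = k by omega, pow_add, pow_mul]
    simp

theorem det_antidiag (S : Type*) [CommRing S] : (antidiag n S).det = (-1) ^ (n / 2) := by
  have h : antidiag n S = (1 : Matrix (Fin n) (Fin n) S).submatrix Fin.revPerm id := by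
    ext i j
    simp only [antidiag, Matrix.of_apply, Matrix.submatrix_apply, Matrix.one_apply, id,
      Fin.revPerm_apply, eq_comm]
  rw [h, Matrix.det_permute, Matrix.det_one, mul_one, sign_revPerm]
  push_cast
  rfl

/-- The sign in the definition of the invariant polynomial is `det A`; hence the invariant
polynomial of `B` is `det (x + B A)`. -/
theorem inv_eq_det (B : W0 n R) : B.inv =
    (Matrix.of fun i j : Fin n => (if i = j then (X : R[X]) else 0) + C (hessMat B i j)).det := by
  have h : (X : R[X]) • (antidiag n R).map C + B.1.map C =
      (Matrix.of fun i j : Fin n => (if i = j then (X : R[X]) else 0) + C (hessMat B i j)) *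
        antidiag n R[X] := by
    ext1 i j
    rw [Matrix.mul_apply, Finset.sum_eq_single j.rev]
    · have h1 : (j = i.rev) = (i = j.rev) := propext ⟨fun h => by rw [h, Fin.rev_rev],
        fun h => by rw [h, Fin.rev_rev]⟩
      simp [antidiag, hessMat_fin, h1]
    · intro l _ hl
      have : ¬ j = l.rev := fun h => hl (by rw [h, Fin.rev_rev])
      simp [antidiag, this]
    · simp
  rw [W0.inv, h, Matrix.det_mul, det_antidiag, mul_comm, mul_assoc, ← pow_add, ← two_mul, pow_mul]
  simp

theorem inv_eq_hessPoly (B : W0 n R) : B.inv = hessPoly (hessMat B) n := by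
  rw [inv_eq_det, det_eq_hessPoly (hessMat_eq_zero B)]

theorem inv_eq_monicPoly (B : W0 n R) : B.inv = monicPoly fun i : Fin n => B.inv.coeff i := by
  ext k
  rw [inv_eq_hessPoly, monicPoly, Polynomial.coeff_add, Polynomial.coeff_X_pow,
    Polynomial.finsetSum_coeff]
  simp only [Polynomial.coeff_C_mul, Polynomial.coeff_X_pow]
  rcases lt_or_ge k n with h | h
  · rw [if_neg (by omega), zero_add, Finset.sum_eq_single ⟨k, h⟩]
    · simp
    · intro b _ hb
      have : k ≠ b := fun h' => hb (Fin.ext h'.symm)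
      simp [this]
    · simp
  · rw [hessPoly_coeff _ _ _ h, Finset.sum_eq_zero, add_zero]
    intro b _
    have : k ≠ b := by have := b.isLt; omega
    simp [this]

theorem monicPoly_coeff (c : Fin n → R) (i : Fin n) : (monicPoly c).coeff i = c i := by
  rw [monicPoly, Polynomial.coeff_add, Polynomial.coeff_X_pow, Polynomial.finsetSum_coeff,
    if_neg i.isLt.ne, zero_add]
  simp only [Polynomial.coeff_C_mul, Polynomial.coeff_X_pow]
  rw [Finset.sum_eq_single i]
  · simp
  · intro b _ hb
    have : (i : ℕ) ≠ b := fun h' => hb (Fin.ext h'.symm)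
    simp [this]
  · simp

theorem inv_eq_monicPoly_iff (B : W0 n R) (c : Fin n → R) :
    B.inv = monicPoly c ↔ (fun i : Fin n => B.inv.coeff i) = c := by
  constructor
  · intro h
    funext i
    rw [h, monicPoly_coeff]
  · intro h
    rw [← h]
    exact inv_eq_monicPoly B

/-- Up to sign, the coefficient of the middle entry of the `d`-th diagonal of `B A` in the
coefficient of `x^(n-1-d)` of the invariant polynomial. The `d`-th diagonal has `n - d` entries;
if this number is even, then the two entries at the middle coincide by symmetry, whence the factor
`2`. -/
def invSlope (B : W0 n R) (d : ℕ) : R :=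
  (if Even (n - 1 - d) then 1 else 2) *
    ∏ l ∈ Finset.Ico ((n - 1 - d) / 2) ((n - 1 - d) / 2 + d), hessMat B l (l + 1)

/-- The invariants are triangular in the entries at the middle of the diagonals. -/
theorem inv_coeff_sub {B B' : W0 n R} {d : ℕ} (hd : d < n)
    (h1 : ∀ i, hessMat B i (i + 1) = hessMat B' i (i + 1))
    (h2 : ∀ i j, j ≤ i → i < j + d → hessMat B i j = hessMat B' i j)
    (h3 : ∀ j, 2 * (j + 1) + d + 1 ≤ n → hessMat B (j + d) j = hessMat B' (j + d) j) :
    B.inv.coeff (n - 1 - d) - B'.inv.coeff (n - 1 - d) =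
      (-1) ^ d * invSlope B d * (hessMat B ((n - 1 - d) / 2 + d) ((n - 1 - d) / 2) -
        hessMat B' ((n - 1 - d) / 2 + d) ((n - 1 - d) / 2)) := by
  rw [inv_eq_hessPoly, inv_eq_hessPoly, hessPoly_coeff_sub h1 h2 n _ (by omega), if_pos (by omega)]
  obtain ⟨N, hN⟩ : ∃ N, n - 1 - d = N := ⟨_, rfl⟩
  obtain ⟨l, hl⟩ : ∃ l, N / 2 = l := ⟨_, rfl⟩
  have hsym : ∀ (B : W0 n R) j, j ≤ N → hessMat B (N - j + d) (N - j) = hessMat B (j + d) j := by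
    intro B j hj
    rw [hessMat_symm B (by omega) (by omega)]
    congr 1 <;> omega
  have hz : ∀ j ∈ Finset.range (N + 1), j ≠ l → j ≠ N - l →
      (∏ l ∈ Finset.Ico j (j + d), hessMat B l (l + 1)) *
        (hessMat B (j + d) j - hessMat B' (j + d) j) = 0 := by
    intro j hj hj1 hj2
    have hj' := Finset.mem_range.1 hj
    rcases lt_or_gt_of_ne hj1 with h | h
    · rw [h3 j (by omega), sub_self, mul_zero]
    · have e := h3 (N - j) (by omega)
      rw [hsym B j (by omega), hsym B' j (by omega)] at e
      rw [e, sub_self, mul_zero]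
  rw [hN, invSlope, hN, hl, mul_assoc]
  congr 1
  by_cases hev : Even N
  · have hNl : N - l = l := by
      obtain ⟨k, hk⟩ := hev
      omega
    rw [if_pos hev, one_mul, Finset.sum_eq_single l]
    · intro j hj hj1
      exact hz j hj hj1 (by rwa [hNl])
    · intro h
      exact absurd (Finset.mem_range.2 (by omega)) h
  · have hNl : N - l = l + 1 := by
      rw [Nat.not_even_iff_odd] at hev
      obtain ⟨k, hk⟩ := hev
      omega
    have hs : Finset.range (N + 1) ⊇ {l, l + 1} := by
      intro x hx
      rw [Finset.mem_insert, Finset.mem_singleton] at hx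
      exact Finset.mem_range.2 (by omega)
    rw [if_neg hev, ← Finset.sum_subset hs, Finset.sum_pair (by omega)]
    · -- the two middle entries of the diagonal coincide, and so do the products of the
      -- superdiagonal entries that they come with
      have e1 : ∀ B : W0 n R, hessMat B (l + 1 + d) (l + 1) = hessMat B (l + d) l := fun B => by
        have := hsym B l (by omega)
        rwa [hNl] at this
      have e2 : ∏ i ∈ Finset.Ico (l + 1) (l + 1 + d), hessMat B i (i + 1) =
          ∏ i ∈ Finset.Ico l (l + d), hessMat B i (i + 1) := by
        refine Finset.prod_bij' (fun i _ => 2 * l + d - i) (fun i _ => 2 * l + d - i) ?_ ?_ ?_ ?_ ?_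
        · intro i hi
          rw [Finset.mem_Ico] at hi ⊢
          omega
        · intro i hi
          rw [Finset.mem_Ico] at hi ⊢
          omega
        · intro i hi
          rw [Finset.mem_Ico] at hi
          show 2 * l + d - (2 * l + d - i) = i
          omega
        · intro i hi
          rw [Finset.mem_Ico] at hi
          show 2 * l + d - (2 * l + d - i) = i
          omega
        · intro i hi
          rw [Finset.mem_Ico] at hi
          rw [hessMat_symm B (by omega) (by omega)]
          congr 1 <;> omega
      rw [e1 B, e1 B', e2]
      ring
    · intro j hj hj1
      rw [Finset.mem_insert, Finset.mem_singleton, not_or] at hj1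
      exact hz j hj hj1.1 (by rw [hNl]; exact hj1.2)

end Inv

/-! ### The discriminant of the invariant polynomial -/

section Discriminant

variable {n : ℕ} {R : Type*} [CommRing R] [IsDomain R] [CharZero R]

theorem monicPoly_monic (c : Fin n → R) : (monicPoly c).Monic ∧ (monicPoly c).natDegree = n := by
  have h : (∑ i : Fin n, C (c i) * X ^ (i : ℕ)).degree < (n : WithBot ℕ) := by
    refine lt_of_le_of_lt (Polynomial.degree_sum_le _ _) ?_
    refine (Finset.sup_lt_iff (WithBot.bot_lt_coe (n : ℕ))).2 fun i _ => ?_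
    exact lt_of_le_of_lt (Polynomial.degree_C_mul_X_pow_le _ _)
      (Nat.cast_lt.2 i.isLt)
  refine ⟨Polynomial.monic_X_pow_add h, ?_⟩
  refine Polynomial.natDegree_eq_of_degree_eq_some ?_
  rw [monicPoly, Polynomial.degree_add_eq_left_of_degree_lt (by rwa [Polynomial.degree_X_pow]),
    Polynomial.degree_X_pow]

theorem injective_algebraMap_algebraicClosure :
    Function.Injective (algebraMap R (AlgebraicClosure (FractionRing R))) := by
  rw [IsScalarTower.algebraMap_eq R (FractionRing R) (AlgebraicClosure (FractionRing R))]
  exact (algebraMap (FractionRing R) (AlgebraicClosure (FractionRing R))).injective.comp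
    (IsFractionRing.injective R (FractionRing R))

/-- For a monic polynomial, the discriminant vanishes if and only if the resultant with the
derivative does, and if and only if there is a multiple root in an algebraic closure. -/
theorem discr_eq_zero_iff {f : R[X]} (hf : f.Monic) (h0 : 0 < f.natDegree) :
    (f.discr = 0 ↔ f.resultant f.derivative f.natDegree (f.natDegree - 1) = 0) ∧
    (f.discr = 0 ↔ ∃ a : AlgebraicClosure (FractionRing R), aeval a f = 0 ∧
      aeval a f.derivative = 0) := by
  have h1 := Polynomial.resultant_deriv (Polynomial.natDegree_pos_iff_degree_pos.1 h0)
  have h2 : f.discr = 0 ↔ f.resultant f.derivative f.natDegree (f.natDegree - 1) = 0 := by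
    rw [h1, hf.leadingCoeff, mul_one]
    constructor
    · intro h
      rw [h, mul_zero]
    · intro h
      exact (mul_eq_zero.1 h).resolve_left (pow_ne_zero _ (by simp))
  refine ⟨h2, ?_⟩
  let K := AlgebraicClosure (FractionRing R)
  have hinj : Function.Injective (algebraMap R K) := injective_algebraMap_algebraicClosure
  have : CharZero K := charZero_of_injective_algebraMap hinj
  set F := f.map (algebraMap R K) with hF
  have hFd : F.natDegree = f.natDegree := Polynomial.natDegree_map_eq_of_injective hinj f
  have hFd' : F.derivative.natDegree = f.natDegree - 1 := by
    rw [Polynomial.natDegree_derivative, hFd]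
  have h3 : f.resultant f.derivative f.natDegree (f.natDegree - 1) = 0 ↔
      F.resultant F.derivative = 0 := by
    rw [hFd', hFd, hF, Polynomial.derivative_map, Polynomial.resultant_map_map,
      map_eq_zero_iff _ hinj]
  have hF0 : F ≠ 0 := (hf.map _).ne_zero
  rw [h2, h3, Polynomial.resultant_eq_zero_iff,
    Polynomial.isCoprime_iff_aeval_ne_zero_of_isAlgClosed K K]
  push Not
  simp only [hF, Polynomial.derivative_map, Polynomial.aeval_map_algebraMap]
  exact ⟨fun h => h.2, fun h => ⟨Or.inl hF0, h⟩⟩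

theorem discr_eq_zero_of_sq_dvd {f g : R[X]} (hf : f.Monic)
    (h0 : 0 < g.natDegree) (h : g * g ∣ f) : f.discr = 0 := by
  obtain ⟨e, rfl⟩ := h
  have hpos : 0 < (g * g * e).natDegree :=
    lt_of_lt_of_le h0 (Polynomial.natDegree_le_of_dvd ⟨g * e, by ring⟩ hf.ne_zero)
  rw [(discr_eq_zero_iff hf hpos).2]
  let K := AlgebraicClosure (FractionRing R)
  have hinj : Function.Injective (algebraMap R K) := injective_algebraMap_algebraicClosure
  obtain ⟨a, ha⟩ := IsAlgClosed.exists_root (g.map (algebraMap R K)) (by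
    rw [Polynomial.degree_map_eq_of_injective hinj]
    exact (Polynomial.natDegree_pos_iff_degree_pos.1 h0).ne')
  rw [Polynomial.IsRoot, Polynomial.eval_map_algebraMap] at ha
  refine ⟨a, ?_, ?_⟩
  · simp [ha]
  · simp [Polynomial.derivative_mul, ha]

/-- If an entry next to the anti-diagonal vanishes then `B A` is block triangular, with two
diagonal blocks exchanged by the reflection in the anti-diagonal. -/
theorem discr_inv_eq_zero (B : W0 n R) {k : ℕ} (hk : 2 * (k + 1) ≤ n)
    (h : hessMat B k (k + 1) = 0) : B.inv.discr = 0 := by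
  let Q : Matrix (Fin n) (Fin n) R[X] :=
    Matrix.of fun i j : Fin n => (if i = j then (X : R[X]) else 0) + C (hessMat B i j)
  -- the numbers of the three diagonal blocks; they decrease, for block lower triangularity
  let b : Fin n → ℕ := fun i =>
    if (i : ℕ) < k + 1 then 2 else if (i : ℕ) < n - (k + 1) then 1 else 0
  have h' : hessMat B (n - 1 - (k + 1)) (n - 1 - k) = 0 := by
    rw [← hessMat_symm B (by omega) (by omega), h]
  have hQ : Q.BlockTriangular b := by
    intro i j hij
    have hi := i.isLt
    have hj := j.isLt
    have hlt : (i : ℕ) < j := by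
      by_contra hcon
      simp only [b] at hij
      split_ifs at hij <;> omega
    have hne : i ≠ j := by
      rintro rfl
      exact lt_irrefl _ hlt
    have hz : hessMat B i j = 0 := by
      rcases Nat.lt_or_ge ((i : ℕ) + 1) j with h1 | h1
      · exact hessMat_eq_zero B _ _ h1
      · simp only [b] at hij
        by_cases h2 : (i : ℕ) = k
        · rw [h2, show (j : ℕ) = k + 1 by omega, h]
        · have h3 : (i : ℕ) = n - 1 - (k + 1) := by
            split_ifs at hij <;> omega
          rw [h3, show (j : ℕ) = n - 1 - k by omega, h']
    simp [Q, hne, hz]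
  have hsq : ∀ a : ℕ, Q.toSquareBlock b a =
      (-(Matrix.of fun i j : {i // b i = a} => hessMat B i.1 j.1)).charmatrix := by
    intro a
    ext1 i j
    rw [Matrix.charmatrix_apply]
    simp only [Matrix.toSquareBlock_def, Matrix.of_apply, Q, Matrix.neg_apply, map_neg,
      sub_neg_eq_add, Matrix.diagonal_apply, Subtype.ext_iff]
  let e : {i // b i = 2} ≃ {i // b i = 0} :=
    { toFun := fun i => ⟨i.1.rev, by
        have h1 := i.2
        have h2 := i.1.isLt
        simp only [b, Fin.val_rev] at h1 ⊢
        split_ifs at h1 ⊢ <;> omega⟩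
      invFun := fun i => ⟨i.1.rev, by
        have h1 := i.2
        have h2 := i.1.isLt
        simp only [b, Fin.val_rev] at h1 ⊢
        split_ifs at h1 ⊢ <;> omega⟩
      left_inv := fun i => Subtype.ext (Fin.rev_rev _)
      right_inv := fun i => Subtype.ext (Fin.rev_rev _) }
  set g := (Q.toSquareBlock b 2).det with hg
  have hg0 : (Q.toSquareBlock b 0).det = g := by
    rw [← Matrix.det_submatrix_equiv_self e, hg, ← Matrix.det_transpose]
    congr 1
    ext1 i j
    have hi := i.1.isLt
    have hj := j.1.isLt
    simp only [Matrix.transpose_apply, Matrix.submatrix_apply, Matrix.toSquareBlock_def,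
      Matrix.of_apply, Q, e, Equiv.coe_fn_mk]
    have h1 : hessMat B (j.1.rev : ℕ) (i.1.rev : ℕ) = hessMat B i.1 j.1 := by
      rw [hessMat_symm B j.1.rev.isLt i.1.rev.isLt, Fin.val_rev, Fin.val_rev]
      congr 1 <;> omega
    rw [h1]
    simp only [Fin.rev_inj, eq_comm]
  have hdvd : g * g ∣ B.inv := by
    rw [inv_eq_det, show (Matrix.of fun i j : Fin n =>
      (if i = j then (X : R[X]) else 0) + C (hessMat B i j)) = Q from rfl, hQ.det]
    have hs : ({2, 0} : Finset ℕ) ⊆ Finset.image b Finset.univ := by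
      intro a ha
      rw [Finset.mem_insert, Finset.mem_singleton] at ha
      rw [Finset.mem_image]
      rcases ha with rfl | rfl
      · exact ⟨⟨0, by omega⟩, Finset.mem_univ _, by simp [b]⟩
      · refine ⟨⟨n - 1, by omega⟩, Finset.mem_univ _, ?_⟩
        simp only [b]
        split_ifs <;> omega
    have := Finset.prod_dvd_prod_of_subset _ _ (fun a => (Q.toSquareBlock b a).det) hs
    rwa [Finset.prod_pair (by norm_num), hg0] at this
  have hgc : g = (-(Matrix.of fun i j : {i // b i = 2} => hessMat B i.1 j.1)).charpoly := by
    rw [hg, hsq, Matrix.charpoly]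
  have hne : Nonempty {i // b i = 2} := ⟨⟨⟨0, by omega⟩, by simp [b]⟩⟩
  refine discr_eq_zero_of_sq_dvd (g := g) ?_ ?_ hdvd
  · rw [inv_eq_monicPoly]
    exact (monicPoly_monic _).1
  · rw [hgc, Matrix.charpoly_natDegree_eq_dim]
    exact Fintype.card_pos

end Discriminant

/-! ### Polynomials of vanishing discriminant form a null set -/

section DiscrNull

variable {n : ℕ} {R : Type*} [NormedCommRing R] [NormMulClass R] [NormOneClass R] [IsDomain R]
  [CharZero R] [ProperSpace R] [MeasurableSpace R] [BorelSpace R]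
  {μ : Measure R} [μ.IsAddHaarMeasure] [NullSingletonClass μ]

/-- For given higher coefficients, the polynomial has a multiple root for finitely many constant
terms only: these are determined by the roots of the derivative. -/
theorem finite_setOf_discr_eq_zero (hn : 0 < n) (c : Fin n → R) :
    {x : R | (monicPoly (Function.update c ⟨0, hn⟩ x)).discr = 0}.Finite := by
  let K := AlgebraicClosure (FractionRing R)
  have hinj : Function.Injective (algebraMap R K) := injective_algebraMap_algebraicClosure
  let f := monicPoly (Function.update c ⟨0, hn⟩ 0)
  have hf : ∀ x, monicPoly (Function.update c ⟨0, hn⟩ x) = f + C x := by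
    intro x
    have : ∑ i : Fin n, C (Function.update c ⟨0, hn⟩ x i) * (X : R[X]) ^ (i : ℕ) =
        ∑ i : Fin n, C (Function.update c ⟨0, hn⟩ 0 i) * (X : R[X]) ^ (i : ℕ) + C x := by
      rw [← Finset.add_sum_erase _ _ (Finset.mem_univ (⟨0, hn⟩ : Fin n)),
        ← Finset.add_sum_erase (s := Finset.univ) (a := (⟨0, hn⟩ : Fin n))
          (h := Finset.mem_univ _)]
      rw [Finset.sum_congr rfl (g := fun i : Fin n =>
        C (Function.update c ⟨0, hn⟩ 0 i) * (X : R[X]) ^ (i : ℕ))]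
      · simp
        ring
      · intro i hi
        have := Finset.ne_of_mem_erase hi
        simp [this]
    simp only [f, monicPoly, this, add_assoc]
  have hd : f.derivative ≠ 0 := by
    intro h
    have h1 := Polynomial.derivative_eq_zero.1 h
    rw [(monicPoly_monic _).2] at h1
    omega
  have hfin : {a : K | aeval a f.derivative = 0}.Finite := by
    have h1 : f.derivative.map (algebraMap R K) ≠ 0 :=
      (Polynomial.map_ne_zero_iff hinj).2 hd
    refine (Polynomial.finite_setOfPred_isRoot h1).subset ?_
    intro a ha
    rw [Set.mem_ofPred_eq, Polynomial.IsRoot, Polynomial.eval_map_algebraMap]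
    exact ha
  refine Set.Finite.subset ((hfin.image fun a => -aeval a f).preimage hinj.injOn) ?_
  intro x hx
  have hx' : (monicPoly (Function.update c ⟨0, hn⟩ x)).discr = 0 := hx
  rw [(discr_eq_zero_iff (monicPoly_monic _).1 (by rw [(monicPoly_monic _).2]; exact hn)).2,
    hf] at hx'
  obtain ⟨a, ha, ha'⟩ := hx'
  refine ⟨a, ?_, ?_⟩
  · simpa using ha'
  · simp only [map_add, Polynomial.aeval_C] at ha
    exact (eq_neg_of_add_eq_zero_right ha).symm

theorem measurableSet_discr_eq_zero (hn : 0 < n) :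
    MeasurableSet {c : Fin n → R | (monicPoly c).discr = 0} := by
  have hc : ∀ k : ℕ, Continuous fun c : Fin n → R => (monicPoly c).coeff k := by
    intro k
    simp only [monicPoly, Polynomial.coeff_add, Polynomial.finsetSum_coeff, Polynomial.coeff_C_mul]
    fun_prop
  have h1 : {c : Fin n → R | (monicPoly c).discr = 0} = {c : Fin n → R |
      (monicPoly c).resultant (monicPoly c).derivative n (n - 1) = 0} := by
    ext c
    have := (discr_eq_zero_iff (monicPoly_monic c).1 (by rw [(monicPoly_monic c).2]; exact hn)).1
    rw [(monicPoly_monic c).2] at this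
    exact this
  rw [h1]
  refine (isClosed_eq ?_ continuous_const).measurableSet
  unfold Polynomial.resultant
  refine Continuous.matrix_det ?_
  refine continuous_matrix fun i j => ?_
  simp only [Polynomial.sylvester, Matrix.of_apply]
  induction j using Fin.addCases with
  | left j =>
    simp only [Fin.addCases_left]
    split_ifs
    · simp only [Polynomial.coeff_derivative]
      exact (hc _).mul continuous_const
    · exact continuous_const
  | right j =>
    simp only [Fin.addCases_right]
    split_ifs
    · exact hc _
    · exact continuous_const

theorem measure_discr_eq_zero (hn : 0 < n) :
    (Measure.pi fun _ : Fin n => μ) {c : Fin n → R | (monicPoly c).discr = 0} = 0 := by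
  have hm := measurableSet_discr_eq_zero (R := R) hn
  rw [← lintegral_indicator_one hm, ← lintegral_zero (μ := Measure.pi fun _ : Fin n => μ)]
  refine lintegral_eq_of_lmarginal_eq {⟨0, hn⟩} (measurable_one.indicator hm) measurable_const ?_
  rw [lmarginal_singleton, lmarginal_singleton]
  funext c
  have h1 : (fun x => {c : Fin n → R | (monicPoly c).discr = 0}.indicator (1 : (Fin n → R) → ℝ≥0∞)
      (Function.update c ⟨0, hn⟩ x)) =
      {x : R | (monicPoly (Function.update c ⟨0, hn⟩ x)).discr = 0}.indicator 1 := rfl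
  have h2 := finite_setOf_discr_eq_zero hn c
  rw [h1, lintegral_indicator_one h2.measurableSet, h2.measure_zero]
  simp

end DiscrNull

/-! ### The monomial `λ` -/

section Monomials

variable {n : ℕ} {M : Type*} [CommMonoid M]

theorem prod_unipIndex (F : ℕ → ℕ → M) :
    ∏ q : unipIndex n, F q.1.1 q.1.2 =
      ∏ a ∈ Finset.range (n / 2), ∏ i ∈ Finset.Ico (a + 1) (n - (a + 1)), F i a := by
  rw [Finset.prod_sigma']
  refine Finset.prod_bij (fun q _ => ⟨(q.1.2 : ℕ), (q.1.1 : ℕ)⟩) ?_ ?_ ?_ ?_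
  · intro q _
    have h1 : (q.1.2 : ℕ) < q.1.1 := q.2.1
    have h2 := q.2.2
    rw [Finset.mem_sigma, Finset.mem_range, Finset.mem_Ico]
    dsimp only
    omega
  · intro q _ q' _ h
    simp only [Sigma.mk.injEq, heq_eq_eq] at h
    exact Subtype.ext (Prod.ext (Fin.ext h.2) (Fin.ext h.1))
  · rintro ⟨a, i⟩ h
    rw [Finset.mem_sigma, Finset.mem_range, Finset.mem_Ico] at h
    dsimp only at h
    exact ⟨⟨(⟨i, by omega⟩, ⟨a, by omega⟩), by rw [Fin.lt_def]; exact h.2.1,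
      by dsimp only; omega⟩, Finset.mem_univ _, rfl⟩
  · intro q _
    rfl

/-- Folding a product over an interval that is symmetric under `l ↦ n - 2 - l`. -/
theorem prod_Ico_fold {b : ℕ → M} (hb : ∀ k, k + 2 ≤ n → b (n - 2 - k) = b k) {a : ℕ}
    (ha : a ≤ n / 2) :
    ∏ l ∈ Finset.Ico a (n - 1 - a), b l =
      ∏ k ∈ Finset.Ico a (n / 2), b k ^ (if 2 * (k + 1) = n then 1 else 2) := by
  induction ha using Nat.decreasingInduction with
  | self =>
    rw [Finset.Ico_eq_empty (by omega), Finset.Ico_eq_empty (by omega), Finset.prod_empty,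
      Finset.prod_empty]
  | of_succ a ha ih =>
    rw [Finset.prod_eq_prod_Ico_succ_bot (by omega), Finset.prod_eq_prod_Ico_succ_bot ha, ← ih]
    split_ifs with h
    · rw [pow_one, Finset.Ico_eq_empty (by omega), Finset.Ico_eq_empty (by omega)]
    · obtain ⟨N, hN⟩ : ∃ N, n - 1 - a = N + 1 := ⟨n - 2 - a, by omega⟩
      rw [hN, Finset.prod_Ico_succ_top (by omega), show n - 1 - (a + 1) = N by omega,
        show N = n - 2 - a by omega, hb a (by omega), pow_two]
      ac_rfl

theorem prod_range_two_mul (g : ℕ → M) (m : ℕ) :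
    ∏ i ∈ Finset.range (2 * m), g i = ∏ a ∈ Finset.range m, g (2 * a) * g (2 * a + 1) := by
  induction m with
  | zero => simp
  | succ m ih =>
    rw [Nat.mul_succ, Finset.prod_range_succ, Finset.prod_range_succ, ih, Finset.prod_range_succ,
      mul_assoc]

/-- The monomial identity behind the weight `λ`: the product of the slopes of the invariants is
`λ` times the monomial by which the coordinates of an orbit are scaled. -/
theorem prod_slopes_eq {b : ℕ → M} (hb : ∀ k, k + 2 ≤ n → b (n - 2 - k) = b k) :
    ∏ i : Fin n, ∏ l ∈ Finset.Ico ((i : ℕ) / 2) ((i : ℕ) / 2 + (n - 1 - i)), b l =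
      (∏ k : Fin (n / 2), b k ^ (if 2 * ((k : ℕ) + 1) = n then (n - 2) / 2 else 2 * (k : ℕ) + 1)) *
        ((∏ k : Fin (n / 2), b k) * ∏ q : unipIndex n, b (q.1.1 - 1)) := by
  have h1 : ∏ q : unipIndex n, b (q.1.1 - 1) =
      ∏ a ∈ Finset.range (n / 2), ∏ l ∈ Finset.Ico a (n - 2 - a), b l := by
    rw [prod_unipIndex fun i _ => b (i - 1)]
    refine Finset.prod_congr rfl fun a ha => ?_
    rw [Finset.mem_range] at ha
    rw [show n - (a + 1) = n - 2 - a + 1 by omega, ← Finset.prod_Ico_add' (fun i => b (i - 1))]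
    rfl
  have h2 : ∏ i : Fin n, ∏ l ∈ Finset.Ico ((i : ℕ) / 2) ((i : ℕ) / 2 + (n - 1 - i)), b l =
      ∏ a ∈ Finset.range (n / 2), (∏ l ∈ Finset.Ico a (n - 1 - a), b l) *
        ∏ l ∈ Finset.Ico a (n - 2 - a), b l := by
    rw [← Finset.prod_range
      (fun i => ∏ l ∈ Finset.Ico (i / 2) (i / 2 + (n - 1 - i)), b l)]
    have h3 : ∏ i ∈ Finset.range n, ∏ l ∈ Finset.Ico (i / 2) (i / 2 + (n - 1 - i)), b l =
        ∏ i ∈ Finset.range (2 * (n / 2)),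
          ∏ l ∈ Finset.Ico (i / 2) (i / 2 + (n - 1 - i)), b l := by
      rcases Nat.even_or_odd' n with ⟨m, hm | hm⟩
      · rw [show 2 * (n / 2) = n by omega]
      · obtain ⟨N, hN⟩ : ∃ N, 2 * (n / 2) = N := ⟨_, rfl⟩
        have hN' : n = N + 1 := by omega
        rw [hN]
        conv_lhs => rw [hN', Finset.prod_range_succ]
        rw [Finset.Ico_eq_empty (by omega), Finset.prod_empty, mul_one, hN']
    rw [h3, prod_range_two_mul]
    refine Finset.prod_congr rfl fun a ha => ?_
    rw [Finset.mem_range] at ha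
    rw [show 2 * a / 2 = a by omega, show (2 * a + 1) / 2 = a by omega,
      show a + (n - 1 - 2 * a) = n - 1 - a by omega,
      show a + (n - 1 - (2 * a + 1)) = n - 2 - a by omega]
  have h3 : ∏ a ∈ Finset.range (n / 2), ∏ l ∈ Finset.Ico a (n - 1 - a), b l =
      ∏ k ∈ Finset.range (n / 2), b k ^ ((if 2 * (k + 1) = n then 1 else 2) * (k + 1)) := by
    rw [Finset.prod_congr rfl fun a ha => prod_Ico_fold hb (Finset.mem_range.1 ha).le,
      Finset.prod_comm' (t' := Finset.range (n / 2)) (s' := fun k => Finset.range (k + 1))]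
    · refine Finset.prod_congr rfl fun k _ => ?_
      rw [Finset.prod_const, Finset.card_range, pow_mul]
    · intro a k
      simp only [Finset.mem_range, Finset.mem_Ico]
      omega
  rw [h2, Finset.prod_mul_distrib, ← h1, h3, ← mul_assoc]
  congr 1
  rw [← Finset.prod_mul_distrib, Finset.prod_range]
  refine Finset.prod_congr rfl fun k _ => ?_
  rw [← pow_succ]
  congr 1
  split_ifs <;> omega

end Monomials

/-! ### The character `δ` -/

section Modulus

variable {n : ℕ} {G : Type*} [CommGroup G]

theorem prod_Ico_reflect {T : ℕ → G} {c : G} (hT : ∀ i < n, T i * T (n - 1 - i) = c) {a : ℕ}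
    (ha : a ≤ n / 2) :
    ∏ i ∈ Finset.Ico a (n - a), T i =
      c ^ (n / 2 - a) * ∏ i ∈ Finset.Ico (n / 2) (n - n / 2), T i := by
  induction ha using Nat.decreasingInduction with
  | self => simp
  | of_succ a ha ih =>
    obtain ⟨N, hN⟩ : ∃ N, n - a = N + 1 := ⟨n - 1 - a, by omega⟩
    rw [Finset.prod_eq_prod_Ico_succ_bot (by omega), hN, Finset.prod_Ico_succ_top (by omega),
      show N = n - (a + 1) by omega, ih, show n / 2 - a = n / 2 - (a + 1) + 1 by omega, pow_succ,
      ← hT a (by omega), show n - 1 - a = n - (a + 1) by omega]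
    ac_rfl

theorem prod_zpow_eq_zpow_sum {ι : Type*} (s : Finset ι) (f : ι → ℤ) (x : G) :
    ∏ a ∈ s, x ^ f a = x ^ ∑ a ∈ s, f a := by
  classical
  induction s using Finset.induction_on with
  | empty => simp
  | insert a s ha ih => rw [Finset.prod_insert ha, Finset.sum_insert ha, _root_.zpow_add, ih]

theorem prod_unipIndex_div {T : ℕ → G} {c : G} (hT : ∀ i < n, T i * T (n - 1 - i) = c)
    (hmid : Odd n → T (n / 2) = 1) :
    ∏ q : unipIndex n, T q.1.2 * (T q.1.1)⁻¹ =
      ∏ a ∈ Finset.range (n / 2), T a ^ (n - 2 - 2 * a) * (c ^ (n / 2 - (a + 1)))⁻¹ := by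
  rw [prod_unipIndex fun i a => T a * (T i)⁻¹]
  refine Finset.prod_congr rfl fun a ha => ?_
  rw [Finset.mem_range] at ha
  rw [Finset.prod_mul_distrib, Finset.prod_const, Nat.card_Ico, Finset.prod_inv_distrib,
    prod_Ico_reflect hT (by omega), show n - (a + 1) - (a + 1) = n - 2 - 2 * a by omega]
  have h : ∏ i ∈ Finset.Ico (n / 2) (n - n / 2), T i = 1 := by
    rcases Nat.even_or_odd n with h | h
    · obtain ⟨m, hm⟩ := h
      rw [Finset.Ico_eq_empty (by omega), Finset.prod_empty]
    · have h' := h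
      obtain ⟨m, hm⟩ := h'
      rw [show n - n / 2 = n / 2 + 1 by omega, Nat.Ico_succ_singleton, Finset.prod_singleton,
        hmid h]
  rw [h, mul_one]

theorem sum_range_ite_le {m k : ℕ} (hk : k < m) (f : ℕ → ℤ) :
    ∑ a ∈ Finset.range m, (if a ≤ k then f a else 0) = ∑ a ∈ Finset.range (k + 1), f a := by
  rw [← Finset.sum_filter]
  refine Finset.sum_congr ?_ fun _ _ => rfl
  ext a
  simp only [Finset.mem_filter, Finset.mem_range]
  omega

theorem sum_range_sub_two_mul (N k : ℕ) :
    ∑ a ∈ Finset.range k, ((N : ℤ) - 2 * a) = k * (N + 1 - k) := by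
  induction k with
  | zero => simp
  | succ k ih =>
    rw [Finset.sum_range_succ, ih]
    push_cast
    ring

/-- The torus acts by conjugation on the coordinate `u_ij` of `N` through `t_i / t_j`; for `n` odd
the product of the inverses of these characters is `δ`. -/
theorem prod_unipIndex_div_odd (hn : Odd n) (s : Fin (n / 2) → G) {T : ℕ → G}
    (hT : ∀ i < n, T i * T (n - 1 - i) = 1) (hmid : T (n / 2) = 1)
    (hTs : ∀ a < n / 2, T a = ∏ k : Fin (n / 2), if a ≤ (k : ℕ) then (s k)⁻¹ else 1) :
    ∏ q : unipIndex n, T q.1.2 * (T q.1.1)⁻¹ =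
      ∏ k : Fin (n / 2), s k ^ (((k : ℤ) + 1) ^ 2 - 2 * ((k : ℤ) + 1) * ((n / 2 : ℕ) : ℤ)) := by
  rw [prod_unipIndex_div hT fun _ => hmid]
  have h1 : ∀ a ∈ Finset.range (n / 2), T a ^ (n - 2 - 2 * a) * (1 ^ (n / 2 - (a + 1)))⁻¹ =
      ∏ k : Fin (n / 2), s k ^ (if a ≤ (k : ℕ) then -(((n - 2 : ℕ) : ℤ) - 2 * a) else 0) := by
    intro a ha
    rw [Finset.mem_range] at ha
    rw [one_pow, inv_one, mul_one, hTs a ha, ← Finset.prod_pow]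
    refine Finset.prod_congr rfl fun k _ => ?_
    split_ifs with h
    · rw [inv_pow, _root_.zpow_neg, ← zpow_natCast, Nat.cast_sub (by omega)]
      norm_num
    · simp
  rw [Finset.prod_congr rfl h1, Finset.prod_comm]
  refine Finset.prod_congr rfl fun k _ => ?_
  rw [prod_zpow_eq_zpow_sum, sum_range_ite_le k.isLt, Finset.sum_neg_distrib,
    sum_range_sub_two_mul]
  congr 1
  obtain ⟨m, hm⟩ := hn
  have hk := k.isLt
  have e1 : ((n / 2 : ℕ) : ℤ) = m := by omega
  have e2 : ((n - 2 : ℕ) : ℤ) = 2 * m - 1 := by omega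
  rw [e1, e2]
  push_cast
  ring

/-- The product of the characters `t_j / t_i` of the torus over the coordinates `u_ij` is `δ` for
`n` even. -/
theorem prod_unipIndex_div_even (hn : Even n) (s : Fin (n / 2) → G) {T : ℕ → G}
    (hT : ∀ i < n, T i * T (n - 1 - i) =
      ∏ k : Fin (n / 2), s k ^ (if (k : ℕ) + 2 < n / 2 then 2 else 1))
    (hTs : ∀ a < n / 2, T a = ∏ k : Fin (n / 2), if (k : ℕ) < a then s k else 1) :
    ∏ q : unipIndex n, T q.1.2 * (T q.1.1)⁻¹ =
      ∏ k : Fin (n / 2), s k ^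
        (if (k : ℕ) + 2 < n / 2 then ((k : ℤ) + 1) ^ 2 - ((k : ℤ) + 1) * ((n : ℤ) - 1)
          else -(((n ^ 2 - 2 * n) / 8 : ℕ) : ℤ)) := by
  rw [prod_unipIndex_div hT fun h => absurd hn (Nat.not_even_iff_odd.2 h)]
  obtain ⟨m, hm⟩ := hn
  have hm2 : n / 2 = m := by omega
  have h1 : ∀ a ∈ Finset.range (n / 2), T a ^ (n - 2 - 2 * a) *
      ((∏ k : Fin (n / 2), s k ^ (if (k : ℕ) + 2 < n / 2 then 2 else 1)) ^
        (n / 2 - (a + 1)))⁻¹ =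
      ∏ k : Fin (n / 2), s k ^ (if (k : ℕ) + 2 < n / 2 then
        (if a ≤ (k : ℕ) then -(((n - 2 : ℕ) : ℤ) - 2 * a) else 0) else -((m : ℤ) - 1 - a)) := by
    intro a ha
    rw [Finset.mem_range] at ha
    rw [hTs a ha, ← Finset.prod_pow, ← Finset.prod_pow, ← Finset.prod_inv_distrib,
      ← Finset.prod_mul_distrib]
    refine Finset.prod_congr rfl fun k _ => ?_
    have hk := k.isLt
    obtain ⟨e, he⟩ : ∃ e, m = a + 1 + e := ⟨m - (a + 1), by omega⟩
    have e1 : n / 2 - (a + 1) = e := by omega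
    have e2 : n - 2 - 2 * a = 2 * e := by omega
    have e3 : ((n - 2 : ℕ) : ℤ) - 2 * a = ((2 * e : ℕ) : ℤ) := by omega
    have e4 : (m : ℤ) - 1 - a = (e : ℤ) := by omega
    rw [e1, e2, e3, e4]
    split_ifs with h1 h2 h3 h4
    · omega
    · rw [← pow_mul, zpow_zero, mul_inv_cancel]
    · have : e = 0 := by omega
      subst this
      simp
    · rw [one_pow, one_mul, ← pow_mul, _root_.zpow_neg, zpow_natCast]
    · omega
    · rw [one_pow, one_mul, pow_one, _root_.zpow_neg, zpow_natCast]
  rw [Finset.prod_congr rfl h1, Finset.prod_comm]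
  refine Finset.prod_congr rfl fun k _ => ?_
  have hk := k.isLt
  rw [prod_zpow_eq_zpow_sum]
  congr 1
  split_ifs with h
  · rw [sum_range_ite_le k.isLt, Finset.sum_neg_distrib, sum_range_sub_two_mul]
    have e1 : (n : ℤ) = m + m := by omega
    have e2 : ((n - 2 : ℕ) : ℤ) = m + m - 2 := by omega
    rw [e1, e2]
    push_cast
    ring
  · rw [hm2, Finset.sum_neg_distrib]
    congr 1
    have h2 : ∀ m : ℕ, 2 * ∑ a ∈ Finset.range m, ((m : ℤ) - 1 - a) = m * (m - 1) := by
      intro m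
      have h3 : ∑ a ∈ Finset.range m, ((m : ℤ) - 1 - a) = ∑ a ∈ Finset.range m, (a : ℤ) := by
        rw [← Finset.sum_range_reflect]
        refine Finset.sum_congr rfl fun a ha => ?_
        rw [Finset.mem_range] at ha
        omega
      have h4 := Finset.sum_range_id_mul_two m
      rw [h3]
      rcases m with _ | m
      · simp
      · have : ((∑ i ∈ Finset.range (m + 1), i : ℕ) : ℤ) * 2 = ((m + 1) * m : ℕ) := by
          exact_mod_cast h4
        push_cast at this ⊢
        linarith
    obtain ⟨r, hr⟩ := Nat.even_mul_pred_self m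
    have h5 : n ^ 2 - 2 * n = 8 * r := by
      have : n ^ 2 = 4 * (m * (m - 1)) + 2 * n := by
        obtain ⟨e, he⟩ : ∃ e, m = e + 1 := ⟨m - 1, by omega⟩
        subst he
        rw [hm, Nat.add_sub_cancel]
        ring
      omega
    rw [h5, Nat.mul_div_cancel_left _ (by norm_num)]
    have h6 := h2 m
    have h7 : ((m * (m - 1) : ℕ) : ℤ) = m * (m - 1) := by
      rw [Nat.cast_mul, Nat.cast_sub (by omega)]
      simp
    rw [← h7, hr] at h6
    push_cast at h6
    linarith

end Modulus

/-! ### Shears -/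

section Shear

variable {G : Type*} [Group G] [MeasurableSpace G] [MeasurableMul₂ G] {m : ℕ} {i j : Fin m}

/-- A shear `σ_i ↦ g (σ_j) σ_i` preserves the product of left-invariant measures. -/
theorem measurePreserving_update_mul (ν : Measure G) [SigmaFinite ν] [ν.IsMulLeftInvariant]
    (hij : i ≠ j) {g : G → G} (hg : Measurable g) :
    MeasurePreserving (fun σ : Fin m → G => Function.update σ i (g (σ j) * σ i))
      (Measure.pi fun _ => ν) (Measure.pi fun _ => ν) := by
  have hm : Measurable fun σ : Fin m → G => Function.update σ i (g (σ j) * σ i) := by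
    refine measurable_pi_lambda _ fun l => ?_
    by_cases hl : l = i
    · subst hl
      simp only [Function.update_self]
      exact (hg.comp (measurable_pi_apply j)).mul (measurable_pi_apply l)
    · simpa [hl] using measurable_pi_apply l
  refine ⟨hm, ?_⟩
  ext s hs
  rw [Measure.map_apply hm hs, ← lintegral_indicator_one (hm hs), ← lintegral_indicator_one hs]
  have hs' : Measurable (s.indicator (1 : (Fin m → G) → ℝ≥0∞)) := measurable_one.indicator hs
  refine lintegral_eq_of_lmarginal_eq {i} (measurable_one.indicator (hm hs)) hs' ?_
  rw [lmarginal_singleton, lmarginal_singleton]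
  funext σ
  have h1 : ∀ x, ((fun σ : Fin m → G => Function.update σ i (g (σ j) * σ i)) ⁻¹' s).indicator
      (1 : (Fin m → G) → ℝ≥0∞) (Function.update σ i x) =
      s.indicator 1 (Function.update σ i (g (σ j) * x)) := by
    intro x
    have e : Function.update σ i x ∈
        ((fun σ : Fin m → G => Function.update σ i (g (σ j) * σ i)) ⁻¹' s) ↔
        Function.update σ i (g (σ j) * x) ∈ s := by
      rw [Set.mem_preimage, Function.update_self, Function.update_of_ne hij.symm,
        Function.update_idem]
    by_cases h : Function.update σ i (g (σ j) * x) ∈ s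
    · rw [Set.indicator_of_mem h, Set.indicator_of_mem (e.2 h)]
      rfl
    · rw [Set.indicator_of_notMem h, Set.indicator_of_notMem fun h' => h (e.1 h')]
  simp only [h1]
  exact lintegral_mul_left_eq_self (μ := ν) (fun x => s.indicator 1 (Function.update σ i x))
    (g (σ j))

theorem bijective_update_mul (hij : i ≠ j) (g : G → G) :
    Function.Bijective (fun σ : Fin m → G => Function.update σ i (g (σ j) * σ i)) := by
  refine Function.bijective_iff_has_inverse.2
    ⟨fun σ => Function.update σ i ((g (σ j))⁻¹ * σ i), fun σ => ?_, fun σ => ?_⟩ <;>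
  simp [Function.update_of_ne hij.symm]

end Shear

/-! ### The diagonal torus -/

section Entries

variable {n : ℕ} {R : Type*} [CommRing R]

/-- The entries of a diagonal matrix, indexed by `ℕ`, with junk value `1`. -/
def natEntry (t : Fin n → Rˣ) (i : ℕ) : Rˣ := if h : i < n then t ⟨i, h⟩ else 1

theorem natEntry_fin (t : Fin n → Rˣ) (i : Fin n) : natEntry t i = t i := dif_pos i.isLt

theorem natEntry_of_lt (t : Fin n → Rˣ) {i : ℕ} (h : i < n) : natEntry t i = t ⟨i, h⟩ := dif_pos h

theorem natEntry_mul_rev {t : Fin n → Rˣ} {c : Rˣ} (h : ∀ i, t i * t i.rev = c) {i : ℕ}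
    (hi : i < n) : natEntry t i * natEntry t (n - 1 - i) = c := by
  rw [natEntry_of_lt t hi, natEntry_of_lt t (by omega), ← h ⟨i, hi⟩]
  congr 2
  rw [Fin.ext_iff, Fin.val_rev]
  show n - 1 - i = n - (i + 1)
  omega

theorem torusOddEntry_of_le (hn : Odd n) (s : Fin (n / 2) → Rˣ) {a : ℕ} (ha : a ≤ n / 2) :
    natEntry (torusOddEntry n s) a = ∏ k : Fin (n / 2), if a ≤ (k : ℕ) then (s k)⁻¹ else 1 := by
  obtain ⟨m, hm⟩ := hn
  rw [natEntry_of_lt _ (by omega), torusOddEntry]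
  dsimp only
  refine mul_eq_left.2 (Finset.prod_eq_one fun k _ => if_neg ?_)
  have hk := k.isLt
  rw [Fin.val_rev]
  dsimp only
  omega

theorem torusOddEntry_ratio (hn : Odd n) (s : Fin (n / 2) → Rˣ) (k : Fin (n / 2)) :
    natEntry (torusOddEntry n s) k * (natEntry (torusOddEntry n s) (k + 1))⁻¹ = (s k)⁻¹ := by
  have hk := k.isLt
  rw [torusOddEntry_of_le hn s (by omega), torusOddEntry_of_le hn s (by omega),
    ← Finset.prod_inv_distrib, ← Finset.prod_mul_distrib, Finset.prod_eq_single k]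
  · simp
  · intro l _ hl
    have hl' : (l : ℕ) ≠ k := fun h => hl (Fin.ext h)
    by_cases h : (k : ℕ) ≤ l
    · rw [if_pos h, if_pos (by omega), mul_inv_cancel]
    · rw [if_neg h, if_neg (by omega), mul_inv_cancel]
  · simp

theorem prod_torusOddEntry (hn : Odd n) (s : Fin (n / 2) → Rˣ) :
    ∏ q : unipIndex n, natEntry (torusOddEntry n s) q.1.2 *
      (natEntry (torusOddEntry n s) q.1.1)⁻¹ = delta n s := by
  rw [delta, if_pos hn]
  refine prod_unipIndex_div_odd hn s (fun i hi => natEntry_mul_rev (torusOddEntry_mul_rev n s) hi)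
    ?_ fun a ha => torusOddEntry_of_le hn s ha.le
  rw [torusOddEntry_of_le hn s le_rfl]
  refine Finset.prod_eq_one fun k _ => if_neg ?_
  have := k.isLt
  omega

theorem torusEvenEntry_mul_rev (hn : Even n) (s : Fin (n / 2) → Rˣ) (i : Fin n) :
    torusEvenEntry n s i * torusEvenEntry n s i.rev = torusEvenMult n s := by
  have hr : (i.rev : ℕ) = n - (i + 1) := Fin.val_rev i
  have hi := i.isLt
  obtain ⟨m, hm⟩ := hn
  by_cases h : (i : ℕ) < n / 2
  · have h' : ¬ (i.rev : ℕ) < n / 2 := by omega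
    simp only [torusEvenEntry, if_pos h, if_neg h', Fin.rev_rev]
    rw [mul_comm, inv_mul_cancel_right]
  · have h' : (i.rev : ℕ) < n / 2 := by omega
    simp only [torusEvenEntry, if_neg h, if_pos h']
    rw [inv_mul_cancel_right]

theorem torusEvenEntry_of_lt (s : Fin (n / 2) → Rˣ) {a : ℕ} (ha : a < n / 2) :
    natEntry (torusEvenEntry n s) a = ∏ k : Fin (n / 2), if (k : ℕ) < a then s k else 1 := by
  rw [natEntry_of_lt _ (by omega), torusEvenEntry, if_pos (show a < n / 2 from ha)]

theorem torusEvenEntry_ratio (s : Fin (n / 2) → Rˣ) (k : Fin (n / 2))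
    (hk : (k : ℕ) + 1 < n / 2) :
    natEntry (torusEvenEntry n s) k * (natEntry (torusEvenEntry n s) (k + 1))⁻¹ = (s k)⁻¹ := by
  rw [torusEvenEntry_of_lt s k.isLt, torusEvenEntry_of_lt s hk,
    ← Finset.prod_inv_distrib, ← Finset.prod_mul_distrib, Finset.prod_eq_single k]
  · simp
  · intro l _ hl
    have hl' : (l : ℕ) ≠ k := fun h => hl (Fin.ext h)
    by_cases h : (l : ℕ) < k
    · rw [if_pos h, if_pos (by omega), mul_inv_cancel]
    · rw [if_neg h, if_neg (by omega), mul_inv_cancel]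
  · simp

theorem torusEvenEntry_ratio_last (hn : Even n) (s : Fin (n / 2) → Rˣ) {k k' : Fin (n / 2)}
    (hk : (k : ℕ) + 1 = n / 2) (hk' : (k' : ℕ) + 2 = n / 2) :
    natEntry (torusEvenEntry n s) k * (natEntry (torusEvenEntry n s) (k + 1))⁻¹ =
      s k' * (s k)⁻¹ := by
  have h1 := natEntry_mul_rev (torusEvenEntry_mul_rev hn s) (i := (k : ℕ)) (by omega)
  obtain ⟨m, hm⟩ := hn
  rw [show n - 1 - (k : ℕ) = k + 1 by omega] at h1
  rw [eq_mul_inv_of_mul_eq ((mul_comm _ _).trans h1), mul_inv, inv_inv, mul_left_comm,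
    torusEvenEntry_of_lt s k.isLt, torusEvenMult, ← Finset.prod_inv_distrib,
    ← Finset.prod_mul_distrib, ← Finset.prod_mul_distrib]
  have h2 : s k' * (s k)⁻¹ = ∏ l : Fin (n / 2), (if l = k' then s l else 1) *
      (if l = k then (s l)⁻¹ else 1) := by
    rw [Finset.prod_mul_distrib, Finset.prod_ite_eq', Finset.prod_ite_eq']
    simp
  rw [h2]
  refine Finset.prod_congr rfl fun l _ => ?_
  have hl := l.isLt
  simp only [Fin.ext_iff]
  by_cases h3 : (l : ℕ) + 2 < n / 2
  · rw [if_pos h3, if_pos (by omega), if_neg (by omega), if_neg (by omega), pow_two, mul_inv]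
    simp
  · by_cases h4 : (l : ℕ) < k
    · rw [if_neg h3, if_pos h4, if_pos (by omega), if_neg (by omega), pow_one]
      simp
    · rw [if_neg h3, if_neg h4, if_neg (by omega), if_pos (by omega), pow_one]
      simp

theorem prod_torusEvenEntry (hn : Even n) (s : Fin (n / 2) → Rˣ) :
    ∏ q : unipIndex n, natEntry (torusEvenEntry n s) q.1.2 *
      (natEntry (torusEvenEntry n s) q.1.1)⁻¹ = delta n s := by
  rw [delta, if_neg (Nat.not_odd_iff_even.2 hn)]
  exact prod_unipIndex_div_even hn s
    (fun i hi => natEntry_mul_rev (torusEvenEntry_mul_rev hn s) hi)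
    fun a ha => torusEvenEntry_of_lt s ha

/-- The product of the diagonal entries of a similitude. -/
theorem prod_entries {t : Fin n → Rˣ} {c : Rˣ} (h : ∀ i, t i * t i.rev = c) :
    (∏ i, t i) * ∏ i, t i = c ^ n := by
  have h1 : ∏ i, t i = ∏ i : Fin n, t i.rev := (Equiv.prod_comp Fin.revPerm t).symm
  conv_lhs => enter [2]; rw [h1]
  rw [← Finset.prod_mul_distrib, Finset.prod_congr rfl fun i _ => h i, Finset.prod_const,
    Finset.card_univ, Fintype.card_fin]

/-- Every diagonal matrix in the special orthogonal group is in the image of the torus. -/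
theorem exists_torusOddEntry_eq (hn : Odd n) {t : Fin n → Rˣ} (h : ∀ i, t i * t i.rev = 1)
    (hdet : ∏ i, t i = 1) : ∃ s, torusOddEntry n s = t := by
  have hmid : natEntry t (n / 2) = 1 := by
    have h1 := prod_Ico_reflect (T := natEntry t) (c := 1)
      (fun i hi => natEntry_mul_rev h hi) (Nat.zero_le (n / 2))
    obtain ⟨m, hm⟩ := hn
    rw [show n - n / 2 = n / 2 + 1 by omega, Nat.Ico_succ_singleton, Finset.prod_singleton,
      one_pow, one_mul, Nat.sub_zero, ← Finset.range_eq_Ico, Finset.prod_range] at h1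
    rw [← h1, ← hdet]
    exact Finset.prod_congr rfl fun i _ => natEntry_fin t i
  let s : Fin (n / 2) → Rˣ := fun k => natEntry t (k + 1) * (natEntry t k)⁻¹
  have hle : ∀ a ≤ n / 2, natEntry (torusOddEntry n s) a = natEntry t a := by
    intro a ha
    induction ha using Nat.decreasingInduction with
    | self =>
      rw [hmid, torusOddEntry_of_le hn s le_rfl]
      refine Finset.prod_eq_one fun k _ => if_neg ?_
      have := k.isLt
      omega
    | of_succ a ha ih =>
      have h1 := torusOddEntry_ratio hn s ⟨a, ha⟩
      dsimp only [s] at h1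
      rw [mul_inv_eq_iff_eq_mul] at h1
      rw [h1, ih, mul_inv, inv_inv]
      simp
  refine ⟨s, ?_⟩
  funext i
  have hi := i.isLt
  rw [← natEntry_fin t, ← natEntry_fin (torusOddEntry n s)]
  rcases Nat.lt_or_ge (n / 2) i with h1 | h1
  · have h2 := natEntry_mul_rev h i.isLt
    have h3 := natEntry_mul_rev (torusOddEntry_mul_rev n s) i.isLt
    rw [hle (n - 1 - i) (by omega)] at h3
    exact mul_right_cancel (h3.trans h2.symm)
  · exact hle _ h1

/-- Up to a scalar, every diagonal similitude is in the image of the torus. -/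
theorem exists_torusEvenEntry_eq (hn : Even n) (h3 : 3 ≤ n) {t : Fin n → Rˣ} {c : Rˣ}
    (h : ∀ i, t i * t i.rev = c) (h0 : natEntry t 0 = 1) :
    ∃ s, torusEvenEntry n s = t ∧ torusEvenMult n s = c := by
  have hn' := hn
  obtain ⟨m, hm⟩ := hn'
  let s : Fin (n / 2) → Rˣ := fun k => if (k : ℕ) + 1 < n / 2 then
    natEntry t (k + 1) * (natEntry t k)⁻¹ else c * (natEntry t (k - 1) * natEntry t k)⁻¹
  have hlt : ∀ a, a < n / 2 → natEntry (torusEvenEntry n s) a = natEntry t a := by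
    intro a ha
    induction a with
    | zero =>
      rw [h0, torusEvenEntry_of_lt s ha]
      simp
    | succ a ih =>
      have h1 := torusEvenEntry_ratio s ⟨a, by omega⟩ ha
      dsimp only [s] at h1
      rw [if_pos ha, ih (by omega), mul_inv, inv_inv, mul_comm, mul_right_cancel_iff,
        _root_.inv_inj] at h1
      exact h1
  have hc : torusEvenMult n s = c := by
    have h1 := torusEvenEntry_ratio_last hn s (k := ⟨n / 2 - 1, by omega⟩)
      (k' := ⟨n / 2 - 2, by omega⟩) (by dsimp only; omega) (by dsimp only; omega)
    have h2 := natEntry_mul_rev (torusEvenEntry_mul_rev hn s) (i := n / 2 - 1) (by omega)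
    dsimp only [s] at h1
    rw [if_pos (by omega), if_neg (by omega), hlt _ (by omega),
      show n / 2 - 2 + 1 = n / 2 - 1 by omega, show n / 2 - 1 - 1 = n / 2 - 2 by omega] at h1
    rw [hlt _ (by omega), show n - 1 - (n / 2 - 1) = n / 2 - 1 + 1 by omega] at h2
    rw [mul_assoc, mul_right_inj, ← mul_inv, _root_.inv_inj] at h1
    rw [← h2, h1]
    simp [mul_comm, mul_left_comm]
  refine ⟨s, ?_, hc⟩
  funext i
  have hi := i.isLt
  rw [← natEntry_fin t, ← natEntry_fin (torusEvenEntry n s)]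
  rcases Nat.lt_or_ge i (n / 2) with h1 | h1
  · exact hlt _ h1
  · have h2 := natEntry_mul_rev h i.isLt
    have h3 := natEntry_mul_rev (torusEvenEntry_mul_rev hn s) i.isLt
    rw [hlt (n - 1 - i) (by omega), hc] at h3
    exact mul_right_cancel (h3.trans h2.symm)

end Entries

section Ratio

variable {n : ℕ} {R : Type*} [NormedCommRing R] [NormMulClass R] [NormOneClass R] [IsDomain R]
  [CharZero R] [ProperSpace R] [MeasurableSpace R] [BorelSpace R]
  {μ : Measure R} [μ.IsAddHaarMeasure] (hμ : IsModulus μ)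

/-- The characters of the torus through which it acts on the entries next to the anti-diagonal. -/
def entryRatio (t : (Fin (n / 2) → Rˣ) → Fin n → Rˣ) (s : Fin (n / 2) → Rˣ) : Fin (n / 2) → Rˣ :=
  fun k => natEntry (t s) k * (natEntry (t s) (k + 1))⁻¹

include hμ in
/-- For `n` odd the characters `entryRatio` are the inverses of the coordinates of the torus. -/
theorem entryRatio_torusOdd (hn : Odd n) :
    MeasurePreserving (entryRatio (torusOddEntry n (R := R)))
      (Measure.pi fun _ => unitMeasure μ) (Measure.pi fun _ => unitMeasure μ) ∧
    Function.Bijective (entryRatio (torusOddEntry n (R := R))) := by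
  have := measurableMul₂_units (R := R)
  have := measurableInv_units (R := R)
  have := sigmaFinite_unitMeasure (μ := μ)
  have := isInvInvariant_unitMeasure hμ
  have h : entryRatio (torusOddEntry n (R := R)) = Inv.inv := by
    funext s k
    exact torusOddEntry_ratio hn s k
  rw [h]
  exact ⟨Measure.measurePreserving_inv _, inv_involutive.bijective⟩

include hμ in
/-- For `n` even the characters `entryRatio` are the inverses of the coordinates of the torus,
except for the last one, which is `s_(m-1) / s_m`: they arise from the coordinates by a shear,
followed by inversion. -/
theorem entryRatio_torusEven (hn : Even n) (h3 : 3 ≤ n) :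
    MeasurePreserving (entryRatio (torusEvenEntry n (R := R)))
      (Measure.pi fun _ => unitMeasure μ) (Measure.pi fun _ => unitMeasure μ) ∧
    Function.Bijective (entryRatio (torusEvenEntry n (R := R))) := by
  have := measurableMul₂_units (R := R)
  have := measurableInv_units (R := R)
  have := sigmaFinite_unitMeasure (μ := μ)
  have := isInvInvariant_unitMeasure hμ
  have := isMulLeftInvariant_unitMeasure hμ
  have hn' := hn
  obtain ⟨m, hm⟩ := hn'
  let k₁ : Fin (n / 2) := ⟨n / 2 - 1, by omega⟩
  let k₂ : Fin (n / 2) := ⟨n / 2 - 2, by omega⟩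
  have hk : k₁ ≠ k₂ := by
    rw [Ne, Fin.ext_iff]
    dsimp only [k₁, k₂]
    omega
  have h : entryRatio (torusEvenEntry n (R := R)) =
      Inv.inv ∘ fun s => Function.update s k₁ ((s k₂)⁻¹ * s k₁) := by
    funext s k
    have hk' := k.isLt
    by_cases hkk : k = k₁
    · subst hkk
      simp only [entryRatio, Function.comp_apply, Pi.inv_apply, Function.update_self, mul_inv,
        inv_inv]
      exact torusEvenEntry_ratio_last hn s (by dsimp only [k₁]; omega)
        (by dsimp only [k₂]; omega)
    · simp only [entryRatio, Function.comp_apply, Pi.inv_apply, Function.update_of_ne hkk]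
      refine torusEvenEntry_ratio s k ?_
      rw [Fin.ext_iff] at hkk
      dsimp only [k₁] at hkk
      omega
  rw [h]
  exact ⟨(Measure.measurePreserving_inv _).comp
      (measurePreserving_update_mul (unitMeasure μ) hk measurable_inv),
    inv_involutive.bijective.comp (bijective_update_mul hk _)⟩

end Ratio

/-! ### The points of `P` and their action -/

section Points

variable {n : ℕ} {R : Type*} [NormedCommRing R]

/-- The diagonal entries of a lower-triangular similitude. -/
theorem lower_diag_mul_rev {g : Matrix (Fin n) (Fin n) R} (hg : ∀ i j : Fin n, i < j → g i j = 0)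
    {c : R} (h : gᵀ * antidiag n R * g = c • antidiag n R) (i : Fin n) :
    g i i * g i.rev i.rev = c := by
  have h1 := congrFun (congrFun h i) i.rev
  rw [transpose_mul_antidiag_mul_apply, Fintype.sum_eq_single i] at h1
  · simpa [antidiag] using h1
  · intro k hk
    rcases lt_or_gt_of_ne hk with h2 | h2
    · rw [hg k i h2, zero_mul]
    · rw [hg k.rev i.rev (Fin.rev_lt_rev.2 h2), mul_zero]

theorem exists_diag_units {g : Matrix (Fin n) (Fin n) R} (hg : ∀ i j : Fin n, i < j → g i j = 0)
    {c : Rˣ} (h : gᵀ * antidiag n R * g = c.1 • antidiag n R) :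
    ∃ t : Fin n → Rˣ, (∀ i, (t i).1 = g i i) ∧ ∀ i, t i * t i.rev = c := by
  have h1 := lower_diag_mul_rev hg h
  have h2 : ∀ i, IsUnit (g i i) := fun i => isUnit_of_mul_isUnit_left (h1 i ▸ c.isUnit)
  refine ⟨fun i => (h2 i).unit, fun i => rfl, fun i => Units.ext ?_⟩
  exact h1 i

theorem diagGL_inv_mul_isUnip {g : GL (Fin n) R} (hg : g ∈ lowerGL n R) {t : Fin n → Rˣ}
    (ht : ∀ i, (t i).1 = g.1 i i) {c : Rˣ} (hc : ∀ i, t i * t i.rev = c)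
    (h : g.1ᵀ * antidiag n R * g.1 = c.1 • antidiag n R) :
    (diagGL n t)⁻¹ * g ∈ unipGroup n R := by
  have h1 : ((⟨diagGL n t, c⟩ : GL (Fin n) R × Rˣ)⁻¹ * ⟨g, c⟩) ∈ simGroup n R :=
    mul_mem (inv_mem (diagGL_sim n t c hc)) h
  have h2 : ((diagGL n t)⁻¹ * g).1ᵀ * antidiag n R * ((diagGL n t)⁻¹ * g).1 =
      (c⁻¹ * c).1 • antidiag n R := h1
  refine ⟨?_, mul_mem (inv_mem (diagGL_mem_lowerGL n t)) hg, fun i => ?_⟩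
  · show _ = _
    rw [h2, inv_mul_cancel, Units.val_one, one_smul]
  · show (Matrix.diagonal (fun i => ((t i)⁻¹).1) * g.1) i i = 1
    rw [Matrix.diagonal_mul, ← ht, Units.inv_mul]

theorem pointOdd_surjective (hn : Odd n) : Function.Surjective (pointOdd n (R := R)) := by
  rintro ⟨g, ⟨⟨hg, hl⟩, hdet⟩⟩
  have hg' : g.1ᵀ * antidiag n R * g.1 = (1 : Rˣ).1 • antidiag n R := by
    rw [Units.val_one, one_smul]
    exact hg
  obtain ⟨t, ht, htc⟩ := exists_diag_units hl hg'
  obtain ⟨s, hs⟩ := exists_torusOddEntry_eq hn htc (by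
    apply Units.ext
    have h1 : g.1.det = 1 := congrArg Units.val hdet
    rw [Units.coe_prod, Units.val_one, ← h1,
      Matrix.det_of_isLowerTriangular _ (fun i j hij => hl i j hij)]
    exact Finset.prod_congr rfl fun i _ => ht i)
  refine ⟨(s, ⟨(diagGL n t)⁻¹ * g, diagGL_inv_mul_isUnip hl ht htc hg'⟩), ?_⟩
  apply Subtype.ext
  show diagGL n (torusOddEntry n s) * ((diagGL n t)⁻¹ * g) = g
  rw [hs, mul_inv_cancel_left]

theorem pointEven_surjective (hn : Even n) (h3 : 3 ≤ n) :
    Function.Surjective (pointEven n hn (R := R)) := by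
  intro x
  induction x using QuotientGroup.induction_on with
  | H z =>
  obtain ⟨⟨g, c⟩, hg, hl, -⟩ := z
  have hl : g ∈ lowerGL n R := fun i j hij => hl i j hij
  have hg : g.1ᵀ * antidiag n R * g.1 = c.1 • antidiag n R := hg
  obtain ⟨t, ht, htc⟩ := exists_diag_units hl hg
  -- the representative with first diagonal entry `1`
  let a : Rˣ := (natEntry t 0)⁻¹
  obtain ⟨s, hs, hsc⟩ := exists_torusEvenEntry_eq hn h3 (t := fun i => t i * a)
    (c := c * a ^ 2) (fun i => by rw [mul_mul_mul_comm, htc, pow_two]) (by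
      rw [natEntry_of_lt _ (by omega : 0 < n)]
      dsimp only [a]
      rw [natEntry_of_lt _ (by omega : 0 < n), mul_inv_cancel])
  refine ⟨(s, ⟨(diagGL n t)⁻¹ * g, diagGL_inv_mul_isUnip hl ht htc hg⟩), ?_⟩
  rw [pointEven, QuotientGroup.eq]
  refine ⟨a⁻¹, ?_⟩
  rw [eq_inv_mul_iff_mul_eq]
  apply Subtype.ext
  refine Prod.ext ?_ ?_
  · apply Units.ext
    show Matrix.diagonal (fun i => (torusEvenEntry n s i).1) *
      (Matrix.diagonal (fun i => ((t i)⁻¹).1) * g.1) * Matrix.scalar (Fin n) (a⁻¹).1 = g.1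
    ext i j
    rw [hs, Matrix.scalar_apply, Matrix.mul_diagonal, Matrix.diagonal_mul, Matrix.diagonal_mul]
    simp only [Units.val_mul]
    have e1 : (t i).1 * ((t i)⁻¹).1 = 1 := Units.mul_inv _
    have e2 : a.1 * (a⁻¹).1 = 1 := Units.mul_inv _
    linear_combination (g.1 i j) * e1 * (a.1 * (a⁻¹).1) + g.1 i j * e2
  · show torusEvenMult n s * 1 * (a⁻¹) ^ 2 = c
    rw [hsc, mul_one, mul_assoc, ← mul_pow, mul_inv_cancel, one_pow, mul_one]

/-- The action of `s u` in matrix entries. -/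
theorem pointOdd_smul_apply (s : Fin (n / 2) → Rˣ) (u : unipGroup n R) (B : W0 n R) (i j : Fin n) :
    (pointOdd n (s, u) • B).1 i j = ((1 : Rˣ)⁻¹ * (torusOddEntry n s i * torusOddEntry n s j)).1 *
      (u.1.1 * B.1 * u.1.1ᵀ) i j := by
  show ((1 : R) • ((Matrix.diagonal (fun i => (torusOddEntry n s i).1) * u.1.1) * B.1 *
    (Matrix.diagonal (fun i => (torusOddEntry n s i).1) * u.1.1)ᵀ)) i j = _
  rw [one_smul, Matrix.transpose_mul, Matrix.diagonal_transpose,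
    show ∀ D : Matrix (Fin n) (Fin n) R, D * u.1.1 * B.1 * (u.1.1ᵀ * D) =
      D * (u.1.1 * B.1 * u.1.1ᵀ) * D from fun D => by simp only [Matrix.mul_assoc],
    Matrix.mul_diagonal, Matrix.diagonal_mul]
  simp only [Units.val_mul, inv_one, Units.val_one]
  ring

theorem pointEven_smul_apply (hn : Even n) (s : Fin (n / 2) → Rˣ) (u : unipGroup n R)
    (B : W0 n R) (i j : Fin n) :
    (pointEven n hn (s, u) • B).1 i j =
      ((torusEvenMult n s)⁻¹ * (torusEvenEntry n s i * torusEvenEntry n s j)).1 *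
      (u.1.1 * B.1 * u.1.1ᵀ) i j := by
  show (((torusEvenMult n s * 1)⁻¹).1 •
    ((Matrix.diagonal (fun i => (torusEvenEntry n s i).1) * u.1.1) * B.1 *
    (Matrix.diagonal (fun i => (torusEvenEntry n s i).1) * u.1.1)ᵀ)) i j = _
  rw [mul_one, Matrix.transpose_mul, Matrix.diagonal_transpose,
    show ∀ D : Matrix (Fin n) (Fin n) R, D * u.1.1 * B.1 * (u.1.1ᵀ * D) =
      D * (u.1.1 * B.1 * u.1.1ᵀ) * D from fun D => by simp only [Matrix.mul_assoc],
    Matrix.smul_apply, Matrix.mul_diagonal, Matrix.diagonal_mul]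
  simp only [Units.val_mul, smul_eq_mul]
  ring

/-- The matrices that preserve `A` up to the multiplier preserve the invariant polynomial. -/
theorem inv_eq_of_entries {B B' : W0 n R} {t : Fin n → Rˣ} {c : Rˣ} (htc : ∀ i, t i * t i.rev = c)
    (u : unipGroup n R) (h : ∀ i j, B'.1 i j = (c⁻¹ * (t i * t j)).1 * (u.1.1 * B.1 * u.1.1ᵀ) i j) :
    B'.inv = B.inv := by
  -- the transpose of `u` also preserves `A`
  have hu : u.1.1 * antidiag n R * u.1.1ᵀ = antidiag n R := by
    have h1 := u.2.1
    have h1 : u.1.1ᵀ * antidiag n R * u.1.1 = antidiag n R := h1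
    have h2 : (antidiag n R * u.1.1ᵀ * antidiag n R) * u.1.1 = 1 := by
      rw [Matrix.mul_assoc, Matrix.mul_assoc, ← Matrix.mul_assoc u.1.1ᵀ, h1, antidiag_mul_self]
    have h3 := mul_eq_one_comm.1 h2
    calc u.1.1 * antidiag n R * u.1.1ᵀ
        = u.1.1 * (antidiag n R * u.1.1ᵀ * antidiag n R) * antidiag n R := by
          simp only [Matrix.mul_assoc, antidiag_mul_self, Matrix.mul_one]
      _ = antidiag n R := by rw [h3, Matrix.one_mul]
  have hud : u.1.1.det = 1 := by
    rw [Matrix.det_of_isLowerTriangular _ (fun i j hij => u.2.2.1 i j hij)]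
    exact Finset.prod_eq_one fun i _ => u.2.2.2 i
  let D : Matrix (Fin n) (Fin n) R[X] := Matrix.diagonal fun i => C (t i).1
  let U : Matrix (Fin n) (Fin n) R[X] := u.1.1.map C
  have hUd : U.det = 1 := by
    rw [show U = (C : R →+* R[X]).mapMatrix u.1.1 from rfl, ← RingHom.map_det, hud, map_one]
  have h2 : (X : R[X]) • (antidiag n R).map C + B'.1.map C =
      (C (c⁻¹).1) • (D * (U * ((X : R[X]) • (antidiag n R).map C + B.1.map C) * Uᵀ) * D) := by
    have hUA : U * (antidiag n R).map C * Uᵀ = (antidiag n R).map C := by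
      conv_rhs => rw [← hu]
      simp only [U, Matrix.map_mul, Matrix.transpose_map]
    have hUB : U * B.1.map C * Uᵀ = (u.1.1 * B.1 * u.1.1ᵀ).map C := by
      simp only [U, Matrix.map_mul, Matrix.transpose_map]
    rw [Matrix.mul_add, Matrix.add_mul, Matrix.mul_smul, Matrix.smul_mul, hUA, hUB]
    ext1 i j
    simp only [D, Matrix.smul_apply, Matrix.add_apply, Matrix.mul_diagonal, Matrix.diagonal_mul,
      Matrix.map_apply, smul_eq_mul, h, map_mul, Units.val_mul]
    by_cases hij : j = i.rev
    · subst hij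
      have h4 : C (c⁻¹).1 * (C (t i).1 * C (t i.rev).1) = (1 : R[X]) := by
        rw [← map_mul, ← map_mul, ← Units.val_mul, ← Units.val_mul, htc, inv_mul_cancel,
          Units.val_one, map_one]
      linear_combination (-(X * C (antidiag n R i i.rev))) * h4
    · have h5 : antidiag n R i j = 0 := by simp [antidiag, hij]
      rw [h5, map_zero]
      ring
  rw [W0.inv, W0.inv, h2, Matrix.det_smul, Matrix.det_mul, Matrix.det_mul, Matrix.det_mul,
    Matrix.det_mul, Matrix.det_transpose, hUd, Fintype.card_fin]
  have hD : D.det = C (∏ i, t i).1 := by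
    rw [Matrix.det_diagonal, Units.coe_prod, map_prod]
  have h6 : (C (c⁻¹).1 : R[X]) ^ n * (C (∏ i, t i).1 * C (∏ i, t i).1) = 1 := by
    rw [← map_pow, ← map_mul, ← map_mul, ← Units.val_mul, prod_entries htc,
      ← Units.val_pow_eq_pow_val, ← Units.val_mul, ← mul_pow, inv_mul_cancel, one_pow,
      Units.val_one, map_one]
  rw [hD]
  linear_combination ((-1) ^ (n / 2) *
    ((X : R[X]) • (antidiag n R).map C + B.1.map C).det) * h6

end Points

/-! ### Three blocks of coordinates on `W₀` -/

section Blocks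

variable {n : ℕ} {R : Type*} [CommRing R]

/-- The entries next to the anti-diagonal. -/
def W0.beta (B : W0 n R) (k : Fin (n / 2)) : R := hessMat B k (k + 1)

/-- The entries that the unipotent group moves freely. -/
def W0.side (B : W0 n R) (q : unipIndex n) : R := B.1 (unipRow q) q.1.2.rev

/-- The entries at the middle of each diagonal parallel to the anti-diagonal, numbered by the
coefficient of the invariant polynomial which they determine. -/
def W0.mid (B : W0 n R) (i : Fin n) : R := hessMat B (i / 2 + (n - 1 - i)) (i / 2)

/-- The position of a coordinate of each of the three kinds. -/
def blockPos : Fin (n / 2) ⊕ unipIndex n ⊕ Fin n → W0Index n :=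
  Sum.elim
    (fun k => ⟨(⟨k, by omega⟩, Fin.rev ⟨k + 1, by omega⟩), by
      have hk := k.isLt
      rw [Fin.le_def, Fin.val_rev]
      dsimp only
      omega⟩)
    (Sum.elim
      (fun q => ⟨(unipRow q, q.1.2.rev), by
        have h1 := unipRow_val q
        have h2 : (q.1.2 : ℕ) < q.1.1 := q.2.1
        have h3 := q.2.2
        rw [Fin.le_def, Fin.val_rev]
        dsimp only
        omega⟩)
      (fun i => ⟨(⟨i / 2 + (n - 1 - i), by omega⟩, Fin.rev ⟨i / 2, by omega⟩), by
        have hi := i.isLt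
        rw [Fin.le_def, Fin.val_rev]
        dsimp only
        omega⟩))

theorem blockPos_bijective : Function.Bijective (blockPos (n := n)) := by
  constructor
  · have key : ∀ x y : Fin (n / 2) ⊕ unipIndex n ⊕ Fin n, blockPos x = blockPos y →
        ((blockPos x).1.1 : ℕ) = (blockPos y).1.1 ∧ ((blockPos x).1.2 : ℕ) = (blockPos y).1.2 :=
      fun x y h => by rw [h]; exact ⟨rfl, rfl⟩
    rintro (k | q | i) (k' | q' | i') h
    all_goals
      have h' := key _ _ h
      simp only [blockPos, Sum.elim_inl, Sum.elim_inr, Fin.val_rev] at h'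
    · exact congrArg Sum.inl (Fin.ext h'.1)
    · have h1 := unipRow_val q'
      have h2 : (q'.1.2 : ℕ) < q'.1.1 := q'.2.1
      have h3 := q'.2.2
      have hk := k.isLt
      omega
    · have hk := k.isLt
      have hi := i'.isLt
      omega
    · have h1 := unipRow_val q
      have h2 : (q.1.2 : ℕ) < q.1.1 := q.2.1
      have h3 := q.2.2
      have hk := k'.isLt
      omega
    · have h1 := unipRow_val q
      have h1' := unipRow_val q'
      have h2 := q.1.2.isLt
      have h2' := q'.1.2.isLt
      exact congrArg (Sum.inr ∘ Sum.inl)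
        (Subtype.ext (Prod.ext (Fin.ext (by omega)) (Fin.ext (by omega))))
    · have h1 := unipRow_val q
      have h2 : (q.1.2 : ℕ) < q.1.1 := q.2.1
      have h3 := q.2.2
      have hi := i'.isLt
      omega
    · have hk := k'.isLt
      have hi := i.isLt
      omega
    · have h1 := unipRow_val q'
      have h2 : (q'.1.2 : ℕ) < q'.1.1 := q'.2.1
      have h3 := q'.2.2
      have hi := i.isLt
      omega
    · have hi := i.isLt
      have hi' := i'.isLt
      exact congrArg (Sum.inr ∘ Sum.inr) (Fin.ext (by omega))
  · rintro ⟨⟨i, j⟩, hij, hn⟩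
    have hi := i.isLt
    have hj := j.isLt
    have hij : (i : ℕ) ≤ j := hij
    have hn : n ≤ (i : ℕ) + j + 2 := hn
    by_cases h1 : (i : ℕ) + j + 2 = n
    · refine ⟨Sum.inl ⟨i, by omega⟩, Subtype.ext (Prod.ext (Fin.ext rfl) (Fin.ext ?_))⟩
      simp only [blockPos, Sum.elim_inl, Fin.val_rev]
      omega
    · by_cases h2 : (j : ℕ) ≤ i + 1
      · refine ⟨Sum.inr (Sum.inr ⟨2 * n - 2 - (i + j), by omega⟩),
          Subtype.ext (Prod.ext (Fin.ext ?_) (Fin.ext ?_))⟩ <;>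
        simp only [blockPos, Sum.elim_inr, Fin.val_rev] <;>
        omega
      · refine ⟨Sum.inr (Sum.inl ⟨(⟨i + 1, by omega⟩, j.rev), ?_, ?_⟩),
          Subtype.ext (Prod.ext (Fin.ext ?_) (Fin.ext ?_))⟩
        · rw [Fin.lt_def, Fin.val_rev]
          dsimp only
          omega
        · rw [Fin.val_rev]
          dsimp only
          omega
        · simp [blockPos, unipRow]
        · simp [blockPos]

/-- The three kinds of coordinates of `W₀` together. -/
noncomputable def blockEquiv : Fin (n / 2) ⊕ unipIndex n ⊕ Fin n ≃ W0Index n :=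
  Equiv.ofBijective blockPos blockPos_bijective

theorem ofCoords_apply (x : W0Index n → R) (p : W0Index n) :
    (W0.ofCoords x).1 p.1.1 p.1.2 = x p := by
  show (if h : n ≤ (p.1.1 : ℕ) + (p.1.2 : ℕ) + 2 then
    x ⟨(min p.1.1 p.1.2, max p.1.1 p.1.2), _⟩ else 0) = x p
  rw [dif_pos p.2.2]
  congr 1
  exact Subtype.ext (Prod.ext (min_eq_left p.2.1) (max_eq_right p.2.1))

theorem ofCoords_self (B : W0 n R) : W0.ofCoords (fun p => B.1 p.1.1 p.1.2) = B := by
  refine Subtype.ext ?_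
  ext i j
  show (if h : n ≤ (i : ℕ) + (j : ℕ) + 2 then B.1 (min i j) (max i j) else 0) = B.1 i j
  split_ifs with h
  · rcases le_total i j with hij | hij
    · rw [min_eq_left hij, max_eq_right hij]
    · rw [min_eq_right hij, max_eq_left hij, B.2.1.apply]
  · exact (B.2.2 i j (by omega)).symm

/-- The element of `W₀` with given blocks of coordinates. -/
noncomputable def W0.ofBlocks (b : Fin (n / 2) → R) (v : unipIndex n → R) (w : Fin n → R) :
    W0 n R :=
  W0.ofCoords fun p => Sum.elim b (Sum.elim v w) (blockEquiv.symm p)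

theorem ofBlocks_apply (b : Fin (n / 2) → R) (v : unipIndex n → R) (w : Fin n → R)
    (x : Fin (n / 2) ⊕ unipIndex n ⊕ Fin n) :
    (W0.ofBlocks b v w).1 (blockPos x).1.1 (blockPos x).1.2 = Sum.elim b (Sum.elim v w) x := by
  rw [W0.ofBlocks, ofCoords_apply]
  exact congrArg _ (blockEquiv.symm_apply_apply x)

theorem apply_blockPos (B : W0 n R) (x : Fin (n / 2) ⊕ unipIndex n ⊕ Fin n) :
    B.1 (blockPos x).1.1 (blockPos x).1.2 = Sum.elim B.beta (Sum.elim B.side B.mid) x := by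
  rcases x with k | q | i
  · exact (hessMat_fin B ⟨k, by omega⟩ ⟨k + 1, by omega⟩).symm
  · rfl
  · exact (hessMat_fin B ⟨i / 2 + (n - 1 - i), by omega⟩ ⟨i / 2, by omega⟩).symm

theorem beta_ofBlocks (b : Fin (n / 2) → R) (v : unipIndex n → R) (w : Fin n → R) :
    (W0.ofBlocks b v w).beta = b := funext fun k =>
  (apply_blockPos _ (Sum.inl k)).symm.trans (ofBlocks_apply b v w (Sum.inl k))

theorem side_ofBlocks (b : Fin (n / 2) → R) (v : unipIndex n → R) (w : Fin n → R) :
    (W0.ofBlocks b v w).side = v := funext fun q =>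
  (apply_blockPos _ (Sum.inr (Sum.inl q))).symm.trans (ofBlocks_apply b v w (Sum.inr (Sum.inl q)))

theorem mid_ofBlocks (b : Fin (n / 2) → R) (v : unipIndex n → R) (w : Fin n → R) :
    (W0.ofBlocks b v w).mid = w := funext fun i =>
  (apply_blockPos _ (Sum.inr (Sum.inr i))).symm.trans (ofBlocks_apply b v w (Sum.inr (Sum.inr i)))

theorem ofBlocks_self (B : W0 n R) : W0.ofBlocks B.beta B.side B.mid = B := by
  conv_rhs => rw [← ofCoords_self B]
  rw [W0.ofBlocks]
  congr 1
  funext p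
  obtain ⟨x, rfl⟩ := blockPos_bijective.2 p
  rw [apply_blockPos]
  exact congrArg _ (blockEquiv.symm_apply_apply x)

theorem hessMat_succ_eq {B B' : W0 n R} (h : B.beta = B'.beta) (i : ℕ) :
    hessMat B i (i + 1) = hessMat B' i (i + 1) := by
  have key : ∀ i, i < n / 2 → hessMat B i (i + 1) = hessMat B' i (i + 1) := fun i hi =>
    congrFun h ⟨i, hi⟩
  by_cases hi : i + 1 < n
  · rcases Nat.lt_or_ge i (n / 2) with h1 | h1
    · exact key i h1
    · rw [hessMat_symm B (by omega) hi, hessMat_symm B' (by omega) hi,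
        show n - 1 - i = n - 1 - (i + 1) + 1 by omega]
      exact key _ (by omega)
  · rw [hessMat, hessMat, dif_neg (by omega), dif_neg (by omega)]

theorem hessMat_eq_of_side {B B' : W0 n R} (h : B.side = B'.side) {i j : ℕ} (hij : j ≤ i)
    (hn : i + j + 3 ≤ n) : hessMat B i j = hessMat B' i j := by
  have h1 := congrFun h ⟨(⟨i + 1, by omega⟩, ⟨j, by omega⟩), by
    rw [Fin.lt_def]
    dsimp only
    omega, by dsimp only; omega⟩
  have h2 := hessMat_fin B ⟨i, by omega⟩ ⟨j, by omega⟩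
  have h3 := hessMat_fin B' ⟨i, by omega⟩ ⟨j, by omega⟩
  exact h2.trans (Eq.trans h1 h3.symm)

theorem hessMat_eq_of_blocks {B B' : W0 n R} (hs : B.side = B'.side) {d : ℕ}
    (hm : ∀ i : Fin n, n - 1 - i < d → B.mid i = B'.mid i) {i j : ℕ} (hij : j ≤ i)
    (hd : i < j + d) : hessMat B i j = hessMat B' i j := by
  by_cases hi : i < n
  swap
  · rw [hessMat, hessMat, dif_neg (by omega), dif_neg (by omega)]
  have key : ∀ i j, j ≤ i → i < j + d → i + j + 1 ≤ n → hessMat B i j = hessMat B' i j := by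
    intro i j hij hd hn
    rcases Nat.lt_or_ge n (i + j + 3) with h1 | h1
    · have h2 := hm ⟨n - 1 - (i - j), by omega⟩ (by dsimp only; omega)
      simp only [W0.mid] at h2
      rw [show (n - 1 - (i - j)) / 2 + (n - 1 - (n - 1 - (i - j))) = i by omega,
        show (n - 1 - (i - j)) / 2 = j by omega] at h2
      exact h2
    · exact hessMat_eq_of_side hs hij h1
  rcases Nat.lt_or_ge n (i + j + 1) with h1 | h1
  · rw [hessMat_symm B hi (by omega), hessMat_symm B' hi (by omega)]
    exact key _ _ (by omega) (by omega) (by omega)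
  · exact key i j hij hd h1

/-- The coefficients of the invariant polynomial. -/
noncomputable def W0.invCoeffs (B : W0 n R) (i : Fin n) : R := B.inv.coeff i

theorem invCoeffs_sub {B B' : W0 n R} (hb : B.beta = B'.beta) (hs : B.side = B'.side) (i : Fin n)
    (hm : ∀ i' : Fin n, n - 1 - (i' : ℕ) < n - 1 - i → B.mid i' = B'.mid i') :
    B.invCoeffs i - B'.invCoeffs i =
      (-1) ^ (n - 1 - (i : ℕ)) * invSlope B (n - 1 - i) * (B.mid i - B'.mid i) := by
  have hi := i.isLt
  have h := inv_coeff_sub (B := B) (B' := B') (d := n - 1 - i) (by omega) (hessMat_succ_eq hb)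
    (fun a b hab hd => hessMat_eq_of_blocks hs hm hab hd)
    (fun j hj => hessMat_eq_of_side hs (by omega) (by omega))
  rw [show n - 1 - (n - 1 - (i : ℕ)) = i by omega] at h
  exact h

/-- The blocks next to the anti-diagonal and at the sides, together with the invariant polynomial,
determine the matrix, when the entries next to the anti-diagonal do not vanish. -/
theorem eq_of_beta_side_invCoeffs [IsDomain R] [CharZero R] {B B' : W0 n R}
    (h0 : ∀ k, B.beta k ≠ 0) (hb : B.beta = B'.beta) (hs : B.side = B'.side)
    (hc : B.invCoeffs = B'.invCoeffs) : B = B' := by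
  have h1 : ∀ l, l + 1 < n → hessMat B l (l + 1) ≠ 0 := by
    intro l hl
    rcases Nat.lt_or_ge l (n / 2) with h | h
    · exact h0 ⟨l, h⟩
    · rw [hessMat_symm B (by omega) hl, show n - 1 - l = n - 1 - (l + 1) + 1 by omega]
      exact h0 ⟨n - 1 - (l + 1), by omega⟩
  have hm : ∀ d, ∀ i : Fin n, n - 1 - (i : ℕ) < d → B.mid i = B'.mid i := by
    intro d
    induction d with
    | zero => intro i hi; omega
    | succ d ih =>
      intro i hi
      have h2 := invCoeffs_sub hb hs i fun i' hi' => ih i' (by omega)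
      rw [hc, sub_self, eq_comm, mul_eq_zero, mul_eq_zero] at h2
      refine sub_eq_zero.1 (h2.resolve_left ?_)
      rintro (h | h)
      · exact pow_ne_zero _ (neg_ne_zero.2 one_ne_zero) h
      · rw [invSlope, mul_eq_zero] at h
        rcases h with h | h
        · split_ifs at h
          · exact one_ne_zero h
          · exact two_ne_zero h
        · obtain ⟨l, hl, hl0⟩ := Finset.prod_eq_zero_iff.1 h
          rw [Finset.mem_Ico] at hl
          have hi' := i.isLt
          exact h1 l (by omega) hl0
  rw [← ofBlocks_self B, ← ofBlocks_self B', hb, hs, funext fun i => hm n i (by omega)]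

end Blocks

/-! ### The Jacobian of the invariants -/

section Slopes

variable {n : ℕ} {R : Type*} [CommRing R]

/-- The monomial in the entries next to the anti-diagonal by which the coordinates of an orbit
distort the measure. -/
noncomputable def W0.orbitScale (B : W0 n R) : R :=
  (∏ k, B.beta k) * ∏ q : unipIndex n, hessMat B (unipRow q) (unipRow q + 1)

theorem prod_ite_even (n : ℕ) (x : R) :
    ∏ i : Fin n, (if Even (i : ℕ) then 1 else x) = x ^ (n / 2) := by
  rw [← Finset.prod_range fun i => if Even i then 1 else x]
  have h : ∀ m, ∏ i ∈ Finset.range (2 * m), (if Even i then 1 else x) = x ^ m := by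
    intro m
    rw [prod_range_two_mul, ← Finset.card_range m, ← Finset.prod_const, Finset.card_range]
    refine Finset.prod_congr rfl fun a _ => ?_
    rw [if_pos (even_two_mul a), if_neg (Nat.not_even_iff_odd.2 ⟨a, rfl⟩), one_mul]
  rcases Nat.even_or_odd' n with ⟨m, hm | hm⟩
  · rw [hm, h, show 2 * m / 2 = m by omega]
  · rw [hm, Finset.prod_range_succ, h, if_pos (even_two_mul m), mul_one,
      show (2 * m + 1) / 2 = m by omega]

/-- The Jacobian determinant of the invariants with respect to the middle entries, up to sign. The
power of `2` comes from the diagonals with two middle entries. -/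
theorem prod_invSlope (B : W0 n R) :
    ∏ i : Fin n, invSlope B (n - 1 - i) = 2 ^ (n / 2) * (B.lam * B.orbitScale) := by
  have h1 : ∀ i : Fin n, invSlope B (n - 1 - i) = (if Even (i : ℕ) then 1 else 2) *
      ∏ l ∈ Finset.Ico ((i : ℕ) / 2) ((i : ℕ) / 2 + (n - 1 - i)), hessMat B l (l + 1) := by
    intro i
    have hi := i.isLt
    rw [invSlope, show n - 1 - (n - 1 - (i : ℕ)) = i by omega]
  rw [Finset.prod_congr rfl fun i _ => h1 i, Finset.prod_mul_distrib, prod_ite_even,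
    prod_slopes_eq (b := fun l => hessMat B l (l + 1))]
  · congr 2
    rw [W0.lam]
    refine Finset.prod_congr rfl fun k _ => ?_
    congr 1
    have hk := k.isLt
    have h2 := apply_eq_hessMat B ⟨k, by omega⟩ ⟨n - 2 - k, by omega⟩
    rw [h2]
    dsimp only
    congr 1
    omega
  · intro k hk
    rw [hessMat_symm B (i := k) (by omega) (by omega)]
    congr 1
    · omega
    · omega

theorem orbitScale_ne_zero [IsDomain R] {B : W0 n R} (h : ∀ k, B.beta k ≠ 0) :
    B.orbitScale ≠ 0 := by
  refine mul_ne_zero (Finset.prod_ne_zero_iff.2 fun k _ => h k)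
    (Finset.prod_ne_zero_iff.2 fun q _ => ?_)
  have h2 := q.2.2
  have h3 := unipRow_val q
  have h4 : (q.1.2 : ℕ) < q.1.1 := q.2.1
  rcases Nat.lt_or_ge (unipRow q : ℕ) (n / 2) with h1 | h1
  · exact h ⟨_, h1⟩
  · rw [hessMat_symm B (by omega) (by omega),
      show n - 1 - (unipRow q : ℕ) = n - 1 - (unipRow q + 1) + 1 by omega]
    exact h ⟨n - 1 - (unipRow q + 1), by omega⟩

theorem invSlope_ne_zero [IsDomain R] [CharZero R] {B : W0 n R} (h : ∀ k, B.beta k ≠ 0)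
    (hlam : B.lam ≠ 0) (i : Fin n) : invSlope B (n - 1 - i) ≠ 0 := by
  have h1 : ∏ i : Fin n, invSlope B (n - 1 - i) ≠ 0 := by
    rw [prod_invSlope]
    exact mul_ne_zero (pow_ne_zero _ two_ne_zero) (mul_ne_zero hlam (orbitScale_ne_zero h))
  exact Finset.prod_ne_zero_iff.1 h1 i (Finset.mem_univ i)

theorem lam_ne_zero [IsDomain R] {B : W0 n R} (h : ∀ k, B.beta k ≠ 0) : B.lam ≠ 0 := by
  refine Finset.prod_ne_zero_iff.2 fun k _ => pow_ne_zero _ ?_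
  have hk := k.isLt
  have h2 := apply_eq_hessMat B ⟨k, by omega⟩ ⟨n - 2 - k, by omega⟩
  rw [h2]
  have h3 := h k
  rw [W0.beta] at h3
  convert h3 using 2
  dsimp only
  omega

theorem invSlope_congr {B B' : W0 n R} (h : B.beta = B'.beta) (d : ℕ) :
    invSlope B d = invSlope B' d := by
  rw [invSlope, invSlope, Finset.prod_congr rfl fun l _ => hessMat_succ_eq h l]

end Slopes

/-! ### Integration over `W₀` along the fibres of the invariants -/

theorem lintegral_eq_lintegral_comap {X Y : Type*} [MeasurableSpace X] [MeasurableSpace Y]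
    {F : X → Y} (hF : MeasurableEmbedding F) {μ : Measure Y} {g : Y → ℝ≥0∞}
    (hg : ∀ y, y ∉ Set.range F → g y = 0) :
    ∫⁻ y, g y ∂μ = ∫⁻ x, g (F x) ∂μ.comap F := by
  rw [← hF.lintegral_map g, hF.map_comap, ← lintegral_indicator hF.measurableSet_range]
  refine lintegral_congr fun y => ?_
  by_cases hy : y ∈ Set.range F
  · rw [Set.indicator_of_mem hy]
  · rw [Set.indicator_of_notMem hy, hg y hy]

section MeasureW0

variable {n : ℕ} {R : Type*} [NormedCommRing R] [NormMulClass R] [NormOneClass R] [IsDomain R]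
  [CharZero R] [ProperSpace R] [MeasurableSpace R] [BorelSpace R]
  {μ : Measure R} [μ.IsAddHaarMeasure] (hμ : IsModulus μ)

theorem enorm_finset_prod {ι : Type*} (s : Finset ι) (f : ι → R) :
    ‖∏ i ∈ s, f i‖ₑ = ∏ i ∈ s, ‖f i‖ₑ := by
  simp only [enorm_eq_nnnorm, nnnorm_prod, ENNReal.ofNNReal_finsetProd]

theorem measurable_W0_apply (i j : Fin n) : Measurable fun B : W0 n R => B.1 i j :=
  (measurable_matrix_apply i j).comp measurable_subtype_coe

theorem measurable_W0_of {X : Type*} [MeasurableSpace X] {f : X → W0 n R}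
    (h : ∀ i j, Measurable fun x => (f x).1 i j) : Measurable f :=
  Measurable.subtype_mk (measurable_matrix_of h)

theorem measurable_hessMat (i j : ℕ) : Measurable fun B : W0 n R => hessMat B i j := by
  unfold hessMat
  split_ifs with h
  · exact measurable_W0_apply _ _
  · exact measurable_const

theorem measurable_beta : Measurable (W0.beta : W0 n R → _) :=
  measurable_pi_lambda _ fun _ => measurable_hessMat _ _

theorem measurable_side : Measurable (W0.side : W0 n R → _) :=
  measurable_pi_lambda _ fun _ => measurable_W0_apply _ _

theorem measurable_orbitScale : Measurable (W0.orbitScale : W0 n R → R) :=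
  (Finset.measurable_prod _ fun _ _ => measurable_hessMat _ _).mul
    (Finset.measurable_prod _ fun _ _ => measurable_hessMat _ _)

theorem measurable_lam : Measurable (W0.lam : W0 n R → R) :=
  Finset.measurable_prod _ fun _ _ => (measurable_W0_apply _ _).pow_const _

theorem measurable_invCoeffs : Measurable (W0.invCoeffs : W0 n R → _) := by
  have h : ∀ k i, Measurable fun B : W0 n R => (hessPoly (hessMat B) k).coeff i := by
    intro k
    induction k using Nat.strong_induction_on with
    | _ k ih =>
      intro i
      rcases k with _ | k
      · simp only [hessPoly]
        exact measurable_const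
      · simp only [hessPoly_succ, Polynomial.coeff_add, Polynomial.finsetSum_coeff,
          Polynomial.coeff_C_mul]
        refine Measurable.add ?_ (Finset.measurable_sum _ fun j hj => ?_)
        · rcases i with _ | i
          · simp only [Polynomial.mul_coeff_zero, Polynomial.coeff_X_zero, zero_mul]
            exact measurable_const
          · simp only [Polynomial.coeff_X_mul]
            exact ih k (Nat.lt_succ_self k) i
        · exact (((measurable_hessMat _ _).const_mul _).mul
            (Finset.measurable_prod _ fun _ _ => measurable_hessMat _ _)).mul
            (ih j (Finset.mem_range.1 hj) i)
  refine measurable_pi_lambda _ fun i => ?_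
  simp only [W0.invCoeffs, inv_eq_hessPoly]
  exact h n i

theorem measurable_ofCoords : Measurable (W0.ofCoords : (W0Index n → R) → W0 n R) := by
  refine measurable_W0_of fun i j => ?_
  show Measurable fun x : W0Index n → R => if h : n ≤ (i : ℕ) + (j : ℕ) + 2 then
    x ⟨(min i j, max i j), _⟩ else 0
  split_ifs with h
  · exact measurable_pi_apply _
  · exact measurable_const

/-- The coordinates of `W₀`. -/
noncomputable def W0.coordsEquiv : W0 n R ≃ᵐ (W0Index n → R) where
  toFun B p := B.1 p.1.1 p.1.2
  invFun := W0.ofCoords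
  left_inv := ofCoords_self
  right_inv x := funext (ofCoords_apply x)
  measurable_toFun := measurable_pi_lambda _ fun p => measurable_W0_apply p.1.1 p.1.2
  measurable_invFun := measurable_ofCoords

theorem standardBorelSpace_W0 : StandardBorelSpace (W0 n R) :=
  standardBorelSpace_of_measurableEmbedding (W0.coordsEquiv (n := n) (R := R)).measurableEmbedding

theorem measurePreserving_ofBlocks :
    MeasurePreserving (fun z : ((Fin (n / 2) → R) × (unipIndex n → R)) × (Fin n → R) =>
        W0.ofBlocks z.1.1 z.1.2 z.2)
      (((Measure.pi fun _ => μ).prod (Measure.pi fun _ => μ)).prod (Measure.pi fun _ => μ))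
      (W0.measure n μ) := by
  have h1 := measurePreserving_prodAssoc (Measure.pi fun _ : Fin (n / 2) => μ)
    (Measure.pi fun _ : unipIndex n => μ) (Measure.pi fun _ : Fin n => μ)
  have h2 := measurePreserving_sumPiEquivProdPi_symm (X := fun _ : unipIndex n ⊕ Fin n => R)
    (fun _ => μ)
  have h3 := (MeasurePreserving.id (Measure.pi fun _ : Fin (n / 2) => μ)).prod h2
  have h4 := measurePreserving_sumPiEquivProdPi_symm
    (X := fun _ : Fin (n / 2) ⊕ unipIndex n ⊕ Fin n => R) (fun _ => μ)
  have h5 := measurePreserving_piCongrLeft (α := fun _ : W0Index n => R) (fun _ => μ)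
    (blockEquiv (n := n))
  have h6 : MeasurePreserving W0.ofCoords (Measure.pi fun _ : W0Index n => μ) (W0.measure n μ) :=
    ⟨measurable_ofCoords, rfl⟩
  have h7 := h6.comp (h5.comp (h4.comp (h3.comp h1)))
  convert h7 using 1
  funext z
  simp only [Function.comp_apply, W0.ofBlocks]
  congr 1
  funext p
  obtain ⟨x, rfl⟩ := (blockEquiv (n := n)).surjective p
  rw [MeasurableEquiv.piCongrLeft_apply_apply, Equiv.symm_apply_apply]
  rcases x with k | q | i <;> rfl

theorem measurable_ofBlocks :
    Measurable (fun z : ((Fin (n / 2) → R) × (unipIndex n → R)) × (Fin n → R) =>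
        W0.ofBlocks z.1.1 z.1.2 z.2) := by
  have h : Measurable fun z : ((Fin (n / 2) → R) × (unipIndex n → R)) × (Fin n → R) =>
      fun p => Sum.elim z.1.1 (Sum.elim z.1.2 z.2) (blockEquiv.symm p) := by
    refine measurable_pi_lambda _ fun p => ?_
    rcases blockEquiv.symm p with k | q | i
    · exact (measurable_pi_apply k).comp (measurable_fst.comp measurable_fst)
    · exact (measurable_pi_apply q).comp (measurable_snd.comp measurable_fst)
    · exact (measurable_pi_apply i).comp measurable_snd
  exact measurable_ofCoords.comp h

theorem measurable_ofBlocks_right (b : Fin (n / 2) → R) (v : unipIndex n → R) :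
    Measurable fun w : Fin n → R => W0.ofBlocks b v w := by
  have h : Measurable fun w : Fin n → R =>
      fun p => Sum.elim b (Sum.elim v w) (blockEquiv.symm p) := by
    refine measurable_pi_lambda _ fun p => ?_
    rcases blockEquiv.symm p with k | q | i
    · exact measurable_const
    · exact measurable_const
    · exact measurable_pi_apply i
  exact measurable_ofCoords.comp h

include hμ in
/-- For fixed other entries, the invariants are a triangular function of the middle entries. -/
theorem comap_invCoeffs {b : Fin (n / 2) → R} (hb : ∀ k, b k ≠ 0) (v : unipIndex n → R) :
    MeasurableEmbedding (fun w => (W0.ofBlocks b v w).invCoeffs) ∧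
    ∀ w₀, (Measure.pi fun _ : Fin n => μ).comap (fun w => (W0.ofBlocks b v w).invCoeffs) =
      (‖(2 : R)‖ₑ ^ (n / 2) * (‖(W0.ofBlocks b v w₀).lam‖ₑ *
        ‖(W0.ofBlocks b v w₀).orbitScale‖ₑ)) • Measure.pi fun _ => μ := by
  have hbeta := beta_ofBlocks b v
  have hne : ∀ w (i : Fin n), invSlope (W0.ofBlocks b v w) (n - 1 - i) ≠ 0 := fun w =>
    invSlope_ne_zero (by rw [hbeta]; exact hb) (lam_ne_zero (by rw [hbeta]; exact hb))
  have hF : Measurable fun w => (W0.ofBlocks b v w).invCoeffs :=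
    measurable_invCoeffs.comp (measurable_ofBlocks_right b v)
  have key := fun w₀ => comap_triangular hμ (fun i : Fin n => n - 1 - (i : ℕ)) (by
      intro i j hij
      have hi := i.isLt
      have hj := j.isLt
      dsimp only at hij
      exact Fin.ext (by omega))
    (a := fun i : Fin n => (-1) ^ (n - 1 - (i : ℕ)) * invSlope (W0.ofBlocks b v w₀) (n - 1 - i))
    (fun i => mul_ne_zero (pow_ne_zero _ (neg_ne_zero.2 one_ne_zero)) (hne w₀ i)) hF (by
      intro i w w' hw
      have h := invCoeffs_sub (B := W0.ofBlocks b v w) (B' := W0.ofBlocks b v w')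
        (by rw [hbeta, hbeta]) (by rw [side_ofBlocks, side_ofBlocks]) i
        (by rw [mid_ofBlocks, mid_ofBlocks]; exact hw)
      rw [mid_ofBlocks, mid_ofBlocks, invSlope_congr (B' := W0.ofBlocks b v w₀)
        (by rw [hbeta, hbeta])] at h
      linear_combination h)
  refine ⟨(key 0).1, fun w₀ => ?_⟩
  rw [(key w₀).2]
  congr 1
  rw [← enorm_finset_prod, Finset.prod_mul_distrib, prod_invSlope, enorm_mul, enorm_mul, enorm_mul,
    enorm_pow, enorm_finset_prod]
  simp only [enorm_pow, enorm_neg, enorm_one, one_pow, Finset.prod_const_one, one_mul]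

variable (n R) in
/-- The matrices whose entries next to the anti-diagonal do not vanish. -/
abbrev W0Reg : Type _ := {B : W0 n R // ∀ k, B.beta k ≠ 0}

/-- The coordinates on regular matrices that consist of the invariant polynomial and of the blocks
on which `P` acts freely. -/
noncomputable def regCoords (B : W0Reg n R) :
    ((Fin (n / 2) → R) × (unipIndex n → R)) × (Fin n → R) :=
  ((B.1.beta, B.1.side), B.1.invCoeffs)

theorem measurableSet_regular : MeasurableSet {B : W0 n R | ∀ k, B.beta k ≠ 0} := by
  have h : {B : W0 n R | ∀ k, B.beta k ≠ 0} = ⋂ k, (fun B : W0 n R => B.beta k) ⁻¹' {0}ᶜ := by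
    ext B
    simp
  rw [h]
  exact MeasurableSet.iInter fun k =>
    (measurable_hessMat _ _) (measurableSet_singleton (0 : R)).compl

theorem measurableEmbedding_regCoords : MeasurableEmbedding (regCoords (n := n) (R := R)) := by
  have := standardBorelSpace_W0 (n := n) (R := R)
  have : StandardBorelSpace (W0Reg n R) := measurableSet_regular.standardBorel
  have h1 : StandardBorelSpace (Fin (n / 2) → R) := inferInstance
  have h2 : StandardBorelSpace (unipIndex n → R) := inferInstance
  have h3 : StandardBorelSpace (Fin n → R) := inferInstance
  have h4 : StandardBorelSpace ((Fin (n / 2) → R) × (unipIndex n → R)) := StandardBorelSpace.prod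
  have h5 : StandardBorelSpace (((Fin (n / 2) → R) × (unipIndex n → R)) × (Fin n → R)) :=
    StandardBorelSpace.prod
  have h6 : MeasurableSpace.CountablySeparated
      (((Fin (n / 2) → R) × (unipIndex n → R)) × (Fin n → R)) :=
    MeasurableSpace.countablySeparated_of_separatesPoints
  refine Measurable.measurableEmbedding ?_ ?_
  · exact ((measurable_beta.comp measurable_subtype_coe).prodMk
      (measurable_side.comp measurable_subtype_coe)).prodMk
      (measurable_invCoeffs.comp measurable_subtype_coe)
  · intro B B' h
    simp only [regCoords, Prod.mk.injEq] at h
    exact Subtype.ext (eq_of_beta_side_invCoeffs B.2 h.1.1 h.1.2 h.2)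

/-- A function on `W₀`, divided by the distortion of the coordinates of an orbit, as a function of
the invariant polynomial and of the blocks on which `P` acts freely; it is `0` where these are not
the coordinates of a regular matrix. -/
noncomputable def fiberDensity (φ : W0 n R → ℝ≥0∞) :
    ((Fin (n / 2) → R) × (unipIndex n → R)) × (Fin n → R) → ℝ≥0∞ :=
  Function.extend regCoords
    (fun B : W0Reg n R => φ B.1 * (‖(2 : R)‖ₑ ^ (n / 2) * ‖B.1.orbitScale‖ₑ)⁻¹) 0

theorem measurable_fiberDensity {φ : W0 n R → ℝ≥0∞} (hφ : Measurable φ) :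
    Measurable (fiberDensity φ) :=
  measurableEmbedding_regCoords.measurable_extend ((hφ.comp measurable_subtype_coe).mul
    ((measurable_orbitScale.comp measurable_subtype_coe).enorm.const_mul _).inv) measurable_const

theorem fiberDensity_apply (φ : W0 n R → ℝ≥0∞) {B : W0 n R} (h : ∀ k, B.beta k ≠ 0) :
    fiberDensity φ ((B.beta, B.side), B.invCoeffs) =
      φ B * (‖(2 : R)‖ₑ ^ (n / 2) * ‖B.orbitScale‖ₑ)⁻¹ :=
  measurableEmbedding_regCoords.injective.extend_apply _ _ (⟨B, h⟩ : W0Reg n R)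

theorem fiberDensity_eq_zero (φ : W0 n R → ℝ≥0∞)
    {z : ((Fin (n / 2) → R) × (unipIndex n → R)) × (Fin n → R)}
    (h : ∀ B : W0 n R, (∀ k, B.beta k ≠ 0) → ((B.beta, B.side), B.invCoeffs) ≠ z) :
    fiberDensity φ z = 0 :=
  Function.extend_apply' _ _ _ fun ⟨B, hB⟩ => h B.1 B.2 hB

theorem two_pow_mul_orbitScale_ne_zero {B : W0 n R} (h : ∀ k, B.beta k ≠ 0) :
    ‖(2 : R)‖ₑ ^ (n / 2) * ‖B.orbitScale‖ₑ ≠ 0 :=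
  mul_ne_zero (pow_ne_zero _ (enorm_ne_zero.2 two_ne_zero)) (enorm_ne_zero.2 (orbitScale_ne_zero h))

theorem two_pow_mul_orbitScale_ne_top (B : W0 n R) :
    ‖(2 : R)‖ₑ ^ (n / 2) * ‖B.orbitScale‖ₑ ≠ ⊤ :=
  ENNReal.mul_ne_top (ENNReal.pow_ne_top enorm_ne_top) enorm_ne_top

include hμ in
/-- Integration over `W₀` by way of the invariant polynomial. -/
theorem lintegral_mul_lam [NullSingletonClass μ] {φ : W0 n R → ℝ≥0∞} (hφ : Measurable φ) :
    ∫⁻ B, φ B * ‖B.lam‖ₑ ∂(W0.measure n μ) =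
      ∫⁻ c, ∫⁻ z, fiberDensity φ (z, c) ∂((Measure.pi fun _ => μ).prod (Measure.pi fun _ => μ))
        ∂(Measure.pi fun _ => μ) := by
  have hH := measurable_fiberDensity hφ
  have hφl : Measurable fun B : W0 n R => φ B * ‖B.lam‖ₑ := hφ.mul measurable_lam.enorm
  rw [← lintegral_prod_symm _ hH.aemeasurable, lintegral_prod _ hH.aemeasurable,
    ← measurePreserving_ofBlocks.lintegral_comp hφl,
    lintegral_prod (fun z : ((Fin (n / 2) → R) × (unipIndex n → R)) × (Fin n → R) =>
      φ (W0.ofBlocks z.1.1 z.1.2 z.2) * ‖(W0.ofBlocks z.1.1 z.1.2 z.2).lam‖ₑ)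
      (hφl.comp measurable_ofBlocks).aemeasurable]
  have hae : ∀ᵐ z : (Fin (n / 2) → R) × (unipIndex n → R)
      ∂((Measure.pi fun _ => μ).prod (Measure.pi fun _ => μ)), ∀ k, z.1 k ≠ 0 := by
    rw [ae_all_iff]
    intro k
    exact Measure.quasiMeasurePreserving_fst.ae
      (Measure.ae_eval_ne (fun _ : Fin (n / 2) => μ) k 0)
  refine lintegral_congr_ae (hae.mono ?_)
  rintro ⟨b, v⟩ hb
  dsimp only at hb ⊢
  obtain ⟨hemb, hcomap⟩ := comap_invCoeffs hμ hb v
  have hreg : ∀ w k, (W0.ofBlocks b v w).beta k ≠ 0 := fun w => by rwa [beta_ofBlocks]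
  have hoff : ∀ c, c ∉ Set.range (fun w => (W0.ofBlocks b v w).invCoeffs) →
      fiberDensity φ ((b, v), c) = 0 := by
    intro c hc
    refine fiberDensity_eq_zero φ fun B _ hB => hc ?_
    simp only [Prod.mk.injEq] at hB
    refine ⟨B.mid, ?_⟩
    dsimp only
    rw [← hB.1.1, ← hB.1.2, ofBlocks_self, hB.2]
  have h1 := lintegral_eq_lintegral_comap hemb (μ := Measure.pi fun _ : Fin n => μ) hoff
  have hcongr : ∀ w, (‖(W0.ofBlocks b v w).lam‖ₑ * ‖(W0.ofBlocks b v w).orbitScale‖ₑ) =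
      ‖(W0.ofBlocks b v 0).lam‖ₑ * ‖(W0.ofBlocks b v 0).orbitScale‖ₑ := by
    intro w
    have h2 : ∀ w, ‖∏ i : Fin n, invSlope (W0.ofBlocks b v w) (n - 1 - i)‖ₑ =
        ‖(2 : R)‖ₑ ^ (n / 2) *
          (‖(W0.ofBlocks b v w).lam‖ₑ * ‖(W0.ofBlocks b v w).orbitScale‖ₑ) := fun w => by
      rw [prod_invSlope, enorm_mul, enorm_mul, enorm_pow]
    have h3 := h2 w
    rw [Finset.prod_congr rfl fun i _ => invSlope_congr (B' := W0.ofBlocks b v 0)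
      (by rw [beta_ofBlocks, beta_ofBlocks]) _, h2 0] at h3
    exact ((ENNReal.mul_right_inj (pow_ne_zero _ (enorm_ne_zero.2 two_ne_zero))
      (ENNReal.pow_ne_top enorm_ne_top)).1 h3).symm
  rw [h1, hcomap 0, lintegral_smul_measure, smul_eq_mul, ← lintegral_const_mul]
  · refine lintegral_congr fun w => ?_
    have h4 := fiberDensity_apply φ (hreg w)
    rw [beta_ofBlocks, side_ofBlocks] at h4
    rw [h4, ← hcongr w]
    have h5 := ENNReal.mul_inv_cancel (two_pow_mul_orbitScale_ne_zero (hreg w))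
      (two_pow_mul_orbitScale_ne_top (W0.ofBlocks b v w))
    calc φ (W0.ofBlocks b v w) * ‖(W0.ofBlocks b v w).lam‖ₑ
        = φ (W0.ofBlocks b v w) * ‖(W0.ofBlocks b v w).lam‖ₑ *
          ((‖(2 : R)‖ₑ ^ (n / 2) * ‖(W0.ofBlocks b v w).orbitScale‖ₑ) *
            (‖(2 : R)‖ₑ ^ (n / 2) * ‖(W0.ofBlocks b v w).orbitScale‖ₑ)⁻¹) := by
          rw [h5, mul_one]
      _ = _ := by ring
  · exact hH.comp (measurable_prodMk_left.comp hemb.measurable)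

end MeasureW0

/-! ### The common structure of the two parabolic groups -/

section Chart

variable {n : ℕ} {R : Type*} [NormedCommRing R] [NormMulClass R] [NormOneClass R] [IsDomain R]
  [CharZero R] [ProperSpace R] [MeasurableSpace R] [BorelSpace R]

/-- A group that acts on `W₀` through the elements `diag(t) u`, with `u` unipotent orthogonal and
`diag(t)` in a torus of similitudes of multiplier `c`: the properties that the groups `P(R)`
for `n` odd and for `n` even have in common. -/
structure IsParabolicChart (μ : Measure R) (P : Type*) [Group P] [MeasurableSpace P]
    [MulAction P (W0 n R)] (point : (Fin (n / 2) → Rˣ) × unipGroup n R → P)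
    (t : (Fin (n / 2) → Rˣ) → Fin n → Rˣ) (c : (Fin (n / 2) → Rˣ) → Rˣ) : Prop where
  measurable_point : Measurable point
  surjective_point : Function.Surjective point
  measurable_smul : ∀ B : W0 n R, Measurable fun h : P => h • B
  mul_rev : ∀ s i, t s i * t s i.rev = c s
  smul_apply : ∀ s u (B : W0 n R) (i j : Fin n), (point (s, u) • B).1 i j =
    ((c s)⁻¹ * (t s i * t s j)).1 * (u.1.1 * B.1 * u.1.1ᵀ) i j
  measurePreserving_ratio : MeasurePreserving (entryRatio t)
    (Measure.pi fun _ => unitMeasure μ) (Measure.pi fun _ => unitMeasure μ)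
  bijective_ratio : Function.Bijective (entryRatio t)
  prod_ratio : ∀ s, ∏ q : unipIndex n, natEntry (t s) q.1.2 * (natEntry (t s) q.1.1)⁻¹ = delta n s

variable {μ : Measure R} [μ.IsAddHaarMeasure] (hμ : IsModulus μ)

theorem measurable_GL_iff {X : Type*} [MeasurableSpace X] {f : X → GL (Fin n) R} :
    Measurable f ↔ Measurable fun x => (f x).1 := measurable_comap_iff

theorem measurable_diagonal_mul {t : (Fin (n / 2) → Rˣ) → Fin n → Rˣ}
    (ht : ∀ i, Measurable fun s => t s i) :
    Measurable fun x : (Fin (n / 2) → Rˣ) × unipGroup n R =>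
      Matrix.diagonal (fun i => (t x.1 i).1) * x.2.1.1 := by
  refine measurable_matrix_of fun i j => ?_
  simp only [Matrix.diagonal_mul]
  exact (measurable_unitsVal.comp ((ht i).comp measurable_fst)).mul
    ((measurable_matrix_apply i j).comp (measurable_unipVal.comp measurable_snd))

include hμ in
theorem isParabolicChart_odd (hn : Odd n) :
    IsParabolicChart μ (POdd n R) (pointOdd n) (torusOddEntry n) fun _ => 1 where
  measurable_point := by
    have := measurableMul₂_units (R := R)
    have := measurableInv_units (R := R)
    refine Measurable.subtype_mk (measurable_GL_iff.2 (measurable_diagonal_mul fun i => ?_))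
    refine (Finset.measurable_prod _ fun k _ => ?_).mul (Finset.measurable_prod _ fun k _ => ?_)
    · split_ifs
      · exact (measurable_pi_apply k).inv
      · exact measurable_const
    · split_ifs
      · exact measurable_pi_apply k
      · exact measurable_const
  surjective_point := pointOdd_surjective hn
  measurable_smul B := by
    refine measurable_W0_of fun i j => ?_
    show Measurable fun h : POdd n R => ((1 : R) • (h.1.1 * B.1 * h.1.1ᵀ)) i j
    have h1 : Measurable fun h : POdd n R => h.1.1 := measurable_GL_iff.1 measurable_subtype_coe
    simp only [one_smul]
    exact (measurable_matrix_apply i j).comp (measurable_matrix_mul (measurable_matrix_mul h1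
      measurable_const) (measurable_matrix_transpose h1))
  mul_rev s i := torusOddEntry_mul_rev n s i
  smul_apply s u B i j := pointOdd_smul_apply s u B i j
  measurePreserving_ratio := (entryRatio_torusOdd hμ hn).1
  bijective_ratio := (entryRatio_torusOdd hμ hn).2
  prod_ratio s := prod_torusOddEntry hn s

include hμ in
theorem isParabolicChart_even (hn : Even n) (h3 : 3 ≤ n) :
    IsParabolicChart μ (PEven n R) (pointEven n hn) (torusEvenEntry n) (torusEvenMult n) where
  measurable_point := by
    have := measurableMul₂_units (R := R)
    have := measurableInv_units (R := R)
    have hc : Measurable fun s : Fin (n / 2) → Rˣ => torusEvenMult n s :=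
      Finset.measurable_prod _ fun k _ => (measurable_pi_apply k).pow_const _
    have h1 : Measurable fun x : (Fin (n / 2) → Rˣ) × unipGroup n R =>
        (torusEvenSim n hn x.1 * ⟨(x.2.1, 1), by
          refine ⟨?_, x.2.2.2.1, trivial⟩
          show x.2.1.1ᵀ * antidiag n R * x.2.1.1 = (1 : R) • antidiag n R
          rw [one_smul]
          exact x.2.2.1⟩ : lowerSim n R) := by
      refine Measurable.subtype_mk (Measurable.prodMk (measurable_GL_iff.2
        (measurable_diagonal_mul fun i => ?_)) ?_)
      · have h2 : ∀ a : ℕ, Measurable fun s : Fin (n / 2) → Rˣ =>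
            ∏ k : Fin (n / 2), if (k : ℕ) < a then s k else 1 := fun a => by
          refine Finset.measurable_prod _ fun k _ => ?_
          split_ifs
          · exact measurable_pi_apply k
          · exact measurable_const
        unfold torusEvenEntry
        split_ifs
        · exact h2 _
        · exact hc.mul (h2 _).inv
      · exact (hc.comp measurable_fst).mul measurable_const
    exact QuotientGroup.measurable_coe.comp h1
  surjective_point := pointEven_surjective hn h3
  measurable_smul B := by
    have := measurableInv_units (R := R)
    rw [QuotientGroup.measurable_from_quotient]
    refine measurable_W0_of fun i j => ?_
    show Measurable fun h : lowerSim n R => (h.1.2⁻¹).1 * (h.1.1.1 * B.1 * h.1.1.1ᵀ) i j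
    have h1 : Measurable fun h : lowerSim n R => h.1.1.1 :=
      measurable_GL_iff.1 (measurable_fst.comp measurable_subtype_coe)
    have h2 : Measurable fun h : lowerSim n R => (h.1.2⁻¹).1 :=
      measurable_unitsVal.comp (measurable_snd.comp measurable_subtype_coe).inv
    exact h2.mul ((measurable_matrix_apply i j).comp (measurable_matrix_mul (measurable_matrix_mul
      h1 measurable_const) (measurable_matrix_transpose h1)))
  mul_rev s i := torusEvenEntry_mul_rev hn s i
  smul_apply s u B i j := pointEven_smul_apply hn s u B i j
  measurePreserving_ratio := (entryRatio_torusEven hμ hn h3).1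
  bijective_ratio := (entryRatio_torusEven hμ hn h3).2
  prod_ratio s := prod_torusEvenEntry hn s

end Chart

/-! ### Integration over a single orbit -/

section Orbit

variable {n : ℕ} {R : Type*} [NormedCommRing R] [NormMulClass R] [NormOneClass R] [IsDomain R]
  [CharZero R] [ProperSpace R] [MeasurableSpace R] [BorelSpace R]
  {μ : Measure R} [μ.IsAddHaarMeasure] (hμ : IsModulus μ)
  {P : Type*} [Group P] [MeasurableSpace P] [MulAction P (W0 n R)]
  {point : (Fin (n / 2) → Rˣ) × unipGroup n R → P}
  {t : (Fin (n / 2) → Rˣ) → Fin n → Rˣ} {c : (Fin (n / 2) → Rˣ) → Rˣ}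
  (hP : IsParabolicChart μ P point t c)

/-- Unipotent elements do not change the entries next to the anti-diagonal. -/
theorem conj_apply_of_add_eq (u : unipGroup n R) (B : W0 n R) {i j : Fin n}
    (h : (i : ℕ) + j + 2 = n) : (u.1.1 * B.1 * u.1.1ᵀ) i j = B.1 i j := by
  rw [mul_mul_transpose_apply, Fintype.sum_eq_single (i, j)]
  · rw [u.2.2.2, u.2.2.2, one_mul, mul_one]
  · rintro ⟨k, l⟩ hkl
    dsimp only
    rcases lt_or_ge i k with hk | hk
    · rw [u.2.2.1 i k hk, zero_mul, zero_mul]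
    rcases lt_or_ge j l with hl | hl
    · rw [u.2.2.1 j l hl, mul_zero]
    rw [B.2.2 k l, mul_zero, zero_mul]
    have hk' : (k : ℕ) ≤ i := hk
    have hl' : (l : ℕ) ≤ j := hl
    by_contra hcon
    exact hkl (Prod.ext (Fin.ext (by dsimp only; omega)) (Fin.ext (by dsimp only; omega)))

include hP in
theorem IsParabolicChart.smul_apply_rev (s : Fin (n / 2) → Rˣ) (u : unipGroup n R) (B : W0 n R)
    (i j : Fin n) : (point (s, u) • B).1 i j.rev =
      (t s i * (t s j)⁻¹).1 * (u.1.1 * B.1 * u.1.1ᵀ) i j.rev := by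
  rw [hP.smul_apply, ← hP.mul_rev s j]
  congr 2
  rw [mul_inv, mul_left_comm, mul_assoc, inv_mul_cancel, mul_one]

include hP in
theorem IsParabolicChart.inv_smul (h : P) (B : W0 n R) : (h • B).inv = B.inv := by
  obtain ⟨⟨s, u⟩, rfl⟩ := hP.surjective_point h
  exact inv_eq_of_entries (hP.mul_rev s) u (hP.smul_apply s u B)

include hP in
theorem IsParabolicChart.hessMat_smul (s : Fin (n / 2) → Rˣ) (u : unipGroup n R) (B : W0 n R)
    {l : ℕ} (hl : l + 1 < n) : hessMat (point (s, u) • B) l (l + 1) =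
      (natEntry (t s) l * (natEntry (t s) (l + 1))⁻¹).1 * hessMat B l (l + 1) := by
  have h1 := hessMat_fin (point (s, u) • B) ⟨l, by omega⟩ ⟨l + 1, hl⟩
  have h2 := hessMat_fin B ⟨l, by omega⟩ ⟨l + 1, hl⟩
  dsimp only at h1 h2
  rw [h1, h2, hP.smul_apply_rev, conj_apply_of_add_eq, natEntry_of_lt, natEntry_of_lt]
  rw [Fin.val_rev]
  dsimp only
  omega

include hP in
theorem IsParabolicChart.beta_smul (s : Fin (n / 2) → Rˣ) (u : unipGroup n R) (B : W0 n R) :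
    (point (s, u) • B).beta = fun k => (entryRatio t s k).1 * B.beta k :=
  funext fun k => hP.hessMat_smul s u B (by have := k.isLt; omega)

include hP in
theorem IsParabolicChart.side_smul (s : Fin (n / 2) → Rˣ) (u : unipGroup n R) (B : W0 n R)
    (q : unipIndex n) : (point (s, u) • B).side q =
      (t s (unipRow q) * (t s q.1.2)⁻¹).1 * (u.1.1 * B.1 * u.1.1ᵀ) (unipRow q) q.1.2.rev :=
  hP.smul_apply_rev s u B _ _

include hP in
theorem IsParabolicChart.orbitScale_smul (s : Fin (n / 2) → Rˣ) (u : unipGroup n R)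
    (B : W0 n R) : (point (s, u) • B).orbitScale =
      (∏ k, (entryRatio t s k).1 * B.beta k) * ((delta n s).1 *
        ∏ q : unipIndex n, (t s (unipRow q) * (t s q.1.2)⁻¹).1 *
          hessMat B (unipRow q) (unipRow q + 1)) := by
  rw [W0.orbitScale, hP.beta_smul, ← hP.prod_ratio, Units.coe_prod, ← Finset.prod_mul_distrib]
  congr 1
  refine Finset.prod_congr rfl fun q _ => ?_
  have h1 := unipRow_val q
  have h2 := q.1.1.isLt
  rw [hP.hessMat_smul s u B (by omega), ← mul_assoc, ← Units.val_mul, h1,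
    natEntry_fin, natEntry_fin, natEntry_fin]
  congr 2
  rw [mul_comm (t s q.1.2), mul_mul_mul_comm, mul_comm (t s q.1.1)⁻¹, mul_assoc,
    mul_inv_cancel, mul_one]

variable (point) in
/-- The blocks on which `P` acts freely, along the orbit of a matrix. -/
def orbitMap (B : W0 n R) (x : (Fin (n / 2) → Rˣ) × unipGroup n R) :
    (Fin (n / 2) → R) × (unipIndex n → R) :=
  ((point x • B).beta, (point x • B).side)

include hμ hP in
/-- For a fixed element of the torus, the free coordinates of `N` and the side entries of a matrix
in the orbit are triangular functions of each other. -/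
theorem IsParabolicChart.comap_side {B : W0 n R} (hB : ∀ k, B.beta k ≠ 0)
    (s : Fin (n / 2) → Rˣ) :
    MeasurableEmbedding (fun u => (point (s, u) • B).side) ∧
    (Measure.pi fun _ : unipIndex n => μ).comap (fun u => (point (s, u) • B).side) =
      ‖∏ q : unipIndex n, (t s (unipRow q) * (t s q.1.2)⁻¹).1 *
          hessMat B (unipRow q) (unipRow q + 1)‖ₑ •
        (Measure.pi fun _ : unipIndex n => μ).comap (unipCoords n) := by
  have := standardBorelSpace_unipGroup (n := n) (R := R)
  have hne : ∀ q : unipIndex n, hessMat B (unipRow q) (unipRow q + 1) ≠ 0 := by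
    have h := orbitScale_ne_zero hB
    intro q
    exact Finset.prod_ne_zero_iff.1 (right_ne_zero_of_mul h) q (Finset.mem_univ q)
  have hm : Measurable fun u => (point (s, u) • B).side :=
    measurable_side.comp ((hP.measurable_smul B).comp
      (hP.measurable_point.comp measurable_prodMk_left))
  have key := comap_triangular_of_embedding hμ unipRank unipRank_injective
    (a := fun q : unipIndex n => -((t s (unipRow q) * (t s q.1.2)⁻¹).1 *
      hessMat B (unipRow q) (unipRow q + 1)))
    (fun q => neg_ne_zero.2 (mul_ne_zero (Units.ne_zero _) (hne q)))
    (measurableEmbedding_unipCoords (n := n) (R := R)) hm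
    (fun q => measurableSet_range_unipCoords {q' | unipRank q' < unipRank q}) (by
      intro q u u' h
      have h1 := (isUnip_of_mem u).conj_sub_conj (isUnip_of_mem u') B.2.2 q h
      have h2 : B.1 (unipRow q) q.1.1.rev = hessMat B (unipRow q) (unipRow q + 1) := by
        rw [unipRow_val, ← hessMat_fin]
      rw [h2] at h1
      rw [hP.side_smul, hP.side_smul]
      show _ - _ * u.1.1 q.1.1 q.1.2 = _ - _ * u'.1.1 q.1.1 q.1.2
      linear_combination (t s (unipRow q) * (t s q.1.2)⁻¹).1 * h1)
  refine ⟨key.1, key.2.trans ?_⟩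
  simp only [enorm_neg, enorm_finset_prod]

include hP in
theorem IsParabolicChart.measurable_orbitMap (B : W0 n R) : Measurable (orbitMap point B) :=
  (measurable_beta.comp ((hP.measurable_smul B).comp hP.measurable_point)).prodMk
    (measurable_side.comp ((hP.measurable_smul B).comp hP.measurable_point))

include hP in
theorem IsParabolicChart.eq_of_beta_eq {B : W0 n R} (hB : ∀ k, B.beta k ≠ 0)
    {s s' : Fin (n / 2) → Rˣ} {u u' : unipGroup n R}
    (h : (point (s, u) • B).beta = (point (s', u') • B).beta) : s = s' := by
  refine hP.bijective_ratio.1 (funext fun k => Units.ext ?_)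
  rw [hP.beta_smul, hP.beta_smul] at h
  exact mul_right_cancel₀ (hB k) (congrFun h k)

include hμ hP in
theorem IsParabolicChart.measurableEmbedding_orbitMap {B : W0 n R} (hB : ∀ k, B.beta k ≠ 0) :
    MeasurableEmbedding (orbitMap point B) := by
  have := standardBorelSpace_unipGroup (n := n) (R := R)
  have := standardBorelSpace_units (R := R)
  have h1 : StandardBorelSpace (Fin (n / 2) → R) := inferInstance
  have h2 : StandardBorelSpace (unipIndex n → R) := inferInstance
  have h3 : StandardBorelSpace ((Fin (n / 2) → R) × (unipIndex n → R)) := StandardBorelSpace.prod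
  have h4 : StandardBorelSpace (Fin (n / 2) → Rˣ) := inferInstance
  have h5 : StandardBorelSpace ((Fin (n / 2) → Rˣ) × unipGroup n R) := StandardBorelSpace.prod
  have h6 : MeasurableSpace.CountablySeparated ((Fin (n / 2) → R) × (unipIndex n → R)) :=
    MeasurableSpace.countablySeparated_of_separatesPoints
  refine (hP.measurable_orbitMap B).measurableEmbedding ?_
  rintro ⟨s, u⟩ ⟨s', u'⟩ h
  simp only [orbitMap, Prod.mk.injEq] at h
  obtain rfl := hP.eq_of_beta_eq hB h.1
  rw [(hP.comap_side hμ hB s).1.injective h.2]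

include hμ hP in
/-- The image of the measure of `P` under the blocks of coordinates along an orbit. -/
theorem IsParabolicChart.lintegral_orbitMap {B : W0 n R} (hB : ∀ k, B.beta k ≠ 0)
    {g : (Fin (n / 2) → R) × (unipIndex n → R) → ℝ≥0∞} (hg : Measurable g)
    (h0 : ∀ z, z ∉ Set.range (orbitMap point B) → g z = 0) :
    ∫⁻ z, g z ∂((Measure.pi fun _ => μ).prod (Measure.pi fun _ => μ)) =
      ∫⁻ s, ‖(delta n s).1‖ₑ⁻¹ * ∫⁻ u, ‖(point (s, u) • B).orbitScale‖ₑ *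
        g (orbitMap point B (s, u)) ∂(Measure.pi fun _ : unipIndex n => μ).comap (unipCoords n)
        ∂(Measure.pi fun _ => unitMeasure μ) := by
  have hh : Measurable fun b => ∫⁻ v, g (b, v) ∂(Measure.pi fun _ : unipIndex n => μ) :=
    hg.lintegral_prod_right'
  rw [lintegral_prod _ hg.aemeasurable, lintegral_pi_unitMeasure hμ hB hh]
  · have hm : Measurable fun σ : Fin (n / 2) → Rˣ => (∏ k, ‖(σ k).1 * B.beta k‖ₑ) *
        ∫⁻ v, g (fun k => (σ k).1 * B.beta k, v) ∂(Measure.pi fun _ : unipIndex n => μ) := by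
      have h1 : ∀ k, Measurable fun σ : Fin (n / 2) → Rˣ => (σ k).1 * B.beta k := fun k =>
        (measurable_unitsVal.comp (measurable_pi_apply k)).mul_const _
      exact (Finset.measurable_prod _ fun k _ => (h1 k).enorm).mul
        (hh.comp (measurable_pi_lambda _ h1))
    rw [← hP.measurePreserving_ratio.lintegral_comp hm]
    refine lintegral_congr fun s => ?_
    obtain ⟨hemb, hcomap⟩ := hP.comap_side hμ hB s
    have hbeta : ∀ u, (point (s, u) • B).beta = fun k => (entryRatio t s k).1 * B.beta k :=
      fun u => hP.beta_smul s u B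
    rw [lintegral_eq_lintegral_comap hemb, hcomap, lintegral_smul_measure, smul_eq_mul]
    · have hscale : ∀ u, ‖(point (s, u) • B).orbitScale‖ₑ = ‖(point (s, 1) • B).orbitScale‖ₑ :=
        fun u => by rw [hP.orbitScale_smul, hP.orbitScale_smul]
      have horb : ∀ u, orbitMap point B (s, u) =
          (fun k => (entryRatio t s k).1 * B.beta k, (point (s, u) • B).side) := fun u => by
        rw [orbitMap, hbeta]
      simp only [hscale, horb]
      rw [lintegral_const_mul, ← mul_assoc, ← mul_assoc]
      · congr 1
        have h1 := ENNReal.inv_mul_cancel (norm_unit_ne_zero (delta n s))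
          (enorm_unit_ne_top (delta n s))
        rw [hP.orbitScale_smul, enorm_mul, enorm_mul, mul_left_comm, ← mul_assoc _ _ ‖∏ q, _‖ₑ,
          h1, one_mul, enorm_finset_prod, enorm_finset_prod]
      · exact hg.comp (measurable_prodMk_left.comp hemb.measurable)
    · intro v hv
      refine h0 _ ?_
      rintro ⟨⟨s', u'⟩, h⟩
      simp only [orbitMap, Prod.mk.injEq] at h
      obtain rfl := hP.eq_of_beta_eq hB (h.1.trans (hbeta 1).symm)
      exact hv ⟨u', h.2⟩
  · intro b hb
    rw [← lintegral_zero]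
    refine lintegral_congr fun v => h0 _ ?_
    rintro ⟨⟨s, u⟩, h⟩
    simp only [orbitMap, Prod.mk.injEq] at h
    exact hb ⟨entryRatio t s, by rw [← h.1, hP.beta_smul]⟩

end Orbit

/-! ### The sum over the orbits in a fibre -/

section OrbitSum

variable {n : ℕ} {R : Type*} [NormedCommRing R] [NormMulClass R] [NormOneClass R] [IsDomain R]
  [CharZero R] [ProperSpace R] [MeasurableSpace R] [BorelSpace R]
  {μ : Measure R} [μ.IsAddHaarMeasure] (hμ : IsModulus μ)
  {P : Type*} [Group P] [MeasurableSpace P] [MulAction P (W0 n R)]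
  {point : (Fin (n / 2) → Rˣ) × unipGroup n R → P}
  {t : (Fin (n / 2) → Rˣ) → Fin n → Rˣ} {c : (Fin (n / 2) → Rˣ) → Rˣ}
  (hP : IsParabolicChart μ P point t c)

variable (n R) in
/-- The normalization of the Haar measure of `N` with respect to the coordinates. -/
noncomputable def unipWeight : ℝ≥0∞ := if Odd n then (‖(2 : R)‖ₑ ^ (n / 2))⁻¹ else 1

theorem two_pow_ne_zero : ‖(2 : R)‖ₑ ^ (n / 2) ≠ 0 :=
  pow_ne_zero _ (enorm_ne_zero.2 two_ne_zero)

theorem two_pow_ne_top : ‖(2 : R)‖ₑ ^ (n / 2) ≠ ⊤ := ENNReal.pow_ne_top enorm_ne_top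

theorem unipWeight_ne_zero : unipWeight n R ≠ 0 := by
  unfold unipWeight
  split_ifs
  · exact ENNReal.inv_ne_zero.2 two_pow_ne_top
  · exact one_ne_zero

theorem unipWeight_ne_top : unipWeight n R ≠ ⊤ := by
  unfold unipWeight
  split_ifs
  · exact ENNReal.inv_ne_top.2 two_pow_ne_zero
  · exact ENNReal.one_ne_top

theorem measurable_delta : Measurable (delta n : (Fin (n / 2) → Rˣ) → Rˣ) := by
  have := measurableMul₂_units (R := R)
  have := measurableInv_units (R := R)
  unfold delta
  split_ifs
  · exact Finset.measurable_prod _ fun k _ => (measurable_pi_apply k).pow_const _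
  · exact Finset.measurable_prod _ fun k _ => (measurable_pi_apply k).pow_const _

include hP in
/-- The right Haar measure `|δ|⁻¹ du d^×s` of `P` as an iterated integral. -/
theorem IsParabolicChart.lintegral_haar {φ : W0 n R → ℝ≥0∞} (hφ : Measurable φ) (B : W0 n R) :
    ∫⁻ h, φ (h • B) ∂(Measure.map point (coordMeasure n μ)) =
      unipWeight n R * ∫⁻ s, ‖(delta n s).1‖ₑ⁻¹ * ∫⁻ u, φ (point (s, u) • B)
        ∂(Measure.pi fun _ : unipIndex n => μ).comap (unipCoords n)
        ∂(Measure.pi fun _ => unitMeasure μ) := by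
  have hm : Measurable fun h : P => φ (h • B) := hφ.comp (hP.measurable_smul B)
  have hm2 : Measurable fun x => φ (point x • B) := hm.comp hP.measurable_point
  have := sigmaFinite_comap (measurableEmbedding_unipCoords (n := n) (R := R))
    (Measure.pi fun _ : unipIndex n => μ)
  have hδ : Measurable fun s : Fin (n / 2) → Rˣ => ‖(delta n s).1‖ₑ⁻¹ :=
    (measurable_unitsVal.comp measurable_delta).enorm.inv
  rw [lintegral_map hm hP.measurable_point, coordMeasure, unipMeasure]
  have hw : (if Odd n then (‖(2 : R)‖ₑ ^ (n / 2))⁻¹ else 1) = unipWeight n R := rfl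
  rw [hw, lintegral_prod _ hm2.aemeasurable]
  simp only [lintegral_smul_measure, smul_eq_mul]
  have hm3 : Measurable fun s => ∫⁻ u, φ (point (s, u) • B)
      ∂(Measure.pi fun _ : unipIndex n => μ).comap (unipCoords n) := hm2.lintegral_prod_right'
  rw [lintegral_const_mul _ hm3, lintegral_withDensity_eq_lintegral_mul _ hδ hm3]
  rfl

include hP in
theorem IsParabolicChart.beta_smul_ne_zero {B : W0 n R} (hB : ∀ k, B.beta k ≠ 0) (h : P)
    (k : Fin (n / 2)) : (h • B).beta k ≠ 0 := by
  obtain ⟨⟨s, u⟩, rfl⟩ := hP.surjective_point h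
  rw [hP.beta_smul]
  exact mul_ne_zero (Units.ne_zero _) (hB k)

include hP in
theorem IsParabolicChart.invCoeffs_smul (h : P) (B : W0 n R) :
    (h • B).invCoeffs = B.invCoeffs := by
  funext i
  rw [W0.invCoeffs, W0.invCoeffs, hP.inv_smul]

include hμ hP in
/-- The contribution of a single orbit to the integral over a fibre of the invariant. -/
theorem IsParabolicChart.setLIntegral_fiberDensity {φ : W0 n R → ℝ≥0∞} (hφ : Measurable φ)
    {B : W0 n R} (hB : ∀ k, B.beta k ≠ 0) :
    ∫⁻ z in Set.range (orbitMap point B), fiberDensity φ (z, B.invCoeffs)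
      ∂((Measure.pi fun _ => μ).prod (Measure.pi fun _ => μ)) =
    (‖(2 : R)‖ₑ ^ (n / 2) * unipWeight n R)⁻¹ *
      ∫⁻ h, φ (h • B) ∂(Measure.map point (coordMeasure n μ)) := by
  have hrange := (hP.measurableEmbedding_orbitMap hμ hB).measurableSet_range
  have hm : Measurable fun z => fiberDensity φ (z, B.invCoeffs) :=
    (measurable_fiberDensity hφ).comp measurable_prodMk_right
  rw [← lintegral_indicator hrange, hP.lintegral_orbitMap hμ hB (hm.indicator hrange)
    fun z hz => Set.indicator_of_notMem hz _, hP.lintegral_haar hφ]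
  have hpt : ∀ s u, ‖(point (s, u) • B).orbitScale‖ₑ * (Set.range (orbitMap point B)).indicator
      (fun z => fiberDensity φ (z, B.invCoeffs)) (orbitMap point B (s, u)) =
      (‖(2 : R)‖ₑ ^ (n / 2))⁻¹ * φ (point (s, u) • B) := by
    intro s u
    have hreg := hP.beta_smul_ne_zero hB (point (s, u))
    have h1 : ‖(point (s, u) • B).orbitScale‖ₑ ≠ 0 := enorm_ne_zero.2 (orbitScale_ne_zero hreg)
    have h2 := fiberDensity_apply φ hreg
    rw [hP.invCoeffs_smul] at h2
    rw [Set.indicator_of_mem (Set.mem_range_self (s, u)), orbitMap, h2,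
      ENNReal.mul_inv (Or.inl two_pow_ne_zero) (Or.inl two_pow_ne_top)]
    calc _ = (‖(2 : R)‖ₑ ^ (n / 2))⁻¹ * φ (point (s, u) • B) *
          (‖(point (s, u) • B).orbitScale‖ₑ * ‖(point (s, u) • B).orbitScale‖ₑ⁻¹) := by ring
      _ = _ := by rw [ENNReal.mul_inv_cancel h1 enorm_ne_top, mul_one]
  have hm2 : Measurable fun x => φ (point x • B) :=
    (hφ.comp (hP.measurable_smul B)).comp hP.measurable_point
  have := sigmaFinite_comap (measurableEmbedding_unipCoords (n := n) (R := R))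
    (Measure.pi fun _ : unipIndex n => μ)
  have hδ : Measurable fun s : Fin (n / 2) → Rˣ => ‖(delta n s).1‖ₑ⁻¹ :=
    (measurable_unitsVal.comp measurable_delta).enorm.inv
  have hm3 : Measurable fun s => ∫⁻ u, φ (point (s, u) • B)
      ∂(Measure.pi fun _ : unipIndex n => μ).comap (unipCoords n) := hm2.lintegral_prod_right'
  have hm4 : Measurable fun s => ‖(delta n s).1‖ₑ⁻¹ * ∫⁻ u, φ (point (s, u) • B)
      ∂(Measure.pi fun _ : unipIndex n => μ).comap (unipCoords n) := hδ.mul hm3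
  simp only [hpt]
  have hc : ∀ s, ∫⁻ u, (‖(2 : R)‖ₑ ^ (n / 2))⁻¹ * φ (point (s, u) • B)
      ∂(Measure.pi fun _ : unipIndex n => μ).comap (unipCoords n) = (‖(2 : R)‖ₑ ^ (n / 2))⁻¹ *
        ∫⁻ u, φ (point (s, u) • B) ∂(Measure.pi fun _ : unipIndex n => μ).comap (unipCoords n) :=
    fun s => lintegral_const_mul _ (hm2.comp measurable_prodMk_left)
  simp only [hc, mul_left_comm _ (‖(2 : R)‖ₑ ^ (n / 2))⁻¹]
  rw [lintegral_const_mul _ hm4, ENNReal.mul_inv (Or.inl two_pow_ne_zero)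
    (Or.inl two_pow_ne_top), mul_assoc, ← mul_assoc (unipWeight n R)⁻¹,
    ENNReal.inv_mul_cancel unipWeight_ne_zero unipWeight_ne_top, one_mul]

include hμ hP in
theorem IsParabolicChart.measure_range_orbitMap_pos {B : W0 n R} (hB : ∀ k, B.beta k ≠ 0) :
    0 < ((Measure.pi fun _ : Fin (n / 2) => μ).prod (Measure.pi fun _ : unipIndex n => μ))
      (Set.range (orbitMap point B)) := by
  have hrange := (hP.measurableEmbedding_orbitMap hμ hB).measurableSet_range
  have := sigmaFinite_unitMeasure (μ := μ)
  have := sigmaFinite_comap (measurableEmbedding_unipCoords (n := n) (R := R))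
    (Measure.pi fun _ : unipIndex n => μ)
  set ν := (Measure.pi fun _ : unipIndex n => μ).comap (unipCoords n) with hν
  rw [pos_iff_ne_zero]
  intro h0
  rw [← lintegral_indicator_one hrange, hP.lintegral_orbitMap hμ hB
    (measurable_one.indicator hrange) fun z hz => Set.indicator_of_notMem hz _] at h0
  have h1 : ∀ s u, (Set.range (orbitMap point B)).indicator
      (1 : (Fin (n / 2) → R) × (unipIndex n → R) → ℝ≥0∞)
      (orbitMap point B (s, u)) = 1 := fun s u => Set.indicator_of_mem (Set.mem_range_self (s, u)) _
  have h2 : ∀ s u, ‖(point (s, u) • B).orbitScale‖ₑ = ‖(point (s, 1) • B).orbitScale‖ₑ :=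
    fun s u => by rw [hP.orbitScale_smul, hP.orbitScale_smul]
  simp only [h1, mul_one, h2, lintegral_const] at h0
  have h3 : ν Set.univ ≠ 0 := by
    have h4 := (measurableEmbedding_unipCoords (n := n) (R := R)).comap_apply
      (Measure.pi fun _ : unipIndex n => μ) Set.univ
    rw [Set.image_univ] at h4
    rw [hν, h4]
    exact measure_range_unipCoords_ne_zero hμ
  have hm : Measurable fun s => ‖(delta n s).1‖ₑ⁻¹ *
      (‖(point (s, 1) • B).orbitScale‖ₑ * ν Set.univ) := by
    refine (measurable_unitsVal.comp measurable_delta).enorm.inv.mul (Measurable.mul_const ?_ _)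
    exact (measurable_orbitScale.comp ((hP.measurable_smul B).comp
      (hP.measurable_point.comp measurable_prodMk_right))).enorm
  rw [lintegral_eq_zero_iff hm] at h0
  have h5 : (Measure.pi fun _ : Fin (n / 2) => unitMeasure μ) = 0 := by
    rw [← Measure.measure_univ_eq_zero]
    refine measure_mono_null ?_ (ae_iff.1 h0)
    intro s _
    refine mul_ne_zero (ENNReal.inv_ne_zero.2 (enorm_unit_ne_top _)) (mul_ne_zero ?_ h3)
    exact enorm_ne_zero.2 (orbitScale_ne_zero (hP.beta_smul_ne_zero hB _))
  have h6 : (Measure.pi fun _ : Fin (n / 2) => unitMeasure μ) Set.univ ≠ 0 := by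
    rw [Measure.pi_univ, Finset.prod_ne_zero_iff]
    intro _ _
    rw [Ne, Measure.measure_univ_eq_zero]
    exact unitMeasure_ne_zero
  exact h6 (by rw [h5]; rfl)

theorem beta_ne_zero_of_discr_ne_zero {B : W0 n R} (h : B.inv.discr ≠ 0) (k : Fin (n / 2)) :
    B.beta k ≠ 0 := fun h0 => h (discr_inv_eq_zero B (by have := k.isLt; omega) h0)

theorem mem_orbit_out (ω : MulAction.orbitRel.Quotient P (W0 n R)) :
    Quotient.out ω ∈ ω.orbit := by
  rw [MulAction.orbitRel.Quotient.mem_orbit]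
  exact Quotient.out_eq' ω

include hμ hP in
/-- The orbits in a fibre of the invariant with nonzero discriminant correspond to disjoint sets
of positive measure; hence there are countably many. -/
theorem IsParabolicChart.lintegral_fiberDensity {φ : W0 n R → ℝ≥0∞} (hφ : Measurable φ)
    {f : Fin n → R} (hf : (monicPoly f).discr ≠ 0) :
    Countable (fiberOrbits n P (monicPoly f)) ∧
    ∫⁻ z, fiberDensity φ (z, f) ∂((Measure.pi fun _ => μ).prod (Measure.pi fun _ => μ)) =
    (‖(2 : R)‖ₑ ^ (n / 2) * unipWeight n R)⁻¹ * ∑' ω : fiberOrbits n P (monicPoly f),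
      ∫⁻ h, φ (h • Quotient.out ω.1) ∂(Measure.map point (coordMeasure n μ)) := by
  let B : fiberOrbits n P (monicPoly f) → W0 n R := fun ω => Quotient.out ω.1
  have hBinv : ∀ ω, (B ω).inv = monicPoly f := fun ω => ω.2 _ (mem_orbit_out ω.1)
  have hBreg : ∀ ω k, (B ω).beta k ≠ 0 := fun ω =>
    beta_ne_zero_of_discr_ne_zero (by rw [hBinv]; exact hf)
  have hBc : ∀ ω, (B ω).invCoeffs = f := fun ω => (inv_eq_monicPoly_iff _ _).1 (hBinv ω)
  let S : fiberOrbits n P (monicPoly f) → Set ((Fin (n / 2) → R) × (unipIndex n → R)) :=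
    fun ω => Set.range (orbitMap point (B ω))
  have hSm : ∀ ω, MeasurableSet (S ω) := fun ω =>
    (hP.measurableEmbedding_orbitMap hμ (hBreg ω)).measurableSet_range
  have hSd : Pairwise (Function.onFun Disjoint S) := by
    intro ω ω' hne
    rw [Function.onFun, Set.disjoint_left]
    rintro _ ⟨x, rfl⟩ ⟨x', h⟩
    refine hne (Subtype.ext ?_)
    simp only [orbitMap, Prod.mk.injEq] at h
    have h1 : point x' • B ω' = point x • B ω :=
      eq_of_beta_side_invCoeffs (hP.beta_smul_ne_zero (hBreg ω') _) h.1 h.2 (by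
        rw [hP.invCoeffs_smul, hP.invCoeffs_smul, hBc, hBc])
    rw [← Quotient.out_eq' ω.1, ← Quotient.out_eq' ω'.1, Quotient.eq'']
    refine MulAction.orbitRel_apply.2 ?_
    refine ⟨(point x)⁻¹ * point x', ?_⟩
    show ((point x)⁻¹ * point x') • B ω' = B ω
    rw [mul_smul, h1, inv_smul_smul]
  have hcount : Countable (fiberOrbits n P (monicPoly f)) := by
    have h1 := Measure.countable_meas_pos_of_disjoint_iUnion
      (μ := (Measure.pi fun _ : Fin (n / 2) => μ).prod (Measure.pi fun _ : unipIndex n => μ))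
      hSm hSd
    refine Set.countable_univ_iff.1 (h1.mono fun ω _ => ?_)
    exact hP.measure_range_orbitMap_pos hμ (hBreg ω)
  refine ⟨hcount, ?_⟩
  have hoff : ∀ z, z ∉ ⋃ ω, S ω → fiberDensity φ (z, f) = 0 := by
    intro z hz
    refine fiberDensity_eq_zero φ fun B' hB' h => hz ?_
    simp only [Prod.mk.injEq] at h
    have hinv : B'.inv = monicPoly f := (inv_eq_monicPoly_iff _ _).2 h.2
    let ω : fiberOrbits n P (monicPoly f) := ⟨Quotient.mk'' B', fun B'' hB'' => by
      rw [MulAction.orbitRel.Quotient.mem_orbit, Quotient.eq''] at hB''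
      obtain ⟨h, rfl⟩ := MulAction.orbitRel_apply.1 hB''
      rw [← hinv]
      exact hP.inv_smul h B'⟩
    have hω : (Quotient.mk'' (Quotient.out ω.1) : MulAction.orbitRel.Quotient P (W0 n R)) =
        Quotient.mk'' B' := Quotient.out_eq' ω.1
    rw [Quotient.eq''] at hω
    obtain ⟨p, hp⟩ := MulAction.orbitRel_apply.1 hω
    obtain ⟨x, hx⟩ := hP.surjective_point p⁻¹
    refine Set.mem_iUnion.2 ⟨ω, x, ?_⟩
    have h2 : point x • B ω = B' := by
      rw [hx]
      show p⁻¹ • Quotient.out ω.1 = B'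
      rw [← hp]
      exact inv_smul_smul p B'
    rw [orbitMap, h2, ← h.1]
  have h1 : ∫⁻ z, fiberDensity φ (z, f) ∂((Measure.pi fun _ => μ).prod (Measure.pi fun _ => μ)) =
      ∫⁻ z in ⋃ ω, S ω, fiberDensity φ (z, f)
        ∂((Measure.pi fun _ => μ).prod (Measure.pi fun _ => μ)) := by
    rw [← lintegral_indicator (MeasurableSet.iUnion hSm)]
    refine lintegral_congr fun z => ?_
    by_cases hz : z ∈ ⋃ ω, S ω
    · rw [Set.indicator_of_mem hz]
    · rw [Set.indicator_of_notMem hz, hoff z hz]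
  rw [h1, lintegral_iUnion hSm hSd, ← ENNReal.tsum_mul_left]
  refine tsum_congr fun ω => ?_
  have h2 := hP.setLIntegral_fiberDensity hμ hφ (hBreg ω)
  rw [hBc] at h2
  exact h2

end OrbitSum

/-! ### The change-of-variables formula -/

section RealValued

theorem integrable_of_lintegral_ofReal {X : Type*} [MeasurableSpace X] {ν : Measure X} {f : X → ℝ}
    (hf : Measurable f) (h1 : ∫⁻ x, ENNReal.ofReal (f x) ∂ν ≠ ⊤)
    (h2 : ∫⁻ x, ENNReal.ofReal (-f x) ∂ν ≠ ⊤) :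
    Integrable f ν ∧ ∫ x, f x ∂ν = (∫⁻ x, ENNReal.ofReal (f x) ∂ν).toReal -
      (∫⁻ x, ENNReal.ofReal (-f x) ∂ν).toReal := by
  have h3 : Integrable f ν := by
    refine ⟨hf.aestronglyMeasurable, ?_⟩
    have h4 : ∀ x, ‖f x‖ₑ = ENNReal.ofReal (f x) + ENNReal.ofReal (-f x) := fun x => by
      rw [Real.enorm_eq_ofReal_abs]
      rcases le_total 0 (f x) with h | h
      · rw [abs_of_nonneg h, ENNReal.ofReal_of_nonpos (neg_nonpos.2 h), add_zero]
      · rw [abs_of_nonpos h, ENNReal.ofReal_of_nonpos h, zero_add]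
    rw [HasFiniteIntegral, lintegral_congr h4, lintegral_add_left hf.ennreal_ofReal]
    exact ENNReal.add_lt_top.2 ⟨h1.lt_top, h2.lt_top⟩
  exact ⟨h3, integral_eq_lintegral_pos_part_sub_lintegral_neg_part h3⟩

end RealValued

section Formula

variable {n : ℕ} {R : Type*} [NormedCommRing R] [NormMulClass R] [NormOneClass R] [IsDomain R]
  [CharZero R] [ProperSpace R] [MeasurableSpace R] [BorelSpace R]
  {μ : Measure R} [μ.IsAddHaarMeasure] [NullSingletonClass μ] (hμ : IsModulus μ)
  {P : Type*} [Group P] [MeasurableSpace P] [MulAction P (W0 n R)]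
  {point : (Fin (n / 2) → Rˣ) × unipGroup n R → P}
  {t : (Fin (n / 2) → Rˣ) → Fin n → Rˣ} {c : (Fin (n / 2) → Rˣ) → Rˣ}
  (hP : IsParabolicChart μ P point t c)

theorem ae_discr_ne_zero (hn : 0 < n) :
    ∀ᵐ f : Fin n → R ∂(Measure.pi fun _ => μ), (monicPoly f).discr ≠ 0 := by
  rw [ae_iff]
  simp only [not_not]
  exact measure_discr_eq_zero hn

include hμ hP in
/-- The constant is the inverse of `|2|^m`, from the Jacobian of the invariants, times the
normalization of the measure of `N`. For real-valued functions the formula follows from that for the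
positive and negative parts, whose integrals are finite. -/
theorem IsParabolicChart.changeOfVariables (hn : 0 < n) {j : ℝ} (hj0 : 0 < j)
    (hj : ENNReal.ofReal j = (‖(2 : R)‖ₑ ^ (n / 2) * unipWeight n R)⁻¹) :
    ChangeOfVariables n μ P (Measure.map point (coordMeasure n μ)) j := by
  have hrestr : (Measure.pi fun _ : Fin n => μ).restrict
      {f : Fin n → R | (monicPoly f).discr ≠ 0} = Measure.pi fun _ => μ :=
    Measure.restrict_eq_self_of_ae_mem (ae_discr_ne_zero hn)
  have hk0 : ENNReal.ofReal j ≠ 0 := (ENNReal.ofReal_pos.2 hj0).ne'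
  -- the integral over a fibre
  let G : (W0 n R → ℝ≥0∞) → (Fin n → R) → ℝ≥0∞ := fun φ f =>
    ∫⁻ z, fiberDensity φ (z, f) ∂((Measure.pi fun _ => μ).prod (Measure.pi fun _ => μ))
  have hGm : ∀ {φ}, Measurable φ → Measurable (G φ) := fun hφ =>
    (measurable_fiberDensity hφ).lintegral_prod_left'
  have hG : ∀ {φ : W0 n R → ℝ≥0∞} (hφ : Measurable φ) {f : Fin n → R},
      (monicPoly f).discr ≠ 0 → G φ f = ENNReal.ofReal j *
        ∑' ω : fiberOrbits n P (monicPoly f),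
          ∫⁻ h, φ (h • Quotient.out ω.1) ∂(Measure.map point (coordMeasure n μ)) := by
    intro φ hφ f hf
    rw [hj]
    exact (hP.lintegral_fiberDensity hμ hφ hf).2
  have htot : ∀ {φ : W0 n R → ℝ≥0∞} (hφ : Measurable φ),
      ∫⁻ B, φ B * ‖B.lam‖ₑ ∂(W0.measure n μ) = ∫⁻ f, G φ f ∂(Measure.pi fun _ => μ) :=
    fun hφ => lintegral_mul_lam hμ hφ
  refine ⟨fun φ hφ => ?_, fun φ hφ hint => ?_⟩
  · rw [htot hφ, hrestr, ← lintegral_const_mul' _ _ ENNReal.ofReal_ne_top]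
    exact lintegral_congr_ae ((ae_discr_ne_zero hn).mono fun f hf => hG hφ hf)
  · have hφp : Measurable fun B => ENNReal.ofReal (φ B) := hφ.ennreal_ofReal
    have hφm : Measurable fun B => ENNReal.ofReal (-φ B) := hφ.neg.ennreal_ofReal
    have hp : ∀ B : W0 n R, ENNReal.ofReal (φ B * ‖B.lam‖) =
        ENNReal.ofReal (φ B) * ‖B.lam‖ₑ := fun B => by
      rw [ENNReal.ofReal_mul' (norm_nonneg _), ofReal_norm]
    have hm : ∀ B : W0 n R, ENNReal.ofReal (-(φ B * ‖B.lam‖)) =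
        ENNReal.ofReal (-φ B) * ‖B.lam‖ₑ := fun B => by
      rw [← neg_mul, ENNReal.ofReal_mul' (norm_nonneg _), ofReal_norm]
    have hpt : ∫⁻ f, G (fun B => ENNReal.ofReal (φ B)) f ∂(Measure.pi fun _ => μ) ≠ ⊤ := by
      rw [← htot hφp, ← lintegral_congr hp]
      exact hint.lintegral_lt_top.ne
    have hmt : ∫⁻ f, G (fun B => ENNReal.ofReal (-φ B)) f ∂(Measure.pi fun _ => μ) ≠ ⊤ := by
      rw [← htot hφm, ← lintegral_congr hm]
      exact hint.neg.lintegral_lt_top.ne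
    have hF : (fun f : Fin n → R => ∑' ω : fiberOrbits n P (monicPoly f),
        ∫ h, φ (h • Quotient.out ω.1) ∂(Measure.map point (coordMeasure n μ))) =ᵐ[
          Measure.pi fun _ => μ] fun f => j⁻¹ * ((G (fun B => ENNReal.ofReal (φ B)) f).toReal -
            (G (fun B => ENNReal.ofReal (-φ B)) f).toReal) := by
      filter_upwards [ae_discr_ne_zero hn, ae_lt_top (hGm hφp) hpt, ae_lt_top (hGm hφm) hmt]
        with f hf h1 h2
      rw [hG hφp hf] at h1 ⊢
      rw [hG hφm hf] at h2 ⊢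
      have h1' := (ENNReal.lt_top_of_mul_ne_top_right h1.ne hk0).ne
      have h2' := (ENNReal.lt_top_of_mul_ne_top_right h2.ne hk0).ne
      have h3 : ∀ ω : fiberOrbits n P (monicPoly f), ∫ h, φ (h • Quotient.out ω.1)
          ∂(Measure.map point (coordMeasure n μ)) =
          (∫⁻ h, ENNReal.ofReal (φ (h • Quotient.out ω.1))
            ∂(Measure.map point (coordMeasure n μ))).toReal -
          (∫⁻ h, ENNReal.ofReal (-φ (h • Quotient.out ω.1))
            ∂(Measure.map point (coordMeasure n μ))).toReal := fun ω =>
        (integrable_of_lintegral_ofReal (hφ.comp (hP.measurable_smul (Quotient.out ω.1)))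
          (ENNReal.ne_top_of_tsum_ne_top h1' ω) (ENNReal.ne_top_of_tsum_ne_top h2' ω)).2
      rw [tsum_congr h3, (ENNReal.summable_toReal h1').tsum_sub (ENNReal.summable_toReal h2'),
        ← ENNReal.tsum_toReal_eq (ENNReal.ne_top_of_tsum_ne_top h1'),
        ← ENNReal.tsum_toReal_eq (ENNReal.ne_top_of_tsum_ne_top h2'),
        ENNReal.toReal_mul, ENNReal.toReal_mul, ENNReal.toReal_ofReal hj0.le, ← mul_sub,
        inv_mul_cancel_left₀ hj0.ne']
    have hpi : Integrable (fun f => (G (fun B => ENNReal.ofReal (φ B)) f).toReal)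
        (Measure.pi fun _ => μ) := integrable_toReal_of_lintegral_ne_top (hGm hφp).aemeasurable hpt
    have hmi : Integrable (fun f => (G (fun B => ENNReal.ofReal (-φ B)) f).toReal)
        (Measure.pi fun _ => μ) := integrable_toReal_of_lintegral_ne_top (hGm hφm).aemeasurable hmt
    rw [IntegrableOn, hrestr]
    refine ⟨((hpi.sub hmi).const_mul j⁻¹).congr hF.symm, ?_⟩
    rw [integral_congr_ae hF, integral_const_mul, integral_sub hpi hmi,
      mul_inv_cancel_left₀ hj0.ne',
      integral_toReal (hGm hφp).aemeasurable (ae_lt_top (hGm hφp) hpt),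
      integral_toReal (hGm hφm).aemeasurable (ae_lt_top (hGm hφm) hmt), ← htot hφp, ← htot hφm,
      ← lintegral_congr hp, ← lintegral_congr hm]
    exact integral_eq_lintegral_pos_part_sub_lintegral_neg_part hint

theorem measure_regular_ne_zero : W0.measure n μ {B : W0 n R | ∀ k, B.beta k ≠ 0} ≠ 0 := by
  have hmp := measurePreserving_ofBlocks (n := n) (μ := μ)
  rw [← hmp.measure_preimage measurableSet_regular.nullMeasurableSet]
  have h1 : (fun z : ((Fin (n / 2) → R) × (unipIndex n → R)) × (Fin n → R) =>
      W0.ofBlocks z.1.1 z.1.2 z.2) ⁻¹' {B : W0 n R | ∀ k, B.beta k ≠ 0} =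
      ({b : Fin (n / 2) → R | ∀ k, b k ≠ 0} ×ˢ Set.univ) ×ˢ Set.univ := by
    ext z
    simp only [Set.mem_preimage, Set.mem_ofPred_eq, beta_ofBlocks, Set.mem_prod, Set.mem_univ,
      and_true]
  have h2 : (Measure.pi fun _ : Fin (n / 2) => μ) {b | ∀ k, b k ≠ 0} ≠ 0 := by
    have h3 : ∀ᵐ b : Fin (n / 2) → R ∂(Measure.pi fun _ => μ), ∀ k, b k ≠ 0 :=
      ae_all_iff.2 fun k => Measure.ae_eval_ne (fun _ : Fin (n / 2) => μ) k 0
    have h4 : (Measure.pi fun _ : Fin (n / 2) => μ) {b | ∀ k, b k ≠ 0} =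
        (Measure.pi fun _ => μ) Set.univ := measure_congr (Filter.eventuallyEq_univ.2 h3)
    rw [h4, Measure.pi_univ]
    exact Finset.prod_ne_zero_iff.2 fun _ _ => (isOpen_univ.measure_pos μ Set.univ_nonempty).ne'
  rw [h1, Measure.prod_prod, Measure.prod_prod, Measure.pi_univ, Measure.pi_univ]
  refine mul_ne_zero (mul_ne_zero h2 ?_) ?_ <;>
  exact Finset.prod_ne_zero_iff.2 fun _ _ => (isOpen_univ.measure_pos μ Set.univ_nonempty).ne'

theorem sigmaFinite_W0_measure : SigmaFinite (W0.measure n μ) :=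
  (W0.coordsEquiv (n := n) (R := R)).symm.sigmaFinite_map

/-- The formula for the test function `1_K / |λ|`, with `K` of finite positive measure, determines
the constant. -/
theorem ChangeOfVariables.ofReal_eq {dh : Measure P} {j j' : ℝ}
    (h : ChangeOfVariables n μ P dh j) (h' : ChangeOfVariables n μ P dh j') :
    ENNReal.ofReal j = ENNReal.ofReal j' := by
  have := sigmaFinite_W0_measure (n := n) (μ := μ)
  obtain ⟨K, hKm, hKs, hK0, hKt⟩ := Measure.exists_subset_measure_lt_top
    (μ := W0.measure n μ) (measurableSet_regular (n := n) (R := R))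
    (pos_iff_ne_zero.2 measure_regular_ne_zero)
  let φ : W0 n R → ℝ≥0∞ := K.indicator fun B => ‖B.lam‖ₑ⁻¹
  have hφ : Measurable φ := (measurable_lam.enorm.inv).indicator hKm
  have hV : ∫⁻ B, φ B * ‖B.lam‖ₑ ∂(W0.measure n μ) = W0.measure n μ K := by
    rw [← lintegral_indicator_one hKm]
    refine lintegral_congr fun B => ?_
    by_cases hB : B ∈ K
    · simp only [φ, Set.indicator_of_mem hB]
      exact ENNReal.inv_mul_cancel (enorm_ne_zero.2 (lam_ne_zero (hKs hB))) enorm_ne_top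
    · simp only [φ, Set.indicator_of_notMem hB, zero_mul]
  have h1 := h.1 φ hφ
  have h2 := h'.1 φ hφ
  rw [hV] at h1 h2
  set X := ∫⁻ f in {f : Fin n → R | (monicPoly f).discr ≠ 0},
    (∑' ω : fiberOrbits n P (monicPoly f), ∫⁻ h, φ (h • Quotient.out ω.1) ∂dh)
      ∂(Measure.pi fun _ => μ)
  have hX0 : X ≠ 0 := fun h0 => hK0.ne' (by rw [h1, h0, mul_zero])
  have hXt : X ≠ ⊤ := by
    intro ht
    rw [ht] at h1
    by_cases hj : ENNReal.ofReal j = 0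
    · rw [hj, zero_mul] at h1
      exact hK0.ne' h1
    · rw [ENNReal.mul_top hj] at h1
      exact hKt.ne h1
  exact (ENNReal.mul_left_inj hX0 hXt).1 (h1.symm.trans h2)

end Formula

/-! ### The constant -/

section Constant

variable {n : ℕ} {R : Type*} [NormedCommRing R] [NormMulClass R] [NormOneClass R] [IsDomain R]
  [CharZero R] [ProperSpace R] [MeasurableSpace R] [BorelSpace R]
  {μ : Measure R} [μ.IsAddHaarMeasure] [NullSingletonClass μ] (hμ : IsModulus μ)

variable (n R) in
/-- The absolute value of the Jacobian constant over `R`. -/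
noncomputable def jacobianNorm : ℝ := if Odd n then 1 else (‖(2 : R)‖ ^ (n / 2))⁻¹

theorem jacobianNorm_pos : 0 < jacobianNorm n R := by
  unfold jacobianNorm
  split_ifs
  · exact one_pos
  · exact inv_pos.2 (pow_pos (norm_pos_iff.2 two_ne_zero) _)

theorem ofReal_jacobianNorm :
    ENNReal.ofReal (jacobianNorm n R) = (‖(2 : R)‖ₑ ^ (n / 2) * unipWeight n R)⁻¹ := by
  unfold jacobianNorm unipWeight
  split_ifs
  · rw [ENNReal.mul_inv_cancel two_pow_ne_zero two_pow_ne_top, ENNReal.ofReal_one, inv_one]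
  · rw [mul_one, ENNReal.ofReal_inv_of_pos (pow_pos (norm_pos_iff.2 two_ne_zero) _),
      ENNReal.ofReal_pow (norm_nonneg _), ofReal_norm]

include hμ in
theorem jacobianFormula_jacobianNorm (h3 : 3 ≤ n) : JacobianFormula n μ (jacobianNorm n R) :=
  ⟨fun hn => (isParabolicChart_odd hμ hn).changeOfVariables hμ (by omega) jacobianNorm_pos
      ofReal_jacobianNorm,
    fun hn => (isParabolicChart_even hμ hn h3).changeOfVariables hμ (by omega) jacobianNorm_pos
      ofReal_jacobianNorm⟩

include hμ in
/-- The formula over `R` alone determines its constant. -/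
theorem JacobianFormula.eq_jacobianNorm (h3 : 3 ≤ n) {j : ℝ} (hj : 0 ≤ j)
    (h : JacobianFormula n μ j) : j = jacobianNorm n R := by
  have h0 := jacobianFormula_jacobianNorm (n := n) hμ h3
  have h1 : ENNReal.ofReal j = ENNReal.ofReal (jacobianNorm n R) := by
    rcases Nat.even_or_odd n with hn | hn
    · exact (h.2 hn).ofReal_eq (h0.2 hn)
    · exact (h.1 hn).ofReal_eq (h0.1 hn)
  exact (ENNReal.ofReal_eq_ofReal_iff hj jacobianNorm_pos.le).1 h1

end Constant

/-! ### The real numbers and the `p`-adic integers -/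

open scoped Pointwise in
theorem isModulus_volume_real : IsModulus (volume : Measure ℝ) := by
  intro a _ s _
  have h : ((a * ·) '' s) = a • s := by
    ext x
    simp [Set.mem_smul_set]
  rw [h, Measure.addHaar_smul, Module.finrank_self, pow_one, Real.enorm_eq_ofReal_abs]

section Padic

variable (p : ℕ) [Fact p.Prime]

instance instIsAddHaarMeasurePadicMeasure : (padicMeasure p).IsAddHaarMeasure :=
  Measure.isAddHaarMeasure_addHaarMeasure _

theorem padicMeasure_univ : padicMeasure p Set.univ = 1 := by
  have h := Measure.addHaarMeasure_self (G := ℤ_[p])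
    (K₀ := (⊤ : TopologicalSpace.PositiveCompacts ℤ_[p]))
  simpa [padicMeasure] using h

instance instIsFiniteMeasurePadicMeasure : IsFiniteMeasure (padicMeasure p) :=
  ⟨by simp [padicMeasure_univ]⟩

variable {p}

theorem range_padicInt_mul_left {a : ℤ_[p]} (ha : a ≠ 0) :
    Set.range (a * ·) =
      ((PadicInt.toZModPow (p := p) a.valuation).toAddMonoidHom.ker : Set ℤ_[p]) := by
  have h : (RingHom.ker (PadicInt.toZModPow (p := p) a.valuation)) = Ideal.span {a} := by
    rw [PadicInt.ker_toZModPow]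
    refine Ideal.span_singleton_eq_span_singleton.2 ?_
    refine ⟨PadicInt.unitCoeff ha, ?_⟩
    rw [mul_comm]
    exact (PadicInt.unitCoeff_spec ha).symm
  ext x
  have h' : x ∈ RingHom.ker (PadicInt.toZModPow (p := p) a.valuation) ↔ x ∈ Ideal.span {a} := by
    rw [h]
  rw [Ideal.mem_span_singleton] at h'
  constructor
  · rintro ⟨y, rfl⟩
    exact h'.2 ⟨y, rfl⟩
  · intro hx
    obtain ⟨y, rfl⟩ := h'.1 hx
    exact ⟨y, rfl⟩

/-- The ideal `a ℤ_p` has measure `|a|_p`, since its index is `|a|_p⁻¹`. -/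
theorem padicMeasure_range_mul_left {a : ℤ_[p]} (ha : a ≠ 0) :
    padicMeasure p (Set.range (a * ·)) = ‖a‖ₑ := by
  set k := a.valuation with hk
  set H := (PadicInt.toZModPow (p := p) k).toAddMonoidHom.ker with hH
  have hp : 0 < p := (Fact.out : p.Prime).pos
  have hindex : H.index = p ^ k := by
    rw [hH, AddSubgroup.index_ker, AddMonoidHom.range_eq_top_of_surjective _
      (ZMod.ringHom_surjective (PadicInt.toZModPow (p := p) k))]
    simp
  have : H.FiniteIndex := ⟨by rw [hindex]; positivity⟩
  have hrange : Set.range (a * ·) = (H : Set ℤ_[p]) := range_padicInt_mul_left ha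
  have hmeas : MeasurableSet (H : Set ℤ_[p]) := by
    rw [← hrange]
    exact (isCompact_range (continuous_const_mul a)).isClosed.measurableSet
  have h := AddSubgroup.index_mul_measure H hmeas (padicMeasure p)
  rw [padicMeasure_univ, hindex] at h
  have hinv : padicMeasure p (H : Set ℤ_[p]) = (((p ^ k : ℕ) : ℝ≥0∞))⁻¹ :=
    ENNReal.eq_inv_of_mul_eq_one_left (by rw [mul_comm]; exact h)
  rw [hrange, hinv, ← ofReal_norm,
    PadicInt.norm_eq_zpow_neg_valuation ha, ← hk, _root_.zpow_neg, zpow_natCast,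
    ENNReal.ofReal_inv_of_pos (by positivity), ENNReal.ofReal_pow (by positivity)]
  simp

/-- The pullback of the Haar measure along multiplication by `a` is invariant under translation,
hence a multiple of the Haar measure; the factor is read off on the whole of `ℤ_p`. -/
theorem isModulus_padicMeasure : IsModulus (padicMeasure p) := by
  intro a ha s hs
  have hemb : MeasurableEmbedding (a * · : ℤ_[p] → ℤ_[p]) :=
    ((continuous_const_mul a).isClosedEmbedding
      (mul_right_injective₀ ha)).measurableEmbedding
  set ν := (padicMeasure p).comap (a * ·) with hν
  have happly (t : Set ℤ_[p]) : ν t = padicMeasure p ((a * ·) '' t) := hemb.comap_apply _ _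
  have : IsFiniteMeasure ν := ⟨by rw [happly]; exact measure_lt_top _ _⟩
  have : ν.IsAddLeftInvariant := by
    refine ⟨fun b => ?_⟩
    ext t ht
    rw [Measure.map_apply (measurable_const_add b) ht, happly, happly]
    have : (a * ·) '' ((b + ·) ⁻¹' t) = (a * b + ·) ⁻¹' ((a * ·) '' t) := by
      ext x
      constructor
      · rintro ⟨y, hy, rfl⟩
        exact ⟨b + y, hy, mul_add a b y⟩
      · rintro ⟨y, hy, hxy⟩
        refine ⟨y - b, by simpa using hy, ?_⟩
        simp only at hxy ⊢
        rw [mul_sub, hxy]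
        ring
    rw [this, measure_preimage_add]
  have h := Measure.addHaarMeasure_unique ν (⊤ : TopologicalSpace.PositiveCompacts ℤ_[p])
  have htop : ν ((⊤ : TopologicalSpace.PositiveCompacts ℤ_[p]) : Set ℤ_[p]) = ‖a‖ₑ := by
    rw [happly, TopologicalSpace.PositiveCompacts.coe_top, Set.image_univ,
      padicMeasure_range_mul_left ha]
  rw [htop] at h
  rw [← happly, h, Measure.smul_apply, smul_eq_mul]
  rfl

instance instNullSingletonClassPadicMeasure : NullSingletonClass (padicMeasure p) := by
  refine ⟨fun x => ?_⟩
  have hp0 : (p : ℤ_[p]) ≠ 0 := by exact_mod_cast (Fact.out : p.Prime).ne_zero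
  have h0 : padicMeasure p {0} = 0 := by
    by_contra hne
    have h := isModulus_padicMeasure (p : ℤ_[p]) hp0 {0} (measurableSet_singleton 0)
    have hlt : ‖(p : ℤ_[p])‖ₑ < 1 := by
      rw [← ofReal_norm, ENNReal.ofReal_lt_one]
      rw [PadicInt.norm_p]
      exact inv_lt_one_of_one_lt₀ (by exact_mod_cast (Fact.out : p.Prime).one_lt)
    have h2 : ‖(p : ℤ_[p])‖ₑ * padicMeasure p {0} < 1 * padicMeasure p {0} :=
      ENNReal.mul_lt_mul_left hne (measure_ne_top _ _) hlt
    rw [← h] at h2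
    simp at h2
  have h := measure_preimage_add (padicMeasure p) (-x) {0}
  rw [h0] at h
  convert h using 2
  ext y
  simp [eq_comm]

theorem jacobianNorm_padicInt (n : ℕ) :
    jacobianNorm n ℤ_[p] = ‖(jacobianValue n : ℚ_[p])‖ := by
  unfold jacobianNorm jacobianValue
  split_ifs
  · simp
  · have h2 : ‖(2 : ℤ_[p])‖ = ‖(2 : ℚ_[p])‖ := PadicInt.norm_def
    rw [h2]
    simp

end Padic

theorem jacobianValue_pos (n : ℕ) : 0 < jacobianValue n := by
  unfold jacobianValue
  split_ifs <;> positivity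

theorem jacobianNorm_real (n : ℕ) : jacobianNorm n ℝ = |(jacobianValue n : ℝ)| := by
  rw [abs_of_pos (by exact_mod_cast jacobianValue_pos n)]
  unfold jacobianNorm jacobianValue
  split_ifs <;> simp

end OrbitJacobian

theorem mainTheorem9 (n : ℕ) (hn : 3 ≤ n) :
    (∃ J : ℚ, OrbitJacobian.IsJacobianConstant n J) ∧
    (∀ J : ℚ, OrbitJacobian.IsJacobianConstant n J →
      |J| = OrbitJacobian.jacobianValue n) ∧
    (∀ J : ℚ, OrbitJacobian.JacobianFormula n (MeasureTheory.volume : MeasureTheory.Measure ℝ)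
        |(J : ℝ)| →
      |J| = OrbitJacobian.jacobianValue n) ∧
    (∀ (p : ℕ) [Fact p.Prime] (J : ℚ),
      OrbitJacobian.JacobianFormula n (OrbitJacobian.padicMeasure p) ‖(J : ℚ_[p])‖ →
      ‖(J : ℚ_[p])‖ = ‖(OrbitJacobian.jacobianValue n : ℚ_[p])‖) := by
  have hreal (J : ℚ) (h : OrbitJacobian.JacobianFormula n
      (MeasureTheory.volume : MeasureTheory.Measure ℝ) |(J : ℝ)|) :
      |J| = OrbitJacobian.jacobianValue n := by
    have h1 := h.eq_jacobianNorm OrbitJacobian.isModulus_volume_real hn (abs_nonneg _)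
    rw [OrbitJacobian.jacobianNorm_real] at h1
    rw [← abs_of_pos (OrbitJacobian.jacobianValue_pos n)]
    exact_mod_cast h1
  refine ⟨⟨OrbitJacobian.jacobianValue n, (OrbitJacobian.jacobianValue_pos n).ne', ?_, ?_⟩,
    fun J h => hreal J h.2.1, hreal, ?_⟩
  · rw [← OrbitJacobian.jacobianNorm_real]
    exact OrbitJacobian.jacobianFormula_jacobianNorm OrbitJacobian.isModulus_volume_real hn
  · intro p _
    rw [← OrbitJacobian.jacobianNorm_padicInt]
    exact OrbitJacobian.jacobianFormula_jacobianNorm OrbitJacobian.isModulus_padicMeasure hn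
  · intro p _ J h
    rw [← OrbitJacobian.jacobianNorm_padicInt]
    exact h.eq_jacobianNorm OrbitJacobian.isModulus_padicMeasure hn (norm_nonneg _)
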